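/- Let $U\subset\mathbb C^m$ be open and let $d\ge 0$. Let $\mathcal A=C^\infty(U\times\mathbb C^{0|d})$ be the Grassmann algebra over $C^\infty(U)$ (complex-valued, real-smooth functions) with odd generators $\theta^1,\dots,\theta^d,\bar\theta^1,\dots,\bar\theta^d$. Every $f\in\mathcal A$ is uniquely $f=\sum_{I,J\subset\{1,\dots,d\}}f_{IJ}\theta^I\bar\theta^J$ with $f_{IJ}\in C^\infty(U)$, where $\theta^I$ and $\bar\theta^J$ are the products of the generators in increasing order. For an algebra $\mathcal B$, $\mathcal B[\nu^{-1},\nu]]$ denotes the formal Laurent series in $\nu$ with finite principal part. Let $\star$ be a (possibly degenerate) star product with separation of variables on $U$, that is, an associative product $f\star g=\sum_{r\ge0}\nu^rC_r(f,g)$ on $C^\infty(U)[\nu^{-1},\nu]]$ with unit $1$, where the $C_r$ are $\mathbb C$-bilinear on $C^\infty(U)$, extended $\nu$-linearly, and are differential operators in each argument, $C_0(f,g)=fg$, and $a\star f=af$, $f\star b=fb$ for all locally defined holomorphic $a$ and antiholomorphic $b$. Let $Y=\nu^{-1}Y_{-1}+Y_0+\nu Y_1+\cdots$, $Y_r\in\mathcal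 A$, be a nondegenerate nilpotent potential: $Y$ is even and nilpotent, and the $d\times d$ matrix $\bigl(\overrightarrow{\tfrac{\partial}{\partial\theta^\alpha}}\,Y_{-1}\,\overleftarrow{\tfrac{\partial}{\partial\bar\theta^\beta}}\bigr)$ is nondegenerate at every point of $U$. Put $u=e^Y=\sum u_{PQ}\theta^P\bar\theta^Q$. Then $u$ is admissible with respect to $\star$, i.e. the $2^d\times2^d$ matrix $(u_{PQ})$ is invertible over the algebra $(C^\infty(U)[\nu^{-1},\nu]],\star)$, so that the map $(F_{KI})\mapsto u^{-1}\sum_{K,I,L}(F_{KI}\star u_{IL})\,\theta^K\bar\theta^L$ from the algebra of $2^d\times2^d$ matrices over $(C^\infty(U)[\nu^{-1},\nu]],\star)$ to $\mathcal A[\nu^{-1},\nu]]$ is a bijection. Let $\ast$ be the product on $\mathcal A[\nu^{-1},\nu]]$ transferred from the matrix product by this bijection (the product associated with the pair $(\star,e^Y)$), and for $f\in\mathcal A[\nu^{-1},\nu]]$ let $L_fg=f\ast g$. For every $f\in\mathcal A[\nu^{-1},\nu]]$ the operator $L_f$ is natural if and only if $f$ contains no terms with negative powers of $\nu$. Here an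 operator is natural if it has the form $A_0+\nu A_1+\nu^2A_2+\cdots$, where $A_k$ is a differential operator on $\mathcal A$ of order not greater than $k$, i.e. a $\mathbb C$-linear operator on $\mathcal A$ with $[f_k,[f_{k-1},\dots[f_0,A_k]\dots]]=0$ for all $f_0,\dots,f_k\in\mathcal A$ ($\mathbb Z_2$-graded commutators with left multiplication operators). -/

import Mathlib

open scoped ContDiff

namespace SuperStar

noncomputable section

/-! ### Smooth functions on an open subset of `ℂᵐ` -/

/-- The algebra `C^∞(U)` of complex-valued functions on the open set `U ⊆ ℂᵐ` that are smooth in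
the real sense. -/
def smoothSubalgebra {m : ℕ} (U : TopologicalSpace.Opens (Fin m → ℂ)) :
    Subalgebra ℂ (U → ℂ) where
  carrier := {f | ∃ F : (Fin m → ℂ) → ℂ, ContDiffOn ℝ ∞ F U ∧ ∀ x : U, F x = f x}
  mul_mem' := by
    rintro f g ⟨F, hF, hf⟩ ⟨G, hG, hg⟩
    exact ⟨fun x => F x * G x, hF.mul hG, fun x => by simp [hf, hg]⟩
  add_mem' := by
    rintro f g ⟨F, hF, hf⟩ ⟨G, hG, hg⟩
    exact ⟨fun x => F x + G x, hF.add hG, fun x => by simp [hf, hg]⟩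
  algebraMap_mem' c := ⟨fun _ => c, contDiffOn_const, fun _ => rfl⟩

/-- `C^∞(U)` as a type. -/
def Smooth {m : ℕ} (U : TopologicalSpace.Opens (Fin m → ℂ)) : Type :=
  smoothSubalgebra U

instance {m : ℕ} (U : TopologicalSpace.Opens (Fin m → ℂ)) : CommRing (Smooth U) :=
  inferInstanceAs (CommRing (smoothSubalgebra U))

instance {m : ℕ} (U : TopologicalSpace.Opens (Fin m → ℂ)) : Algebra ℂ (Smooth U) :=
  inferInstanceAs (Algebra ℂ (smoothSubalgebra U))

instance {m : ℕ} (U : TopologicalSpace.Opens (Fin m → ℂ)) : Algebra ℚ (Smooth U) :=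
  inferInstanceAs (Algebra ℚ (smoothSubalgebra U))

instance {m : ℕ} (U : TopologicalSpace.Opens (Fin m → ℂ)) :
    CoeFun (Smooth U) (fun _ => U → ℂ) :=
  ⟨fun f => (show smoothSubalgebra U from f).1⟩

/-- The smooth function `a` on `U` is holomorphic on the subset `V` of `U`. -/
def HolomorphicOn {m : ℕ} {U : TopologicalSpace.Opens (Fin m → ℂ)}
    (V : TopologicalSpace.Opens (Fin m → ℂ)) (a : Smooth U) : Prop :=
  ∃ F : (Fin m → ℂ) → ℂ, DifferentiableOn ℂ F V ∧
    ∀ x : U, (x : Fin m → ℂ) ∈ V → F x = a x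

/-- The smooth function `b` on `U` is antiholomorphic on the subset `V` of `U`: its complex
conjugate is holomorphic there. -/
def AntiholomorphicOn {m : ℕ} {U : TopologicalSpace.Opens (Fin m → ℂ)}
    (V : TopologicalSpace.Opens (Fin m → ℂ)) (b : Smooth U) : Prop :=
  ∃ F : (Fin m → ℂ) → ℂ, DifferentiableOn ℂ F V ∧
    ∀ x : U, (x : Fin m → ℂ) ∈ V → F x = starRingEnd ℂ (b x)

/-! ### Differential operators on a superalgebra and natural formal operators

A `ℤ₂`-grading of a complex algebra `A` is encoded by its parity automorphism `γ`, which is `1` on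
even elements and `-1` on odd elements; `γ = id` is the trivial grading. -/

section DiffOp

variable {A : Type*} [Ring A] [Algebra ℂ A]

/-- The even component of `f`. -/
def evenPart (γ : A →ₐ[ℂ] A) (f : A) : A := (2⁻¹ : ℂ) • (f + γ f)

/-- The odd component of `f`. -/
def oddPart (γ : A →ₐ[ℂ] A) (f : A) : A := (2⁻¹ : ℂ) • (f - γ f)

/-- The `ℤ₂`-graded commutator `[f, T]` of the operator of left multiplication by `f` with the
operator `T`, i.e. the bilinear extension of `[f, T] = f T - (-1)^{|f||T|} T f` from homogeneous
`f` and `T`. (Conjugation by `γ` multiplies a homogeneous operator `T` by `(-1)^{|T|}`.) -/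
def superComm (γ : A →ₐ[ℂ] A) (f : A) (T : A →ₗ[ℂ] A) : A →ₗ[ℂ] A :=
  LinearMap.mulLeft ℂ f ∘ₗ T
    - T ∘ₗ LinearMap.mulLeft ℂ (evenPart γ f)
    - (γ.toLinearMap ∘ₗ T ∘ₗ γ.toLinearMap) ∘ₗ LinearMap.mulLeft ℂ (oddPart γ f)

/-- `T` is a differential operator of order not greater than `n`:
`[f_n, [f_{n-1}, … [f_0, T] … ]] = 0` for all `f_0, …, f_n`. -/
def DiffOpOrderLE (γ : A →ₐ[ℂ] A) : ℕ → (A →ₗ[ℂ] A) → Prop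
  | 0, T => ∀ f : A, superComm γ f T = 0
  | n + 1, T => ∀ f : A, DiffOpOrderLE γ n (superComm γ f T)

/-- `T` is a differential operator. -/
def IsDiffOp (γ : A →ₐ[ℂ] A) (T : A →ₗ[ℂ] A) : Prop := ∃ n, DiffOpOrderLE γ n T

/-- The operator `T` on formal Laurent series is a natural formal differential operator:
`T = T_0 + ν T_1 + ν² T_2 + …`, where `T_k` is a differential operator on `A` of order not greater
than `k`. -/
def IsNatural (γ : A →ₐ[ℂ] A) (T : LaurentSeries A → LaurentSeries A) : Prop :=
  ∃ D : ℕ → (A →ₗ[ℂ] A), (∀ k, DiffOpOrderLE γ k (D k)) ∧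
    ∀ (g : LaurentSeries A) (n : ℤ), (T g).coeff n = ∑ᶠ k : ℕ, D k (g.coeff (n - k))

end DiffOp

/-! ### Star products with separation of variables on `U` -/

/-- The coefficient at `ν^n` of the product `f ⋆ g = ∑_{r ≥ 0} ν^r C_r(f, g)` on
`C^∞(U)[ν⁻¹, ν]]` given by bilinear maps `C_r` on `C^∞(U)`, which are extended by `ν`-linearity.
Only finitely many terms of the sum are nonzero. -/
def starCoeff {m : ℕ} {U : TopologicalSpace.Opens (Fin m → ℂ)}
    (C : ℕ → Smooth U →ₗ[ℂ] Smooth U →ₗ[ℂ] Smooth U) (f g : LaurentSeries (Smooth U)) (n : ℤ) :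
    Smooth U :=
  ∑ᶠ p : ℕ × ℤ, C p.1 (f.coeff p.2) (g.coeff (n - p.1 - p.2))

theorem bddBelow_starCoeff {m : ℕ} {U : TopologicalSpace.Opens (Fin m → ℂ)}
    (C : ℕ → Smooth U →ₗ[ℂ] Smooth U →ₗ[ℂ] Smooth U) (f g : LaurentSeries (Smooth U)) :
    BddBelow (Function.support (starCoeff C f g)) := by
  refine ⟨f.order + g.order, fun n hn => ?_⟩
  by_contra hlt
  rw [not_le] at hlt
  refine hn ?_
  refine finsum_eq_zero_of_forall_eq_zero fun p => ?_
  by_cases h : p.2 < f.order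
  · simp [HahnSeries.coeff_eq_zero_of_lt_order h]
  · have h' : n - p.1 - p.2 < g.order := by omega
    simp [HahnSeries.coeff_eq_zero_of_lt_order h']

/-- The product `f ⋆ g = ∑_{r ≥ 0} ν^r C_r(f, g)` on `C^∞(U)[ν⁻¹, ν]]`. -/
def starMul {m : ℕ} {U : TopologicalSpace.Opens (Fin m → ℂ)}
    (C : ℕ → Smooth U →ₗ[ℂ] Smooth U →ₗ[ℂ] Smooth U) (f g : LaurentSeries (Smooth U)) :
    LaurentSeries (Smooth U) :=
  HahnSeries.ofSuppBddBelow (starCoeff C f g) (bddBelow_starCoeff C f g)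

/-- A (possibly degenerate) star product with separation of variables (of the anti-Wick type) on
the open set `U ⊆ ℂᵐ`. The last two fields say that `a ⋆ f = a f` and `f ⋆ b = f b` for all
locally defined holomorphic functions `a` and antiholomorphic functions `b`; since the operators
`C_r` are local, it is enough to speak of the functions on `U` that are holomorphic
(antiholomorphic) on an open set `V ⊆ U`. -/
structure StarProductSV {m : ℕ} (U : TopologicalSpace.Opens (Fin m → ℂ)) where
  /-- the bilinear maps `C_r` in `f ⋆ g = ∑ ν^r C_r(f, g)` -/
  C : ℕ → Smooth U →ₗ[ℂ] Smooth U →ₗ[ℂ] Smooth U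
  isDiffOp_left : ∀ (f : Smooth U) (r : ℕ), IsDiffOp (AlgHom.id ℂ (Smooth U)) (C r f)
  isDiffOp_right : ∀ (f : Smooth U) (r : ℕ), IsDiffOp (AlgHom.id ℂ (Smooth U)) ((C r).flip f)
  C_zero : ∀ f g : Smooth U, C 0 f g = f * g
  assoc : ∀ f g h : LaurentSeries (Smooth U),
    starMul C (starMul C f g) h = starMul C f (starMul C g h)
  one_star : ∀ f : LaurentSeries (Smooth U), starMul C 1 f = f
  star_one : ∀ f : LaurentSeries (Smooth U), starMul C f 1 = f
  holomorphic_star : ∀ V : TopologicalSpace.Opens (Fin m → ℂ), V ≤ U →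
    ∀ a f : Smooth U, HolomorphicOn V a →
      ∀ r : ℕ, r ≠ 0 → ∀ x : U, (x : Fin m → ℂ) ∈ V → C r a f x = 0
  star_antiholomorphic : ∀ V : TopologicalSpace.Opens (Fin m → ℂ), V ≤ U →
    ∀ f b : Smooth U, AntiholomorphicOn V b →
      ∀ r : ℕ, r ≠ 0 → ∀ x : U, (x : Fin m → ℂ) ∈ V → C r f b x = 0

/-- The product `f ⋆ g` on `C^∞(U)[ν⁻¹, ν]]`. -/
def StarProductSV.mul {m : ℕ} {U : TopologicalSpace.Opens (Fin m → ℂ)} (S : StarProductSV U)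
    (f g : LaurentSeries (Smooth U)) : LaurentSeries (Smooth U) :=
  starMul S.C f g

/-! ### Functions on `U × ℂ^{0|d}` -/

section Grassmann

variable {m : ℕ} (U : TopologicalSpace.Opens (Fin m → ℂ)) (d : ℕ)

/-- The algebra `C^∞(U × ℂ^{0|d})`: the Grassmann algebra over `C^∞(U)` with the `2 d` odd
generators `θ¹, …, θᵈ, θ̄¹, …, θ̄ᵈ` (in this order). -/
abbrev SuperFun : Type := ExteriorAlgebra (Smooth U) (Fin d ⊕ₗ Fin d → Smooth U)

variable {d}

/-- The odd coordinate `θ^α`. -/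
def theta (α : Fin d) : SuperFun U d :=
  ExteriorAlgebra.ι (Smooth U) (Pi.single (toLex (Sum.inl α)) 1)

/-- The odd coordinate `θ̄^β`. -/
def thetaBar (β : Fin d) : SuperFun U d :=
  ExteriorAlgebra.ι (Smooth U) (Pi.single (toLex (Sum.inr β)) 1)

/-- The monomial `θ^I θ̄^J`, the factors in each of `θ^I` and `θ̄^J` being taken in the increasing
order of the indices. -/
def monomial (I J : Finset (Fin d)) : SuperFun U d :=
  (I.sort.map (theta U)).prod * (J.sort.map (thetaBar U)).prod

variable (d)

/-- The basis of `C^∞(U × ℂ^{0|d})` over `C^∞(U)` that consists of the products of distinct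
generators taken in the increasing order. -/
def superBasis : Module.Basis (Finset (Fin d ⊕ₗ Fin d)) (Smooth U) (SuperFun U d) :=
  (Pi.basisFun (Smooth U) (Fin d ⊕ₗ Fin d)).ExteriorAlgebra

variable {d}

/-- The set of generators that occur in `θ^I θ̄^J`. -/
def pairIndex (I J : Finset (Fin d)) : Finset (Fin d ⊕ₗ Fin d) :=
  (I.disjSum J).map toLex.toEmbedding

variable {U}

/-- The basis element with index `pairIndex I J` is the monomial `θ^I θ̄^J`. -/
theorem superBasis_pairIndex (I J : Finset (Fin d)) :
    superBasis U d (pairIndex I J) = monomial U I J := by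
  have hsort : ∀ s : Finset (Fin d ⊕ₗ Fin d), superBasis U d s =
      (s.sort.map fun i => ExteriorAlgebra.ι (Smooth U)
        (Pi.single i 1 : Fin d ⊕ₗ Fin d → Smooth U)).prod := by
    intro s
    have hl : s.sort = List.ofFn (s.orderEmbOfFin rfl) := by
      apply List.ext_getElem
      · simp
      · intro i h1 h2
        simp [Finset.orderEmbOfFin_apply]
    rw [superBasis, ExteriorAlgebra.basis_apply_ofCard _ rfl, hl, List.map_ofFn,
      ExteriorAlgebra.ιMulti_family, ExteriorAlgebra.ιMulti_apply]
    congr 2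
    funext i
    simp [Set.powersetCard.ofFinEmbEquiv_symm_apply]
  have hpair : (pairIndex I J).sort =
      I.sort.map (fun i => toLex (Sum.inl i)) ++ J.sort.map (fun j => toLex (Sum.inr j)) := by
    refine (pairIndex I J).sortedLT_sort.eq_of_mem_iff ?_ ?_
    · refine List.Pairwise.sortedLT (List.pairwise_append.2 ⟨?_, ?_, ?_⟩)
      · exact List.pairwise_map.2 (I.sortedLT_sort.pairwise.imp fun h => Sum.Lex.inl_lt_inl_iff.2 h)
      · exact List.pairwise_map.2 (J.sortedLT_sort.pairwise.imp fun h => Sum.Lex.inr_lt_inr_iff.2 h)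
      · intro a ha b hb
        obtain ⟨i, -, rfl⟩ := List.mem_map.1 ha
        obtain ⟨j, -, rfl⟩ := List.mem_map.1 hb
        exact Sum.Lex.inl_lt_inr i j
    · intro a
      simp only [Finset.mem_sort, List.mem_append, List.mem_map, pairIndex, Finset.mem_map,
        Finset.mem_disjSum, Equiv.coe_toEmbedding]
      aesop
  rw [hsort, hpair, List.map_append, List.prod_append, List.map_map, List.map_map]
  rfl

/-- The coefficient `f_{IJ} ∈ C^∞(U)` in `f = ∑ f_{IJ} θ^I θ̄^J`. -/
def coeffIJ (I J : Finset (Fin d)) : SuperFun U d →ₗ[Smooth U] Smooth U :=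
  (superBasis U d).coord (pairIndex I J)

variable (U d)

/-- The parity automorphism of `C^∞(U × ℂ^{0|d})`: it sends each odd generator to its negative. -/
def parity : SuperFun U d →ₐ[ℂ] SuperFun U d :=
  (CliffordAlgebra.involute (Q := (0 : QuadraticForm (Smooth U) (Fin d ⊕ₗ Fin d → Smooth U)))
    ).restrictScalars ℂ

variable {U d}

/-- The left partial derivative with respect to `θ^α`. -/
def dTheta (α : Fin d) (f : SuperFun U d) : SuperFun U d :=
  CliffordAlgebra.contractLeft (LinearMap.proj (toLex (Sum.inl α))) f

/-- The right partial derivative with respect to `θ̄^β`. -/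
def dThetaBarRight (β : Fin d) (f : SuperFun U d) : SuperFun U d :=
  CliffordAlgebra.contractRight f (LinearMap.proj (toLex (Sum.inr β)))

/-- The value of `f` at `θ = θ̄ = 0`. -/
def body (f : SuperFun U d) : Smooth U := ExteriorAlgebra.algebraMapInv f

/-- The formal function `f` on `U × ℂ^{0|d}` is even. -/
def IsEven (f : LaurentSeries (SuperFun U d)) : Prop := ∀ n, parity U d (f.coeff n) = f.coeff n

/-- The component `f_{IJ} ∈ C^∞(U)[ν⁻¹, ν]]` of a formal function `f = ∑ f_{IJ} θ^I θ̄^J`. -/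
def comp (f : LaurentSeries (SuperFun U d)) (I J : Finset (Fin d)) : LaurentSeries (Smooth U) :=
  f.map (coeffIJ I J)

/-- The formal function `∑ h_{IJ} θ^I θ̄^J` with given components. -/
def ofComp (h : Finset (Fin d) → Finset (Fin d) → LaurentSeries (Smooth U)) :
    LaurentSeries (SuperFun U d) :=
  ∑ I, ∑ J, (h I J).map (LinearMap.toSpanSingleton (Smooth U) (SuperFun U d) (monomial U I J))

/-! ### The product associated with a pair `(⋆, u)` -/

/-- The product of the algebra of `2^d × 2^d`-matrices over `(C^∞(U)[ν⁻¹, ν]], ⋆)` whose entries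
are indexed by the subsets of `{1, …, d}`. -/
def matMul (S : StarProductSV U)
    (F G : Matrix (Finset (Fin d)) (Finset (Fin d)) (LaurentSeries (Smooth U))) :
    Matrix (Finset (Fin d)) (Finset (Fin d)) (LaurentSeries (Smooth U)) :=
  fun K J => ∑ I, S.mul (F K I) (G I J)

/-- The even formal function `u` with `u_{∅∅} = 1` is admissible with respect to `⋆`: the matrix
`(u_{PQ})` has an inverse `(v^{QP})` over the algebra `(C^∞(U)[ν⁻¹, ν]], ⋆)`. -/
def IsAdmissible (S : StarProductSV U) (u : LaurentSeries (SuperFun U d)) : Prop :=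
  IsEven u ∧ comp u ∅ ∅ = 1 ∧
    ∃ v : Matrix (Finset (Fin d)) (Finset (Fin d)) (LaurentSeries (Smooth U)),
      matMul S (comp u) v = 1 ∧ matMul S v (comp u) = 1

/-- The mapping `(f_K^I) ↦ u⁻¹ (f_K^I ⋆ u_{IL}) θ^K θ̄^L` from matrices (with rows `K` and
columns `I`) to formal functions. It is bijective when `u` is admissible. -/
def ofMatrix (S : StarProductSV U) (u : LaurentSeries (SuperFun U d))
    (F : Matrix (Finset (Fin d)) (Finset (Fin d)) (LaurentSeries (Smooth U))) :
    LaurentSeries (SuperFun U d) :=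
  Ring.inverse u * ofComp fun K L => ∑ I, S.mul (F K I) (comp u I L)

/-- The operator `L_f : g ↦ f ∗ g` of left multiplication for the product `∗` associated with the
pair `(⋆, u)`, where `u` is admissible: `∗` is the product transferred from the algebra of
matrices over `(C^∞(U)[ν⁻¹, ν]], ⋆)` via the bijection `ofMatrix`. -/
def leftMul (S : StarProductSV U) (u f : LaurentSeries (SuperFun U d)) :
    LaurentSeries (SuperFun U d) → LaurentSeries (SuperFun U d) :=
  fun g => ofMatrix S u
    (matMul S (Function.invFun (ofMatrix S u) f) (Function.invFun (ofMatrix S u) g))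

/-- `Y` is a nondegenerate nilpotent potential: an even nilpotent formal function
`Y = ν⁻¹ Y_{-1} + Y_0 + ν Y_1 + …` such that the matrix of the functions obtained from `Y_{-1}` by
a left derivative with respect to `θ^α` and a right derivative with respect to `θ̄^β` is
nondegenerate at every point of `U`. -/
structure IsNondegeneratePotential (Y : LaurentSeries (SuperFun U d)) : Prop where
  coeff_eq_zero : ∀ n < (-1 : ℤ), Y.coeff n = 0
  even : IsEven Y
  nilpotent : IsNilpotent Y
  nondegenerate : ∀ x : U, (Matrix.of fun α β : Fin d =>
    body (dThetaBarRight β (dTheta α (Y.coeff (-1)))) x).det ≠ 0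

end Grassmann

end

end SuperStar

open SuperStar

/-! Put u = e^Y. A matrix F over the star algebra determines an operator N by the rule that the
component matrix of u · N x is F ⋆ (component matrix of u · x). Once u is admissible, N is L_f with
f = N 1 (`IsAdmissible.leftMul_eq_act`). One direction is then immediate: f = L_f 1, and a natural
operator produces no negative powers of ν from 1.

For the other direction enough natural operators of this kind are needed; `IsRep` records such a
pair (F, N). Multiplication by θ^α, the operator ν ∂/∂θ^α and coefficientwise left star
multiplication by a function are natural and act on component matrices by left multiplication. For
the third one this uses that C_r(f, ·) has order at most r, which follows from separation of
variables (`isNaturalStar_of_separation`). To act on the components of u x, these operators are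
conjugated by e^Y. The conjugation is a finite series in commutators with Y; a commutator with ν⁻¹
Y_{-1} lowers the power of ν by one and the order of the operator by one, so naturality survives
(`IsNaturalOp.exp_conj`).

The term N_0 of a natural operator has order zero, hence is multiplication by N_0 1. So the leading
terms N_0 1 are closed under sums and products. They include θ^α, ∂Y_{-1}/∂θ^α and a function with
any prescribed body. Since Y_{-1} is nondegenerate, the functions θ^α and ∂Y_{-1}/∂θ^α generate the
augmentation ideal modulo its square; the ideal is nilpotent, so every function is a leading term
(`mem_of_isUnit_det`, `IsNondegeneratePotential.isLeading`). Correcting one power of ν at a time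
shows that every f without negative powers is N 1 for some pair
(`IsNondegeneratePotential.exists_isRep`).

Admissibility comes from the same result. Applied to a power of ν times u⁻¹ ∑ θ^I θ̄^I, it yields a
left inverse of the matrix of u. Interchanging θ with θ̄ and passing to the opposite star product
yields a right inverse. -/

namespace SuperStar
noncomputable section

/-! ### Calculus of differential operators on a superalgebra -/

section DiffOpCalculus

variable {A : Type*} [Ring A] [Algebra ℂ A] {γ : A →ₐ[ℂ] A}

/-- `T` is a differential operator of order less than `n`; of order less than `0` is only the zero
operator. -/
def DiffOpOrderLT (γ : A →ₐ[ℂ] A) : ℕ → (A →ₗ[ℂ] A) → Prop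
  | 0, T => T = 0
  | n + 1, T => ∀ f : A, DiffOpOrderLT γ n (superComm γ f T)

theorem diffOpOrderLE_iff_lt {n : ℕ} : ∀ {T : A →ₗ[ℂ] A},
    DiffOpOrderLE γ n T ↔ DiffOpOrderLT γ (n + 1) T := by
  induction n with
  | zero => exact Iff.rfl
  | succ n ih => exact forall_congr' fun f => ih

theorem superComm_apply (f : A) (T : A →ₗ[ℂ] A) (x : A) : superComm γ f T x =
    f * T x - T (evenPart γ f * x) - γ (T (γ (oddPart γ f * x))) := rfl

theorem superComm_add (f : A) (T S : A →ₗ[ℂ] A) :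
    superComm γ f (T + S) = superComm γ f T + superComm γ f S := by
  ext x
  simp only [superComm_apply, LinearMap.add_apply, mul_add, map_add]
  abel

theorem superComm_smul (f : A) (c : ℂ) (T : A →ₗ[ℂ] A) :
    superComm γ f (c • T) = c • superComm γ f T := by
  ext x
  simp only [superComm_apply, LinearMap.smul_apply, map_smul, smul_sub, mul_smul_comm]

theorem superComm_zero (f : A) : superComm γ f 0 = 0 := by
  ext x
  simp [superComm_apply]

namespace DiffOpOrderLT

theorem zero (n : ℕ) : DiffOpOrderLT γ n 0 := by
  induction n with
  | zero => rfl
  | succ n ih => intro f; rwa [superComm_zero]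

theorem add {n : ℕ} : ∀ {T S : A →ₗ[ℂ] A}, DiffOpOrderLT γ n T → DiffOpOrderLT γ n S →
    DiffOpOrderLT γ n (T + S) := by
  induction n with
  | zero => rintro T S rfl rfl; exact add_zero _
  | succ n ih =>
    intro T S hT hS f
    rw [superComm_add]
    exact ih (hT f) (hS f)

theorem smul {n : ℕ} (c : ℂ) : ∀ {T : A →ₗ[ℂ] A}, DiffOpOrderLT γ n T →
    DiffOpOrderLT γ n (c • T) := by
  induction n with
  | zero => rintro T rfl; exact smul_zero _
  | succ n ih =>
    intro T hT f
    rw [superComm_smul]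
    exact ih (hT f)

theorem neg {n : ℕ} {T : A →ₗ[ℂ] A} (hT : DiffOpOrderLT γ n T) : DiffOpOrderLT γ n (-T) := by
  rw [← neg_one_smul ℂ T]
  exact hT.smul _

theorem sum {n : ℕ} {ι : Type*} (s : Finset ι) {T : ι → A →ₗ[ℂ] A}
    (hT : ∀ i ∈ s, DiffOpOrderLT γ n (T i)) : DiffOpOrderLT γ n (∑ i ∈ s, T i) :=
  Finset.sum_induction _ _ (fun _ _ => add) (zero n) hT

theorem succ {n : ℕ} : ∀ {T : A →ₗ[ℂ] A}, DiffOpOrderLT γ n T → DiffOpOrderLT γ (n + 1) T := by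
  induction n with
  | zero => rintro T rfl f; exact superComm_zero f
  | succ n ih => exact fun hT f => ih (hT f)

theorem mono {n k : ℕ} (h : n ≤ k) {T : A →ₗ[ℂ] A} (hT : DiffOpOrderLT γ n T) :
    DiffOpOrderLT γ k T := by
  induction k, h using Nat.le_induction with
  | base => exact hT
  | succ k _ ih => exact ih.succ

end DiffOpOrderLT

theorem evenPart_add_oddPart (f : A) : evenPart γ f + oddPart γ f = f := by
  rw [evenPart, oddPart, ← smul_add, add_add_sub_cancel, ← two_smul ℂ, smul_smul]
  norm_num

theorem evenPart_of_even {f : A} (h : γ f = f) : evenPart γ f = f := by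
  rw [evenPart, h, ← two_smul ℂ, smul_smul]
  norm_num

theorem oddPart_of_even {f : A} (h : γ f = f) : oddPart γ f = 0 := by
  rw [oddPart, h, sub_self, smul_zero]

theorem evenPart_of_odd {f : A} (h : γ f = -f) : evenPart γ f = 0 := by
  rw [evenPart, h, add_neg_cancel, smul_zero]

theorem oddPart_of_odd {f : A} (h : γ f = -f) : oddPart γ f = f := by
  rw [oddPart, h, sub_neg_eq_add, ← two_smul ℂ, smul_smul]
  norm_num

theorem superComm_of_even {f : A} (h : γ f = f) (T : A →ₗ[ℂ] A) :
    superComm γ f T = LinearMap.mulLeft ℂ f ∘ₗ T - T ∘ₗ LinearMap.mulLeft ℂ f := by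
  ext x
  simp [superComm_apply, evenPart_of_even h, oddPart_of_even h]

/-- The conjugate of an operator by the parity automorphism. -/
def twist (γ : A →ₐ[ℂ] A) (T : A →ₗ[ℂ] A) : A →ₗ[ℂ] A := γ.toLinearMap ∘ₗ T ∘ₗ γ.toLinearMap

theorem map_evenPart (hγ : ∀ x, γ (γ x) = x) (f : A) : γ (evenPart γ f) = evenPart γ f := by
  rw [evenPart, map_smul, map_add, hγ, add_comm]

theorem map_oddPart (hγ : ∀ x, γ (γ x) = x) (f : A) : γ (oddPart γ f) = -oddPart γ f := by
  rw [oddPart, map_smul, map_sub, hγ, ← smul_neg, neg_sub]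

theorem evenPart_map (hγ : ∀ x, γ (γ x) = x) (f : A) : evenPart γ (γ f) = evenPart γ f := by
  rw [evenPart, evenPart, hγ, add_comm]

theorem oddPart_map (hγ : ∀ x, γ (γ x) = x) (f : A) : oddPart γ (γ f) = -oddPart γ f := by
  rw [oddPart, oddPart, hγ, ← smul_neg, neg_sub]

theorem superComm_twist (hγ : ∀ x, γ (γ x) = x) (f : A) (T : A →ₗ[ℂ] A) :
    superComm γ (γ f) (twist γ T) = twist γ (superComm γ f T) := by
  ext x
  simp [superComm_apply, twist, evenPart_map hγ, oddPart_map hγ, map_evenPart hγ,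
    map_oddPart hγ, hγ]

/-- Needed for compositions, because an odd multiplication that passes T conjugates T by γ. -/
theorem DiffOpOrderLT.twist (hγ : ∀ x, γ (γ x) = x) {n : ℕ} : ∀ {T : A →ₗ[ℂ] A},
    DiffOpOrderLT γ n T → DiffOpOrderLT γ n (twist γ T) := by
  induction n with
  | zero => rintro T rfl; ext x; simp [SuperStar.twist]
  | succ n ih =>
    intro T hT f
    have := ih (hT (γ f))
    rwa [← superComm_twist hγ, hγ] at this

/-- The graded Leibniz rule; `twist γ T` carries the sign that the odd part of f acquires when it
passes T. -/
theorem superComm_comp (hγ : ∀ x, γ (γ x) = x) (f : A) (T S : A →ₗ[ℂ] A) :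
    superComm γ f (T ∘ₗ S) = superComm γ f T ∘ₗ S + T ∘ₗ superComm γ (evenPart γ f) S
      + twist γ T ∘ₗ superComm γ (oddPart γ f) S := by
  ext x
  simp only [superComm_apply, twist, LinearMap.comp_apply, LinearMap.add_apply, map_sub,
    evenPart_of_even (map_evenPart hγ f), oddPart_of_even (map_evenPart hγ f),
    evenPart_of_odd (map_oddPart hγ f), oddPart_of_odd (map_oddPart hγ f), zero_mul, map_zero,
    sub_zero, AlgHom.toLinearMap_apply, hγ]
  abel

/-- The bounds are strict: orders at most p - 1 and q - 1 compose to order at most p + q - 2, that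
is, less than p + q - 1. The induction runs on the Leibniz rule. -/
theorem DiffOpOrderLT.comp (hγ : ∀ x, γ (γ x) = x) {n : ℕ} : ∀ {p q : ℕ} {T S : A →ₗ[ℂ] A},
    p + q ≤ n + 1 → DiffOpOrderLT γ p T → DiffOpOrderLT γ q S →
    DiffOpOrderLT γ n (T ∘ₗ S) := by
  induction n with
  | zero =>
    intro p q T S hpq hT hS
    rcases p with _ | p
    · rw [show T = 0 from hT, LinearMap.zero_comp]; exact .zero _
    · obtain rfl : q = 0 := by omega
      rw [show S = 0 from hS, LinearMap.comp_zero]; exact .zero _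
  | succ n ih =>
    intro p q T S hpq hT hS
    rcases p with _ | p
    · rw [show T = 0 from hT, LinearMap.zero_comp]; exact .zero _
    rcases q with _ | q
    · rw [show S = 0 from hS, LinearMap.comp_zero]; exact .zero _
    intro f
    rw [superComm_comp hγ]
    exact ((ih (by omega) (hT f) hS).add (ih (by omega) hT (hS _))).add
      (ih (by omega) (hT.twist hγ) (hS _))

/-- The algebra `A` with the parity automorphism `γ` is supercommutative. -/
def IsSuperCommutative (γ : A →ₐ[ℂ] A) : Prop :=
  ∀ f g : A, f * g = g * evenPart γ f + γ g * oddPart γ f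

theorem IsSuperCommutative.mulLeft (hc : IsSuperCommutative γ) (hγ : ∀ x, γ (γ x) = x) (a : A) :
    DiffOpOrderLT γ 1 (LinearMap.mulLeft ℂ a) := by
  intro f
  refine LinearMap.ext fun x => ?_
  simp only [superComm_apply, LinearMap.mulLeft_apply, map_mul, hγ, LinearMap.zero_apply]
  rw [← mul_assoc, hc f a]
  noncomm_ring

/-- An operator of order zero supercommutes with multiplications, so its value at f = f · 1 is
determined by its value at 1. -/
theorem DiffOpOrderLT.eq_mulLeft (hc : IsSuperCommutative γ) (hγ : ∀ x, γ (γ x) = x)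
    {T : A →ₗ[ℂ] A} (hT : DiffOpOrderLT γ 1 T) : T = LinearMap.mulLeft ℂ (T 1) := by
  have key : ∀ f, f * T 1 = T (evenPart γ f) + γ (T (γ (oddPart γ f))) := by
    intro f
    have := LinearMap.congr_fun (show superComm γ f T = 0 from hT f) 1
    rw [superComm_apply, mul_one, mul_one, LinearMap.zero_apply, sub_sub, sub_eq_zero] at this
    exact this
  refine LinearMap.ext fun f => ?_
  rw [LinearMap.mulLeft_apply]
  conv_rhs => rw [← evenPart_add_oddPart (γ := γ) f]
  conv_lhs => rw [← evenPart_add_oddPart (γ := γ) f]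
  rw [map_add, mul_add]
  -- The even and odd components are treated separately. The rule for the odd one contains γ, which
  -- `h2` removes by applying γ once more.
  have h0 := key (evenPart γ f)
  have h1 := key (oddPart γ f)
  rw [evenPart_of_even (map_evenPart hγ f), oddPart_of_even (map_evenPart hγ f), map_zero,
    map_zero, map_zero, add_zero, hc, evenPart_of_even (map_evenPart hγ f),
    oddPart_of_even (map_evenPart hγ f), mul_zero, add_zero] at h0
  rw [evenPart_of_odd (map_oddPart hγ f), oddPart_of_odd (map_oddPart hγ f), map_zero,
    zero_add, hc, evenPart_of_odd (map_oddPart hγ f), oddPart_of_odd (map_oddPart hγ f), mul_zero,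
    zero_add, map_oddPart hγ, map_neg, map_neg] at h1
  have h2 := congrArg γ h1
  rw [map_mul, hγ, map_oddPart hγ, map_neg, hγ, mul_neg, neg_inj] at h2
  rw [h0, h2]

end DiffOpCalculus
/-! ### Derivations of the algebra of smooth functions -/

open MeasureTheory Set in
/-- Hadamard's lemma. -/
theorem exists_contDiff_clm_eq_add {E F : Type*} [NormedAddCommGroup E] [NormedSpace ℝ E]
    [NormedAddCommGroup F] [NormedSpace ℝ F] [CompleteSpace F] {G : E → F} (hG : ContDiff ℝ ∞ G)
    (x₀ : E) : ∃ H : E → E →L[ℝ] F, ContDiff ℝ ∞ H ∧ ∀ x, G x = G x₀ + H x (x - x₀) := by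
  -- H x is the integral of G'(x₀ + t (x - x₀)) over 0 ≤ t ≤ 1. It is written as a convolution at 0
  -- of the indicator of (0, 1] with s ↦ χ(s) G'(x₀ - s (x - x₀)), so that smoothness in x follows
  -- from smoothness of convolutions with a parameter. The bump supplies compact support and equals
  -- 1 on [-1, 1].
  let χ : ContDiffBump (0 : ℝ) := ⟨1, 2, one_pos, one_lt_two⟩
  let g : E → ℝ → E →L[ℝ] F := fun p s => χ s • fderiv ℝ G (x₀ - s • (p - x₀))
  have hG' : ContDiff ℝ ∞ (fderiv ℝ G) := hG.fderiv_right (by simp)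
  have hg : ContDiff ℝ ∞ (Function.uncurry g) := by
    refine (χ.contDiff.comp contDiff_snd).smul (hG'.comp ?_)
    exact contDiff_const.sub (contDiff_snd.smul (contDiff_fst.sub contDiff_const))
  let f : ℝ → ℝ := indicator (Ioc 0 1) 1
  have hf : LocallyIntegrable f volume := by
    refine Integrable.locallyIntegrable ?_
    rw [integrable_indicator_iff measurableSet_Ioc]
    exact integrableOn_const (by simp)
  have key := contDiffOn_convolution_right_with_param (n := ⊤) (ContinuousLinearMap.lsmul ℝ ℝ)
    (μ := volume) (f := f) (g := g) (s := univ) (k := Metric.closedBall 0 2) isOpen_univ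
    (isCompact_closedBall _ _) (fun p s _ hs => by
      have : χ s = 0 := χ.zero_of_le_dist (by simpa using (le_of_lt (by simpa using hs)))
      simp [g, this]) hf hg.contDiffOn
  rw [univ_prod_univ, contDiffOn_univ] at key
  refine ⟨_, key.comp (contDiff_id.prodMk (contDiff_const (c := (0 : ℝ)))), fun x => ?_⟩
  have h1 : (convolution f (g x) (ContinuousLinearMap.lsmul ℝ ℝ) volume) 0 =
      ∫ t in (0 : ℝ)..1, fderiv ℝ G (x₀ + t • (x - x₀)) := by
    rw [convolution, intervalIntegral.integral_of_le zero_le_one,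
      ← integral_indicator measurableSet_Ioc]
    congr 1
    ext1 t
    by_cases ht : t ∈ Ioc (0 : ℝ) 1
    · have : χ (-t) = 1 := χ.one_of_mem_closedBall (by
        rw [mem_closedBall_zero_iff, norm_neg, Real.norm_eq_abs, abs_of_pos ht.1]; exact ht.2)
      simp [f, g, ht, this]
    · simp [f, ht]
  have hcont : Continuous fun t : ℝ => fderiv ℝ G (x₀ + t • (x - x₀)) :=
    hG'.continuous.comp (by fun_prop)
  have h2 : ∀ t ∈ uIcc (0 : ℝ) 1, HasDerivAt (fun t : ℝ => G (x₀ + t • (x - x₀)))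
      (fderiv ℝ G (x₀ + t • (x - x₀)) (x - x₀)) t := by
    intro t _
    have hl : HasDerivAt (fun t : ℝ => x₀ + t • (x - x₀)) (x - x₀) t := by
      simpa using ((hasDerivAt_id t).smul_const (x - x₀)).const_add x₀
    exact ((hG.differentiable (by simp)) _).hasFDerivAt.comp_hasDerivAt t hl
  have h3 := intervalIntegral.integral_eq_sub_of_hasDerivAt h2
    ((hcont.clm_apply (continuous_const (y := x - x₀))).intervalIntegrable (μ := volume) 0 1)
  have h4 := ContinuousLinearMap.intervalIntegral_apply
    (hcont.intervalIntegrable (μ := volume) 0 1) (x - x₀)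
  simp only [one_smul, zero_smul, add_zero, add_sub_cancel] at h3
  change G x = G x₀ + (convolution f (g x) (ContinuousLinearMap.lsmul ℝ ℝ) volume 0) (x - x₀)
  rw [h1, h4, h3, add_sub_cancel]

section Smooth

variable {m : ℕ} {U : TopologicalSpace.Opens (Fin m → ℂ)}

/-- Evaluation of smooth functions at a point. -/
def Smooth.eval (x : U) : Smooth U →ₐ[ℂ] ℂ :=
  (Pi.evalAlgHom ℂ (fun _ : U => ℂ) x).comp (smoothSubalgebra U).val

theorem Smooth.ext_eval {f g : Smooth U} (h : ∀ x, Smooth.eval x f = Smooth.eval x g) : f = g :=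
  Subtype.ext (funext h)

variable (U) in
/-- The smooth function on `U` that is the restriction of `F`. -/
def Smooth.restrict (F : (Fin m → ℂ) → ℂ) (hF : ContDiffOn ℝ ∞ F U) : Smooth U :=
  (⟨fun x => F x, F, hF, fun _ => rfl⟩ : smoothSubalgebra U)

theorem Smooth.eval_restrict (F : (Fin m → ℂ) → ℂ) (hF : ContDiffOn ℝ ∞ F U) (x : U) :
    Smooth.eval x (Smooth.restrict U F hF) = F x := rfl

theorem Smooth.exists_restrict (f : Smooth U) : ∃ F hF, Smooth.restrict U F hF = f := by
  obtain ⟨F, hF, h⟩ := (show smoothSubalgebra U from f).2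
  exact ⟨F, hF, Smooth.ext_eval h⟩

variable (U) in
/-- The holomorphic coordinates on `U`. -/
def coordZ (i : Fin m) : Smooth U :=
  Smooth.restrict U (fun x => x i) (contDiff_apply ℝ ℂ i).contDiffOn

variable (U) in
/-- The antiholomorphic coordinates on `U`. -/
def coordZBar (i : Fin m) : Smooth U :=
  Smooth.restrict U (fun x => starRingEnd ℂ (x i))
    (Complex.conjCLE.contDiff.comp (contDiff_apply ℝ ℂ i)).contDiffOn

theorem eval_coordZ (x : U) (i : Fin m) : Smooth.eval x (coordZ U i) = (x : Fin m → ℂ) i := rfl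

theorem eval_coordZBar (x : U) (i : Fin m) :
    Smooth.eval x (coordZBar U i) = starRingEnd ℂ ((x : Fin m → ℂ) i) := rfl

/-- Hadamard's lemma in the coordinates z, z̄. The factor χ is there because U need not be
star-shaped about x. -/
theorem Smooth.exists_sub_eq_sum (f : Smooth U) (x : U) :
    ∃ (χ : Smooth U) (h k : Fin m → Smooth U), Smooth.eval x χ = 1 ∧
      χ * (f - algebraMap ℂ _ (Smooth.eval x f)) =
        ∑ i, ((coordZ U i - algebraMap ℂ _ (Smooth.eval x (coordZ U i))) * h i +
          (coordZBar U i - algebraMap ℂ _ (Smooth.eval x (coordZBar U i))) * k i) := by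
  obtain ⟨F, hF, rfl⟩ := f.exists_restrict
  obtain ⟨r, hr, hrU⟩ := Metric.nhds_basis_closedBall.mem_iff.1 (U.isOpen.mem_nhds x.2)
  let χ : ContDiffBump (x : Fin m → ℂ) := ⟨r / 2, r, half_pos hr, half_lt_self hr⟩
  -- The bump is supported in a closed ball inside U, so the product extends smoothly by zero to ℂᵐ.
  let G : (Fin m → ℂ) → ℂ := fun y => (χ y : ℂ) * (F y - F x)
  have hχ : ContDiff ℝ ∞ fun y => (χ y : ℂ) := Complex.ofRealCLM.contDiff.comp χ.contDiff
  have hG : ContDiff ℝ ∞ G := by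
    rw [contDiff_iff_contDiffAt]
    intro y
    by_cases hy : y ∈ U
    · exact hχ.contDiffAt.mul ((hF.contDiffAt (U.isOpen.mem_nhds hy)).sub contDiffAt_const)
    · have : y ∉ tsupport χ := fun h => hy (hrU (by rwa [χ.tsupport_eq] at h))
      refine contDiffAt_const (c := (0 : ℂ)) |>.congr_of_eventuallyEq ?_
      filter_upwards [(isClosed_tsupport _).isOpen_compl.mem_nhds this] with z hz
      simp [G, image_eq_zero_of_notMem_tsupport hz]
  obtain ⟨H, hH, hGH⟩ := exists_contDiff_clm_eq_add hG x
  have hHv : ∀ v : Fin m → ℂ, ContDiffOn ℝ ∞ (fun y => H y v) U := fun v =>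
    (hH.clm_apply contDiff_const).contDiffOn
  -- The real-linear form H y is split into its complex-linear and antilinear parts, as with
  -- Wirtinger derivatives.
  refine ⟨Smooth.restrict U _ hχ.contDiffOn,
    fun i => (2⁻¹ : ℂ) • (Smooth.restrict U _ (hHv (Pi.single i 1)) -
      Complex.I • Smooth.restrict U _ (hHv (Pi.single i Complex.I))),
    fun i => (2⁻¹ : ℂ) • (Smooth.restrict U _ (hHv (Pi.single i 1)) +
      Complex.I • Smooth.restrict U _ (hHv (Pi.single i Complex.I))), ?_, ?_⟩
  · rw [Smooth.eval_restrict, χ.one_of_mem_closedBall (by simp [χ]; positivity)]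
    simp
  · refine Smooth.ext_eval fun y => ?_
    have hlin : ∀ w : Fin m → ℂ, H y w = ∑ i, (((w i).re : ℂ) * H y (Pi.single i 1) +
        ((w i).im : ℂ) * H y (Pi.single i Complex.I)) := by
      intro w
      conv_lhs => rw [← Finset.univ_sum_single w, map_sum]
      refine Finset.sum_congr rfl fun i _ => ?_
      have : (Pi.single i (w i) : Fin m → ℂ) = (w i).re • (Pi.single i 1 : Fin m → ℂ) +
          (w i).im • (Pi.single i Complex.I : Fin m → ℂ) := by
        rw [← Pi.single_smul, ← Pi.single_smul, ← Pi.single_add]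
        congr 1
        simp
      rw [this, map_add, map_smul, map_smul, Complex.real_smul, Complex.real_smul]
    have h0 : G x = 0 := by simp [G]
    have h1 := hGH y
    rw [h0, zero_add, hlin] at h1
    simp only [map_mul, map_sub, map_sum, map_add, map_smul, AlgHom.commutes,
      Smooth.eval_restrict, eval_coordZ, eval_coordZBar, smul_eq_mul, Algebra.algebraMap_self,
      RingHom.id_apply]
    refine h1.trans (Finset.sum_congr rfl fun i _ => ?_)
    rw [← map_sub, ← Complex.re_add_im ((y : Fin m → ℂ) i - (x : Fin m → ℂ) i)]
    simp only [Pi.sub_apply, map_add, map_mul, Complex.conj_ofReal, Complex.conj_I]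
    set a : ℂ := (((y : Fin m → ℂ) i - (x : Fin m → ℂ) i).re : ℂ)
    set b : ℂ := (((y : Fin m → ℂ) i - (x : Fin m → ℂ) i).im : ℂ)
    linear_combination (b * H y (Pi.single i Complex.I)) * Complex.I_sq

/-- Apply δ to χ (f - f(x)) and evaluate at x. The coordinate expansion gives 0, while the product
rule gives (δ f)(x), because χ(x) = 1 and f - f(x) vanishes at x. -/
theorem derivation_eq_zero {δ : Smooth U →ₗ[ℂ] Smooth U}
    (hδ : ∀ f g, δ (f * g) = f * δ g + g * δ f) (hz : ∀ i, δ (coordZ U i) = 0)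
    (hz' : ∀ i, δ (coordZBar U i) = 0) : δ = 0 := by
  refine LinearMap.ext fun f => Smooth.ext_eval fun x => ?_
  have hc : ∀ c, δ (algebraMap ℂ _ c) = 0 := by
    have h1 : δ 1 = 0 := by simpa using hδ 1 1
    intro c
    rw [Algebra.algebraMap_eq_smul_one, map_smul, h1, smul_zero]
  obtain ⟨χ, h, k, hχ, hs⟩ := f.exists_sub_eq_sum x
  have e1 : Smooth.eval x (δ (χ * (f - algebraMap ℂ _ (Smooth.eval x f)))) = 0 := by
    rw [hs, map_sum, map_sum]
    refine Finset.sum_eq_zero fun i _ => ?_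
    simp [hδ, hz, hz', hc]
  have e2 := hδ χ (f - algebraMap ℂ _ (Smooth.eval x f))
  have e3 := congrArg (Smooth.eval x) e2
  rw [e1] at e3
  simpa [hχ, hc] using e3.symm

theorem superComm_id (f : Smooth U) (T : Smooth U →ₗ[ℂ] Smooth U) :
    superComm (AlgHom.id ℂ _) f T = LinearMap.mulLeft ℂ f ∘ₗ T - T ∘ₗ LinearMap.mulLeft ℂ f :=
  superComm_of_even rfl T

/-- Multiplications by functions on U commute, so the order of nested commutators is irrelevant. -/
theorem superComm_superComm_comm (f g : Smooth U) (T : Smooth U →ₗ[ℂ] Smooth U) :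
    superComm (AlgHom.id ℂ _) f (superComm (AlgHom.id ℂ _) g T) =
      superComm (AlgHom.id ℂ _) g (superComm (AlgHom.id ℂ _) f T) := by
  ext x
  simp only [superComm_id, LinearMap.sub_apply, LinearMap.comp_apply, LinearMap.mulLeft_apply,
    mul_sub, mul_left_comm f g]
  abel

theorem isSuperCommutative_id : IsSuperCommutative (AlgHom.id ℂ (Smooth U)) := fun f g => by
  rw [evenPart_of_even rfl, oddPart_of_even rfl, mul_zero, add_zero, mul_comm]

/-- The set of the holomorphic and antiholomorphic coordinates on `U`. -/
def coordSet (U : TopologicalSpace.Opens (Fin m → ℂ)) : Set (Smooth U) :=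
  Set.range (coordZ U) ∪ Set.range (coordZBar U)

/-- For T of order at most one, T - T(1) is a derivation, and it vanishes on the coordinates, hence
everywhere. Higher orders reduce to this case by taking commutators with functions, which commute
with the commutators with coordinates. -/
theorem DiffOpOrderLT.of_coord_step {n : ℕ} : ∀ {T : Smooth U →ₗ[ℂ] Smooth U},
    DiffOpOrderLT (AlgHom.id ℂ _) (n + 2) T →
    (∀ c ∈ coordSet U, DiffOpOrderLT (AlgHom.id ℂ _) n (superComm (AlgHom.id ℂ _) c T)) →
    DiffOpOrderLT (AlgHom.id ℂ _) (n + 1) T := by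
  induction n with
  | zero =>
    intro T hT hc
    have hm := fun f => (hT f).eq_mulLeft isSuperCommutative_id (fun _ => rfl)
    let δ : Smooth U →ₗ[ℂ] Smooth U := T - LinearMap.mulLeft ℂ (T 1)
    have hδ : ∀ f, δ f = -(superComm (AlgHom.id ℂ _) f T) 1 := fun f => by
      simp [δ, superComm_id, mul_comm]
    have h0 : δ = 0 := by
      refine derivation_eq_zero (fun f g => ?_) (fun i => ?_) (fun i => ?_)
      · have h1 := LinearMap.congr_fun (hm f) g
        rw [LinearMap.mulLeft_apply, superComm_id] at h1
        simp only [LinearMap.sub_apply, LinearMap.comp_apply, LinearMap.mulLeft_apply,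
          mul_one] at h1
        simp only [δ, LinearMap.sub_apply, LinearMap.mulLeft_apply]
        linear_combination -h1
      · rw [hδ, show superComm _ _ T = 0 from hc _ (Or.inl ⟨i, rfl⟩)]
        simp
      · rw [hδ, show superComm _ _ T = 0 from hc _ (Or.inr ⟨i, rfl⟩)]
        simp
    intro f
    have h1 : (superComm (AlgHom.id ℂ _) f T) 1 = 0 := by
      rw [← neg_eq_zero, ← hδ, h0, LinearMap.zero_apply]
    change superComm (AlgHom.id ℂ _) f T = 0
    rw [hm f, h1, LinearMap.mulLeft_zero_eq_zero]
  | succ n ih =>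
    intro T hT hc f
    refine ih (hT f) fun c hcc => ?_
    rw [superComm_superComm_comm]
    exact hc c hcc f

/-- A differential operator has order at most `n` if its commutators with the coordinates have
order less than `n`. -/
theorem DiffOpOrderLT.of_coord {n : ℕ} {T : Smooth U →ₗ[ℂ] Smooth U}
    (hT : IsDiffOp (AlgHom.id ℂ _) T)
    (hc : ∀ c ∈ coordSet U, DiffOpOrderLT (AlgHom.id ℂ _) n (superComm (AlgHom.id ℂ _) c T)) :
    DiffOpOrderLT (AlgHom.id ℂ _) (n + 1) T := by
  obtain ⟨N, hN⟩ := hT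
  rw [diffOpOrderLE_iff_lt] at hN
  have key : ∀ k, DiffOpOrderLT (AlgHom.id ℂ _) (n + 1 + k) T →
      DiffOpOrderLT (AlgHom.id ℂ _) (n + 1) T := by
    intro k
    induction k with
    | zero => exact id
    | succ k ih =>
      intro h
      refine ih ?_
      rw [add_right_comm]
      refine of_coord_step (h.mono (by omega)) fun c hcc => (hc c hcc).mono (by omega)
  exact key N (hN.mono (by omega))

/-! ### Naturality of star products with separation of variables -/

/-- The maps `C_r` are those of an associative unital deformation of the product of `C^∞(U)` whose
operators of left multiplication by functions are natural. -/
structure IsNaturalStar (C : ℕ → Smooth U →ₗ[ℂ] Smooth U →ₗ[ℂ] Smooth U) : Prop where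
  natural : ∀ f r, DiffOpOrderLT (AlgHom.id ℂ _) (r + 1) (C r f)
  C_zero : ∀ f g : Smooth U, C 0 f g = f * g
  assoc : ∀ f g h : LaurentSeries (Smooth U),
    starMul C (starMul C f g) h = starMul C f (starMul C g h)
  one_star : ∀ f : LaurentSeries (Smooth U), starMul C 1 f = f
  star_one : ∀ f : LaurentSeries (Smooth U), starMul C f 1 = f

end Smooth

/-! ### The star product of formal series with constant coefficients -/

section StarMul

variable {m : ℕ} {U : TopologicalSpace.Opens (Fin m → ℂ)}
  {C : ℕ → Smooth U →ₗ[ℂ] Smooth U →ₗ[ℂ] Smooth U}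

theorem finsum_eq_finsum_comp {α β M : Type*} [AddCommMonoid M] {e : α → β}
    (he : Function.Injective e) {f : β → M} (hf : ∀ b, b ∉ Set.range e → f b = 0) :
    ∑ᶠ b, f b = ∑ᶠ a, f (e a) := by
  rw [← finsum_mem_range he, finsum_mem_def]
  refine finsum_congr fun b => ?_
  by_cases hb : b ∈ Set.range e
  · rw [Set.indicator_of_mem hb]
  · rw [Set.indicator_of_notMem hb, hf b hb]

theorem coeff_starMul (C : ℕ → Smooth U →ₗ[ℂ] Smooth U →ₗ[ℂ] Smooth U)
    (F G : LaurentSeries (Smooth U)) (n : ℤ) :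
    (starMul C F G).coeff n = ∑ᶠ p : ℕ × ℤ, C p.1 (F.coeff p.2) (G.coeff (n - p.1 - p.2)) := rfl

theorem coeff_starMul_C (F : LaurentSeries (Smooth U)) (g : Smooth U) (n : ℤ) :
    (starMul C F (HahnSeries.C g)).coeff n = ∑ᶠ r : ℕ, C r (F.coeff (n - r)) g := by
  rw [coeff_starMul, finsum_eq_finsum_comp (e := fun r : ℕ => (r, n - r))]
  · simp
  · exact fun r s h => congrArg Prod.fst h
  · rintro ⟨r, q⟩ h
    rw [HahnSeries.C_apply, HahnSeries.coeff_single_of_ne, map_zero]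
    exact fun h' => h ⟨r, by ext <;> grind⟩

theorem coeff_C_starMul (f : Smooth U) (G : LaurentSeries (Smooth U)) (n : ℤ) :
    (starMul C (HahnSeries.C f) G).coeff n = ∑ᶠ r : ℕ, C r f (G.coeff (n - r)) := by
  rw [coeff_starMul, finsum_eq_finsum_comp (e := fun r : ℕ => (r, (0 : ℤ)))]
  · simp
  · exact fun r s h => congrArg Prod.fst h
  · rintro ⟨r, q⟩ h
    rw [HahnSeries.C_apply, HahnSeries.coeff_single_of_ne, map_zero, LinearMap.zero_apply]
    exact fun h' => h ⟨r, by ext <;> grind⟩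

theorem coeff_C_starMul_C (f g : Smooth U) (n : ℤ) :
    (starMul C (HahnSeries.C f) (HahnSeries.C g)).coeff n =
      if 0 ≤ n then C n.toNat f g else 0 := by
  rw [coeff_C_starMul]
  split_ifs with h
  · rw [finsum_eq_single _ n.toNat]
    · rw [HahnSeries.C_apply, show n - (n.toNat : ℤ) = 0 by omega, HahnSeries.coeff_single_same]
    · intro r hr
      rw [HahnSeries.C_apply, HahnSeries.coeff_single_of_ne (by omega), map_zero]
  · refine finsum_eq_zero_of_forall_eq_zero fun r => ?_
    rw [HahnSeries.C_apply, HahnSeries.coeff_single_of_ne (by omega), map_zero]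

/-- Reversing the arguments of every C_r gives the opposite product, to which all results apply
again. -/
theorem starMul_flip (F G : LaurentSeries (Smooth U)) :
    starMul (fun r => (C r).flip) F G = starMul C G F := by
  ext n
  rw [coeff_starMul, coeff_starMul]
  let e : ℕ × ℤ ≃ ℕ × ℤ :=
    { toFun := fun p => (p.1, n - p.1 - p.2)
      invFun := fun p => (p.1, n - p.1 - p.2)
      left_inv := fun p => by simp
      right_inv := fun p => by simp }
  rw [← finsum_comp_equiv e]
  simp [e]

theorem starMul_C_eq_mul {g : Smooth U} (h0 : ∀ f g, C 0 f g = f * g)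
    (h : ∀ r ≠ 0, ∀ f, C r f g = 0) (F : LaurentSeries (Smooth U)) :
    starMul C F (HahnSeries.C g) = F * HahnSeries.C g := by
  ext n
  rw [coeff_starMul_C, finsum_eq_single _ 0 fun r hr => h r hr _, h0, HahnSeries.C_apply,
    HahnSeries.coeff_mul_single_zero]
  simp

theorem C_starMul_eq_mul {f : Smooth U} (h0 : ∀ f g, C 0 f g = f * g)
    (h : ∀ r ≠ 0, ∀ g, C r f g = 0) (G : LaurentSeries (Smooth U)) :
    starMul C (HahnSeries.C f) G = HahnSeries.C f * G := by
  ext n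
  rw [coeff_C_starMul, finsum_eq_single _ 0 fun r hr => h r hr _, h0, HahnSeries.C_apply,
    HahnSeries.coeff_single_zero_mul]
  simp

/-- The left coordinates of an abstract star product with separation of variables are those `c`
with `c ⋆ g = c g`, the right ones those with `f ⋆ c = f c`. -/
theorem isNaturalStar_of_separation
    (hd : ∀ f r, IsDiffOp (AlgHom.id ℂ (Smooth U)) (C r f)) (h0 : ∀ f g, C 0 f g = f * g)
    (assoc : ∀ f g h : LaurentSeries (Smooth U),
      starMul C (starMul C f g) h = starMul C f (starMul C g h))
    (one_star : ∀ f : LaurentSeries (Smooth U), starMul C 1 f = f)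
    (star_one : ∀ f : LaurentSeries (Smooth U), starMul C f 1 = f)
    (hc : ∀ c ∈ coordSet U, (∀ r ≠ 0, ∀ g, C r c g = 0) ∨ (∀ r ≠ 0, ∀ f, C r f c = 0)) :
    IsNaturalStar C where
  C_zero := h0
  assoc := assoc
  one_star := one_star
  star_one := star_one
  natural := by
    intro f r
    induction r using Nat.strong_induction_on generalizing f with
    | _ r ih =>
    refine .of_coord (hd f r) fun c hcc => ?_
    rcases hc c hcc with h | h
    -- If c acts by plain multiplication from the left, then (c f) ⋆ g = c (f ⋆ g) by associativity.
    · have h1 : ∀ g, C r (f * c) g = c * C r f g := fun g => by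
        have := congrArg (fun F => F.coeff (r : ℤ))
          (assoc (HahnSeries.C c) (HahnSeries.C f) (HahnSeries.C g))
        simp only [C_starMul_eq_mul h0 h] at this
        rw [← map_mul, coeff_C_starMul_C, HahnSeries.C_apply (Γ := ℤ) c,
          HahnSeries.coeff_single_zero_mul, coeff_C_starMul_C] at this
        simpa [mul_comm] using this
      -- Compare the coefficients at ν^r in (f ⋆ c) ⋆ g = f ⋆ (c g). The term i = r on the left is
      -- C_r(f c, g) = c C_r(f, g); the other terms contain C_i with i < r, whose order is known by
      -- induction.
      have h2 : superComm (AlgHom.id ℂ _) c (C r f) =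
          -∑ i ∈ Finset.range r, C i (C (r - i) f c) := by
        ext g
        have := congrArg (fun F => F.coeff (r : ℤ))
          (assoc (HahnSeries.C f) (HahnSeries.C c) (HahnSeries.C g))
        simp only [C_starMul_eq_mul h0 h] at this
        rw [← map_mul, coeff_C_starMul_C, coeff_starMul_C, if_pos (by positivity),
          finsum_eq_sum_of_support_subset (s := Finset.range (r + 1)),
          Finset.sum_range_succ] at this
        · simp only [coeff_C_starMul_C, sub_self, le_refl, if_true, Int.toNat_zero, h0, h1,
            Int.toNat_natCast] at this
          rw [superComm_id]
          simp only [LinearMap.sub_apply, LinearMap.comp_apply, LinearMap.mulLeft_apply,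
            LinearMap.neg_apply, LinearMap.sum_apply]
          rw [← this, sub_add_cancel_right, neg_inj]
          refine Finset.sum_congr rfl fun i hi => ?_
          rw [Finset.mem_range] at hi
          rw [if_pos (by omega), show ((r : ℤ) - i).toNat = r - i by omega]
        · intro i hi
          rw [Finset.coe_range, Set.mem_Iio]
          by_contra hlt
          refine hi ?_
          dsimp only
          rw [coeff_C_starMul_C, if_neg (by omega), map_zero, LinearMap.zero_apply]
      rw [h2]
      refine (DiffOpOrderLT.sum _ fun i hi => ?_).neg
      rw [Finset.mem_range] at hi
      exact (ih i hi _).mono hi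
    -- If c acts by plain multiplication from the right, then (f ⋆ g) c = f ⋆ (g c), so every C_r(f,
    -- ·) commutes with c.
    · have h2 : superComm (AlgHom.id ℂ _) c (C r f) = 0 := by
        ext g
        have := congrArg (fun F => F.coeff (r : ℤ))
          (assoc (HahnSeries.C f) (HahnSeries.C g) (HahnSeries.C c))
        simp only [starMul_C_eq_mul h0 h] at this
        rw [← map_mul, coeff_C_starMul_C, HahnSeries.C_apply (Γ := ℤ) c,
          HahnSeries.coeff_mul_single_zero, coeff_C_starMul_C] at this
        simp only [Nat.cast_nonneg, if_true, Int.toNat_natCast] at this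
        simp only [superComm_id, LinearMap.sub_apply, LinearMap.comp_apply,
          LinearMap.mulLeft_apply, LinearMap.zero_apply]
        rw [mul_comm c g, ← this, mul_comm, sub_self]
      rw [h2]
      exact .zero _

/-- The coordinates z_i multiply plainly from the left and z̄_i from the right; only the case V = U
of the separation axioms enters. -/
theorem IsNaturalStar.of_starProductSV (S : StarProductSV U) : IsNaturalStar S.C := by
  refine isNaturalStar_of_separation S.isDiffOp_left S.C_zero S.assoc S.one_star S.star_one ?_
  rintro c (⟨i, rfl⟩ | ⟨i, rfl⟩)
  · refine Or.inl fun r hr g => Smooth.ext_eval fun x => S.holomorphic_star U le_rfl _ g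
      ⟨fun y => y i, (differentiable_apply i).differentiableOn, fun _ _ => rfl⟩ r hr x x.2
  · refine Or.inr fun r hr f => Smooth.ext_eval fun x => S.star_antiholomorphic U le_rfl f _
      ⟨fun y => y i, (differentiable_apply i).differentiableOn,
        fun y _ => (Complex.conj_conj _).symm⟩ r hr x x.2

/-- In the opposite product z_i and z̄_i exchange their roles. This version serves the right inverse
of the matrix of u. -/
theorem IsNaturalStar.of_starProductSV_flip (S : StarProductSV U) :
    IsNaturalStar fun r => (S.C r).flip := by
  refine isNaturalStar_of_separation S.isDiffOp_right
    (fun f g => (S.C_zero g f).trans (mul_comm _ _)) (fun f g h => ?_) (fun f => ?_) (fun f => ?_)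
    ?_
  · simp only [starMul_flip, S.assoc]
  · rw [starMul_flip, S.star_one]
  · rw [starMul_flip, S.one_star]
  rintro c (⟨i, rfl⟩ | ⟨i, rfl⟩)
  · refine Or.inr fun r hr g => Smooth.ext_eval fun x => S.holomorphic_star U le_rfl _ g
      ⟨fun y => y i, (differentiable_apply i).differentiableOn, fun _ _ => rfl⟩ r hr x x.2
  · refine Or.inl fun r hr f => Smooth.ext_eval fun x => S.star_antiholomorphic U le_rfl f _
      ⟨fun y => y i, (differentiable_apply i).differentiableOn,
        fun y _ => (Complex.conj_conj _).symm⟩ r hr x x.2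

end StarMul

/-! ### Formal operators -/

section LaurentLemmas

theorem coeff_hahnSmul_eq_sum {R V : Type*} [Semiring R] [AddCommMonoid V] [Module R V]
    {x : LaurentSeries R} {y : LaurentSeries V} {a b : ℤ} (hx : ∀ k < a, x.coeff k = 0)
    (hy : ∀ k < b, y.coeff k = 0) (n : ℤ) :
    ((HahnModule.of R).symm (x • HahnModule.of R y)).coeff n =
      ∑ k ∈ Finset.Icc a (n - b), x.coeff k • y.coeff (n - k) := by
  rw [HahnModule.coeff_smul]
  refine Finset.sum_bij_ne_zero (fun p _ _ => p.1) ?_ ?_ ?_ ?_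
  · rintro ⟨i, j⟩ h h0
    have hij : i + j = n := ((Finset.mem_vaddAntidiagonal _ _).1 h).2.2
    rw [Finset.mem_Icc]
    constructor
    · by_contra hlt
      exact h0 (by simp [hx i (not_le.1 hlt)])
    · by_contra hlt
      refine h0 ?_
      change x.coeff i • y.coeff j = 0
      rw [hy j (by omega), smul_zero]
  · rintro ⟨i, j⟩ h _ ⟨i', j'⟩ h' _ rfl
    have hij : i + j = n := ((Finset.mem_vaddAntidiagonal _ _).1 h).2.2
    have hij' : i + j' = n := ((Finset.mem_vaddAntidiagonal _ _).1 h').2.2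
    obtain rfl : j = j' := by omega
    rfl
  · intro k _ h0
    refine ⟨(k, n - k), (Finset.mem_vaddAntidiagonal _ _).2 ⟨?_, ?_, ?_⟩, h0, rfl⟩
    · rw [HahnSeries.mem_support]
      intro h
      simp [h] at h0
    · rw [HahnSeries.mem_support]
      intro h
      change y.coeff (n - k) = 0 at h
      simp [h] at h0
    · exact add_sub_cancel k n
  · rintro ⟨i, j⟩ h _
    have hij : i + j = n := ((Finset.mem_vaddAntidiagonal _ _).1 h).2.2
    obtain rfl : j = n - i := by omega
    rfl

variable {R : Type*} [Semiring R]

theorem coeff_mul_eq_sum {x y : LaurentSeries R} {a b : ℤ} (hx : ∀ k < a, x.coeff k = 0)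
    (hy : ∀ k < b, y.coeff k = 0) (n : ℤ) :
    (x * y).coeff n = ∑ k ∈ Finset.Icc a (n - b), x.coeff k * y.coeff (n - k) :=
  coeff_hahnSmul_eq_sum hx hy n

theorem coeff_mul_eq_sum' {x y : LaurentSeries R} {a b : ℤ} (hx : ∀ k < a, x.coeff k = 0)
    (hy : ∀ k < b, y.coeff k = 0) (n : ℤ) :
    (x * y).coeff n = ∑ k ∈ Finset.Icc b (n - a), x.coeff (n - k) * y.coeff k := by
  rw [coeff_mul_eq_sum hx hy]
  refine Finset.sum_bij' (fun k _ => n - k) (fun k _ => n - k) ?_ ?_ ?_ ?_ ?_ <;>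
    intro k hk <;> simp_all <;> omega

theorem exists_coeff_eq_zero_of_lt {V : Type*} [Zero V] (x : LaurentSeries V) :
    ∃ a : ℤ, ∀ k < a, x.coeff k = 0 := by
  exact ⟨x.order, fun k hk => HahnSeries.coeff_eq_zero_of_lt_order hk⟩

/-- The ring homomorphism of Laurent series that is induced by a ring homomorphism. -/
def laurentMap {R S : Type*} [Semiring R] [Semiring S] (f : R →+* S) :
    LaurentSeries R →+* LaurentSeries S where
  toFun x := x.map f
  map_one' := by ext n; simp [HahnSeries.coeff_one]
  map_mul' x y := HahnSeries.map_mul (f : R →ₙ+* S)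
  map_zero' := by ext n; simp
  map_add' x y := by ext n; simp

@[simp] theorem coeff_laurentMap {R S : Type*} [Semiring R] [Semiring S] (f : R →+* S)
    (x : LaurentSeries R) (n : ℤ) : (laurentMap f x).coeff n = f (x.coeff n) := rfl

end LaurentLemmas

section FormalOperators

variable {A : Type*} [Ring A] [Algebra ℂ A]

/-- The action of a formal operator `∑ ν^k T_k` on formal functions. -/
def act (N : LaurentSeries (Module.End ℂ A)) (x : LaurentSeries A) : LaurentSeries A :=
  (HahnModule.of (Module.End ℂ A)).symm (N • HahnModule.of (Module.End ℂ A) x)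

theorem coeff_act {N : LaurentSeries (Module.End ℂ A)} {x : LaurentSeries A} {a b : ℤ}
    (hN : ∀ k < a, N.coeff k = 0) (hx : ∀ k < b, x.coeff k = 0) (n : ℤ) :
    (act N x).coeff n = ∑ k ∈ Finset.Icc a (n - b), N.coeff k (x.coeff (n - k)) :=
  coeff_hahnSmul_eq_sum hN hx n

theorem act_mul (N N' : LaurentSeries (Module.End ℂ A)) (x : LaurentSeries A) :
    act (N * N') x = act N (act N' x) :=
  congrArg (HahnModule.of (Module.End ℂ A)).symm (mul_smul N N' (HahnModule.of (Module.End ℂ A) x))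

theorem act_add (N N' : LaurentSeries (Module.End ℂ A)) (x : LaurentSeries A) :
    act (N + N') x = act N x + act N' x :=
  congrArg (HahnModule.of (Module.End ℂ A)).symm (add_smul N N' (HahnModule.of _ x))

theorem act_zero (x : LaurentSeries A) : act 0 x = 0 :=
  congrArg (HahnModule.of (Module.End ℂ A)).symm
    (zero_smul (LaurentSeries (Module.End ℂ A)) (HahnModule.of (Module.End ℂ A) x))

theorem act_sub (N N' : LaurentSeries (Module.End ℂ A)) (x : LaurentSeries A) :
    act (N - N') x = act N x - act N' x :=
  congrArg (HahnModule.of (Module.End ℂ A)).symm (sub_smul N N' (HahnModule.of _ x))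

theorem coeff_act_eq_zero {N : LaurentSeries (Module.End ℂ A)} {x : LaurentSeries A} {a b n : ℤ}
    (hN : ∀ k < a, N.coeff k = 0) (hx : ∀ k < b, x.coeff k = 0) (hn : n < a + b) :
    (act N x).coeff n = 0 := by
  rw [coeff_act hN hx, Finset.Icc_eq_empty (by omega), Finset.sum_empty]

theorem coeff_act_add {N : LaurentSeries (Module.End ℂ A)} {x : LaurentSeries A} {a b : ℤ}
    (hN : ∀ k < a, N.coeff k = 0) (hx : ∀ k < b, x.coeff k = 0) :
    (act N x).coeff (a + b) = N.coeff a (x.coeff b) := by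
  rw [coeff_act hN hx, add_sub_cancel_right, Finset.Icc_self, Finset.sum_singleton,
    add_sub_cancel_left]

theorem coeff_act_single (T : Module.End ℂ A) (x : LaurentSeries A) (j n : ℤ) :
    (act (HahnSeries.single j T) x).coeff n = T (x.coeff (n - j)) := by
  obtain ⟨b, hb⟩ := exists_coeff_eq_zero_of_lt x
  have hC : ∀ k < j, (HahnSeries.single j T).coeff k = 0 := fun k hk =>
    HahnSeries.coeff_single_of_ne hk.ne
  rw [coeff_act hC hb, Finset.sum_eq_single j]
  · simp
  · intro k _ hk
    rw [HahnSeries.coeff_single_of_ne hk, LinearMap.zero_apply]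
  · intro h
    rw [Finset.mem_Icc, not_and_or] at h
    rw [hb _ (by omega), map_zero]

/-- The formal operators of left multiplication by formal functions. -/
def opMul : LaurentSeries A →+* LaurentSeries (Module.End ℂ A) :=
  laurentMap (Algebra.lmul ℂ A).toRingHom

theorem coeff_opMul (a : LaurentSeries A) (n : ℤ) :
    (opMul a).coeff n = LinearMap.mulLeft ℂ (a.coeff n) := rfl

theorem act_opMul (a x : LaurentSeries A) : act (opMul a) x = a * x := by
  obtain ⟨c, hc⟩ := exists_coeff_eq_zero_of_lt a
  obtain ⟨b, hb⟩ := exists_coeff_eq_zero_of_lt x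
  ext n
  rw [coeff_act (fun k hk => by rw [coeff_opMul, hc k hk, LinearMap.mulLeft_zero_eq_zero]) hb,
    coeff_mul_eq_sum hc hb]
  rfl

theorem act_opMul_mul_mul (a b x : LaurentSeries A) (N : LaurentSeries (Module.End ℂ A)) :
    act (opMul a * N * opMul b) x = a * act N (b * x) := by
  rw [act_mul, act_mul, act_opMul, act_opMul]

variable {γ : A →ₐ[ℂ] A}

/-- The formal operator `N = N_0 + ν N_1 + …` is natural: `N_k` is a differential operator of order
at most `k`. -/
def IsNaturalOp (γ : A →ₐ[ℂ] A) (N : LaurentSeries (Module.End ℂ A)) : Prop :=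
  ∀ n : ℤ, DiffOpOrderLT γ (n + 1).toNat (N.coeff n)

namespace IsNaturalOp

variable {N N' : LaurentSeries (Module.End ℂ A)}

theorem coeff_eq_zero (h : IsNaturalOp γ N) {n : ℤ} (hn : n < 0) : N.coeff n = 0 := by
  have := h n
  rwa [show (n + 1).toNat = 0 by omega] at this

theorem zero : IsNaturalOp γ 0 := fun _ => .zero _

theorem add (h : IsNaturalOp γ N) (h' : IsNaturalOp γ N') : IsNaturalOp γ (N + N') :=
  fun n => (h n).add (h' n)

theorem single {k : ℕ} {T : Module.End ℂ A} (hT : DiffOpOrderLT γ (k + 1) T) :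
    IsNaturalOp γ (HahnSeries.single (k : ℤ) T) := by
  intro n
  by_cases h : n = k
  · subst h
    rw [HahnSeries.coeff_single_same]
    exact hT
  · rw [HahnSeries.coeff_single_of_ne h]
    exact .zero _

theorem mul (hγ : ∀ x, γ (γ x) = x) (h : IsNaturalOp γ N) (h' : IsNaturalOp γ N') :
    IsNaturalOp γ (N * N') := by
  intro n
  rw [coeff_mul_eq_sum (fun k => h.coeff_eq_zero) (fun k => h'.coeff_eq_zero)]
  refine .sum _ fun k hk => ?_
  rw [Finset.mem_Icc] at hk
  exact .comp hγ (by omega) (h k) (h' (n - k))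

theorem rat_smul [Module ℚ (LaurentSeries (Module.End ℂ A))] (q : ℚ) (h : IsNaturalOp γ N) :
    IsNaturalOp γ (q • N) := by
  intro n
  have := map_ratCast_smul (HahnSeries.coeff.addMonoidHom n) ℚ ℂ q N
  rw [Rat.cast_id] at this
  change DiffOpOrderLT γ _ (HahnSeries.coeff.addMonoidHom n (q • N))
  rw [this]
  exact (h n).smul _

/-- The commutator with an even function of order at least `-1` preserves naturality. -/
theorem comm (h : IsNaturalOp γ N) {Y : LaurentSeries A} (hY : ∀ n < -1, Y.coeff n = 0)
    (he : ∀ n, γ (Y.coeff n) = Y.coeff n) : IsNaturalOp γ (N * opMul Y - opMul Y * N) := by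
  intro n
  have hY' : ∀ k < -1, (opMul Y).coeff k = 0 := fun k hk => by
    rw [coeff_opMul, hY k hk, LinearMap.mulLeft_zero_eq_zero]
  rw [HahnSeries.coeff_sub, coeff_mul_eq_sum (fun k => h.coeff_eq_zero) hY',
    coeff_mul_eq_sum' hY' (fun k => h.coeff_eq_zero), ← Finset.sum_sub_distrib]
  refine .sum _ fun k hk => ?_
  rw [Finset.mem_Icc] at hk
  -- The factor ν^{n-k} has n - k ≥ -1, hence k ≤ n + 1. The commutator of N_k with an even function
  -- has order at most k - 1 ≤ n, so the lost order pays for the factor ν⁻¹.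
  have h1 := h k
  rw [show (k + 1).toNat = k.toNat + 1 by omega] at h1
  have h2 := (h1 (Y.coeff (n - k))).neg
  rw [superComm_of_even (he _), neg_sub] at h2
  exact h2.mono (by omega)

end IsNaturalOp

end FormalOperators

/-! ### Conjugation by the exponential of a nilpotent element -/

section ExpConj

variable {B : Type*} [Ring B] [Algebra ℚ B]

/-- Left multiplication by -y and right multiplication by y commute, so the exponential of their sum
is the product of their exponentials. -/
theorem exp_neg_mul_mul_exp {y : B} (hy : IsNilpotent y) (N : B) :
    IsNilpotent.exp (-y) * N * IsNilpotent.exp y =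
      IsNilpotent.exp (LinearMap.mulRight ℚ y - LinearMap.mulLeft ℚ y) N ∧
    IsNilpotent (LinearMap.mulRight ℚ y - LinearMap.mulLeft ℚ y) := by
  obtain ⟨k, hk⟩ := hy
  have hy : IsNilpotent y := ⟨k, hk⟩
  have hR : LinearMap.mulRight ℚ y ^ k = 0 := by
    rw [LinearMap.pow_mulRight, hk, LinearMap.mulRight_zero_eq_zero]
  have hL : LinearMap.mulLeft ℚ (-y) ^ k = 0 := by
    rw [LinearMap.pow_mulLeft, neg_pow, hk, mul_zero, LinearMap.mulLeft_zero_eq_zero]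
  have hc : Commute (LinearMap.mulLeft ℚ (-y)) (LinearMap.mulRight ℚ y) :=
    LinearMap.commute_mulLeft_right _ _
  have e : LinearMap.mulRight ℚ y - LinearMap.mulLeft ℚ y =
      LinearMap.mulLeft ℚ (-y) + LinearMap.mulRight ℚ y := by
    ext x
    simp [sub_eq_neg_add]
  rw [e]
  refine ⟨?_, hc.isNilpotent_add ⟨k, hL⟩ ⟨k, hR⟩⟩
  rw [IsNilpotent.exp_add_of_commute hc ⟨k, hL⟩ ⟨k, hR⟩, Module.End.mul_apply]
  have h1 : ∀ x, IsNilpotent.exp (LinearMap.mulRight ℚ y) x = x * IsNilpotent.exp y := by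
    intro x
    rw [IsNilpotent.exp_eq_sum hR, IsNilpotent.exp_eq_sum hk, LinearMap.sum_apply, Finset.mul_sum]
    refine Finset.sum_congr rfl fun i _ => ?_
    rw [LinearMap.pow_mulRight, LinearMap.smul_apply, LinearMap.mulRight_apply, mul_smul_comm]
  have h2 : ∀ x, IsNilpotent.exp (LinearMap.mulLeft ℚ (-y)) x = IsNilpotent.exp (-y) * x := by
    intro x
    rw [IsNilpotent.exp_eq_sum hL,
      IsNilpotent.exp_eq_sum (a := -y) (k := k) (by rw [neg_pow, hk, mul_zero]),
      LinearMap.sum_apply, Finset.sum_mul]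
    refine Finset.sum_congr rfl fun i _ => ?_
    rw [LinearMap.pow_mulLeft, LinearMap.smul_apply, LinearMap.mulLeft_apply, smul_mul_assoc]
  rw [h1, h2, mul_assoc]

/-- Conjugation by e^y is a finite rational combination of iterated commutators with y. -/
theorem exp_conj_induction {y : B} (hy : IsNilpotent y) {p : B → Prop} (h0 : p 0)
    (hadd : ∀ a b, p a → p b → p (a + b)) (hsmul : ∀ (q : ℚ) a, p a → p (q • a))
    (hcomm : ∀ a, p a → p (a * y - y * a)) {N : B} (hN : p N) :
    p (IsNilpotent.exp (-y) * N * IsNilpotent.exp y) := by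
  obtain ⟨h1, k, hk⟩ := exp_neg_mul_mul_exp hy N
  rw [h1, IsNilpotent.exp_eq_sum hk, LinearMap.sum_apply]
  refine Finset.sum_induction _ p hadd h0 fun i _ => ?_
  rw [LinearMap.smul_apply]
  refine hsmul _ _ ?_
  clear * - hcomm hN
  induction i with
  | zero => exact hN
  | succ i ih =>
    rw [pow_succ', Module.End.mul_apply]
    exact hcomm _ ih

/-- The second commutator vanishes, so the series for the conjugate stops after its linear term. -/
theorem exp_conj_eq_add {y : B} (hy : IsNilpotent y) {N : B}
    (h : Commute (N * y - y * N) y) :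
    IsNilpotent.exp (-y) * N * IsNilpotent.exp y = N + (N * y - y * N) := by
  obtain ⟨h1, hZ⟩ := exp_neg_mul_mul_exp hy N
  have h2 : (LinearMap.mulRight ℚ y - LinearMap.mulLeft ℚ y) ^ 2 • N = 0 := by
    rw [pow_two, mul_smul]
    simp only [Module.End.smul_def, LinearMap.sub_apply, LinearMap.mulRight_apply,
      LinearMap.mulLeft_apply]
    rw [h.eq, sub_self]
  rw [h1, ← Module.End.smul_def, IsNilpotent.exp_smul_eq_sum h2 hZ]
  simp [Finset.sum_range_succ]

end ExpConj

section ExpConjNatural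

variable {A : Type*} [Ring A] [Algebra ℂ A] {γ : A →ₐ[ℂ] A}

theorem opMul_exp [Module ℚ (LaurentSeries A)]
    [Module ℚ (LaurentSeries (Module.End ℂ A))]
    {Y : LaurentSeries A} (hY : IsNilpotent Y) :
    opMul (IsNilpotent.exp Y) = IsNilpotent.exp (opMul Y) :=
  hY.map_exp opMul

/-- Conjugation by the exponential of an even function of order at least `-1` preserves
naturality. -/
theorem IsNaturalOp.exp_conj [Algebra ℚ (LaurentSeries (Module.End ℂ A))]
    [Module ℚ (LaurentSeries A)] {N : LaurentSeries (Module.End ℂ A)} (h : IsNaturalOp γ N)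
    {Y : LaurentSeries A} (hY : ∀ n < -1, Y.coeff n = 0) (he : ∀ n, γ (Y.coeff n) = Y.coeff n)
    (hn : IsNilpotent Y) :
    IsNaturalOp γ (opMul (IsNilpotent.exp (-Y)) * N * opMul (IsNilpotent.exp Y)) := by
  rw [opMul_exp hn, opMul_exp hn.neg, map_neg]
  exact exp_conj_induction (p := IsNaturalOp γ) (hn.map opMul) .zero (fun _ _ => .add)
    (fun q a ha => IsNaturalOp.rat_smul q ha) (fun _ ha => ha.comm hY he) h

end ExpConjNatural

/-! ### The Grassmann algebra -/

section Grassmann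

variable {m : ℕ} {U : TopologicalSpace.Opens (Fin m → ℂ)} {d : ℕ}

theorem parity_ι (v : Fin d ⊕ₗ Fin d → Smooth U) :
    parity U d (ExteriorAlgebra.ι _ v) = -ExteriorAlgebra.ι _ v :=
  CliffordAlgebra.involute_ι v

theorem parity_algebraMap (r : Smooth U) :
    parity U d (algebraMap _ _ r) = algebraMap _ _ r :=
  (CliffordAlgebra.involute (Q := (0 : QuadraticForm (Smooth U)
    (Fin d ⊕ₗ Fin d → Smooth U)))).commutes r

theorem parity_smul (r : Smooth U) (x : SuperFun U d) : parity U d (r • x) = r • parity U d x :=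
  map_smul (CliffordAlgebra.involute (Q := (0 : QuadraticForm (Smooth U)
    (Fin d ⊕ₗ Fin d → Smooth U)))) r x

theorem parity_parity (x : SuperFun U d) : parity U d (parity U d x) = x :=
  CliffordAlgebra.involute_involute x

theorem ι_mul_eq_parity_mul_ι (v : Fin d ⊕ₗ Fin d → Smooth U) (x : SuperFun U d) :
    ExteriorAlgebra.ι _ v * x = parity U d x * ExteriorAlgebra.ι _ v := by
  induction x using ExteriorAlgebra.induction with
  | algebraMap r => rw [parity_algebraMap, Algebra.commutes]
  | ι w =>
    rw [parity_ι, neg_mul, eq_neg_iff_add_eq_zero, ExteriorAlgebra.ι_add_mul_swap]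
  | mul a b ha hb => rw [← mul_assoc, ha, mul_assoc, hb, map_mul, mul_assoc]
  | add a b ha hb => rw [mul_add, ha, hb, map_add, add_mul]

/-- The commutation rules are carried along with the decomposition so that the induction passes
through products; supercommutativity then follows at once. -/
theorem exists_even_add_odd (f : SuperFun U d) : ∃ a b, f = a + b ∧ parity U d a = a ∧
    parity U d b = -b ∧ (∀ g, a * g = g * a) ∧ ∀ g, b * g = parity U d g * b := by
  induction f using ExteriorAlgebra.induction with
  | algebraMap r =>
    exact ⟨algebraMap _ _ r, 0, (add_zero _).symm, parity_algebraMap r, by simp,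
      fun g => Algebra.commutes r g, by simp⟩
  | ι w =>
    exact ⟨0, ExteriorAlgebra.ι _ w, (zero_add _).symm, map_zero _, parity_ι w, by simp,
      ι_mul_eq_parity_mul_ι w⟩
  | mul f g hf hg =>
    obtain ⟨a, b, rfl, ha, hb, ha', hb'⟩ := hf
    obtain ⟨a₁, b₁, rfl, ha₁, hb₁, ha₁', hb₁'⟩ := hg
    refine ⟨a * a₁ + b * b₁, a * b₁ + b * a₁, by noncomm_ring, by simp [ha, hb, ha₁, hb₁],
      by simp [ha, hb, ha₁, hb₁, add_comm], fun g => ?_, fun g => ?_⟩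
    · rw [add_mul, mul_add, mul_assoc a, ha₁', ← mul_assoc a, ha', mul_assoc b, hb₁',
        ← mul_assoc b, hb', parity_parity, mul_assoc, mul_assoc]
    · rw [add_mul, mul_add, mul_assoc a, hb₁', ← mul_assoc a, ha', mul_assoc b, ha₁',
        ← mul_assoc b, hb', mul_assoc, mul_assoc]
  | add f g hf hg =>
    obtain ⟨a, b, rfl, ha, hb, ha', hb'⟩ := hf
    obtain ⟨a₁, b₁, rfl, ha₁, hb₁, ha₁', hb₁'⟩ := hg
    refine ⟨a + a₁, b + b₁, by abel, by simp [ha, ha₁], by simp [hb, hb₁, add_comm],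
      fun g => ?_, fun g => ?_⟩
    · rw [add_mul, mul_add, ha', ha₁']
    · rw [add_mul, mul_add, hb', hb₁']

theorem isSuperCommutative_parity : IsSuperCommutative (parity U d) := fun f g => by
  obtain ⟨a, b, rfl, ha, hb, ha', hb'⟩ := exists_even_add_odd f
  have h0 : evenPart (parity U d) (a + b) = a := by
    have h1 := evenPart_of_even ha
    have h2 := evenPart_of_odd hb
    rw [evenPart] at h1 h2 ⊢
    rw [map_add, add_add_add_comm, smul_add, h1, h2, add_zero]
  have h1 : oddPart (parity U d) (a + b) = b := by
    have := evenPart_add_oddPart (γ := parity U d) (a + b)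
    rw [h0] at this
    exact add_left_cancel this
  rw [h0, h1, add_mul, ha', hb']

theorem commute_of_even {f : SuperFun U d} (hf : parity U d f = f) (g : SuperFun U d) :
    f * g = g * f := by
  rw [isSuperCommutative_parity f g, evenPart_of_even hf, oddPart_of_even hf, mul_zero, add_zero]

/-! #### Partial derivatives -/

/-- The left derivative in the direction of a covector. -/
def leftDeriv (δ : Module.Dual (Smooth U) (Fin d ⊕ₗ Fin d → Smooth U)) :
    SuperFun U d →ₗ[Smooth U] SuperFun U d :=
  CliffordAlgebra.contractLeft δ

variable (δ : Module.Dual (Smooth U) (Fin d ⊕ₗ Fin d → Smooth U))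

theorem leftDeriv_ι (v : Fin d ⊕ₗ Fin d → Smooth U) :
    leftDeriv δ (ExteriorAlgebra.ι _ v) = algebraMap _ _ (δ v) :=
  CliffordAlgebra.contractLeft_ι _ δ v

theorem leftDeriv_algebraMap (r : Smooth U) : leftDeriv δ (algebraMap _ _ r) = 0 :=
  CliffordAlgebra.contractLeft_algebraMap _ δ r

theorem leftDeriv_mul (a b : SuperFun U d) :
    leftDeriv δ (a * b) = leftDeriv δ a * b + parity U d a * leftDeriv δ b := by
  induction a using ExteriorAlgebra.induction generalizing b with
  | algebraMap r =>
    rw [leftDeriv_algebraMap, zero_mul, zero_add, parity_algebraMap, ← Algebra.smul_def,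
      ← Algebra.smul_def, map_smul]
  | ι w =>
    rw [leftDeriv_ι, parity_ι, ← Algebra.smul_def, neg_mul, ← sub_eq_add_neg]
    exact CliffordAlgebra.contractLeft_ι_mul _ w b
  | mul a a' ha ha' =>
    rw [mul_assoc, ha, ha', ha, map_mul]
    noncomm_ring
  | add a a' ha ha' =>
    rw [add_mul, map_add, map_add, ha, ha', map_add]
    noncomm_ring

theorem leftDeriv_parity (x : SuperFun U d) :
    leftDeriv δ (parity U d x) = -parity U d (leftDeriv δ x) := by
  induction x using ExteriorAlgebra.induction with
  | algebraMap r => simp [parity_algebraMap, leftDeriv_algebraMap]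
  | ι w => rw [parity_ι, map_neg, leftDeriv_ι, parity_algebraMap]
  | mul a a' ha ha' =>
    rw [map_mul, leftDeriv_mul, leftDeriv_mul, ha, ha', parity_parity, map_add, map_mul, map_mul,
      parity_parity]
    noncomm_ring
  | add a a' ha ha' =>
    rw [map_add, map_add, map_add, ha, ha', map_add]
    abel

/-- Reduces right derivatives to left ones, so that a single calculus suffices. The parity and the
minus sign account for moving the derivative past the function. -/
theorem contractRight_eq_leftDeriv (x : SuperFun U d) :
    CliffordAlgebra.contractRight x δ = -leftDeriv δ (parity U d x) := by
  induction x using CliffordAlgebra.right_induction with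
  | algebraMap r =>
    rw [CliffordAlgebra.contractRight_algebraMap]
    have := leftDeriv_algebraMap (d := d) δ r
    rw [← parity_algebraMap] at this
    rw [← neg_eq_zero] at this
    exact this.symm
  | add a b ha hb =>
    rw [map_add, LinearMap.add_apply, ha, hb, map_add, map_add, neg_add]
  | mul_ι x v hx =>
    rw [CliffordAlgebra.contractRight_mul_ι, hx, map_mul]
    change δ x • v - -leftDeriv δ (parity U d v) * ExteriorAlgebra.ι _ x =
      -leftDeriv δ (parity U d v * parity U d (ExteriorAlgebra.ι _ x))
    rw [parity_ι, mul_neg, map_neg, leftDeriv_mul, leftDeriv_ι, parity_parity, Algebra.smul_def,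
      Algebra.commutes (δ x) v]
    noncomm_ring

/-- By the graded Leibniz rule the commutator with f is multiplication by the derivative of f, up to
signs on the even and odd parts, and multiplications have order zero. -/
theorem diffOpOrderLT_leftDeriv :
    DiffOpOrderLT (parity U d) 2 ((leftDeriv δ).restrictScalars ℂ) := by
  intro f
  have : superComm (parity U d) f ((leftDeriv δ).restrictScalars ℂ) = LinearMap.mulLeft ℂ
      (leftDeriv δ (oddPart (parity U d) f) - leftDeriv δ (evenPart (parity U d) f)) := by
    refine LinearMap.ext fun x => ?_
    have h1 : f * leftDeriv δ x = evenPart (parity U d) f * leftDeriv δ x +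
        oddPart (parity U d) f * leftDeriv δ x := by rw [← add_mul, evenPart_add_oddPart]
    simp only [superComm_apply, LinearMap.restrictScalars_apply, LinearMap.mulLeft_apply,
      leftDeriv_parity, map_neg, parity_parity, leftDeriv_mul, map_evenPart parity_parity,
      map_oddPart parity_parity, h1]
    noncomm_ring
  rw [this]
  exact isSuperCommutative_parity.mulLeft parity_parity _

theorem dTheta_eq (α : Fin d) (f : SuperFun U d) :
    dTheta α f = leftDeriv (LinearMap.proj (toLex (Sum.inl α))) f := rfl

theorem dThetaBarRight_eq (β : Fin d) (f : SuperFun U d) : dThetaBarRight β f =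
    -leftDeriv (LinearMap.proj (toLex (Sum.inr β))) (parity U d f) :=
  contractRight_eq_leftDeriv _ f

/-! #### The augmentation ideal -/

theorem body_algebraMap (r : Smooth U) : body (algebraMap _ (SuperFun U d) r) = r :=
  ExteriorAlgebra.algebraMap_leftInverse _ r

theorem body_ι (v : Fin d ⊕ₗ Fin d → Smooth U) :
    body (ExteriorAlgebra.ι _ v : SuperFun U d) = 0 := by
  rw [body, ExteriorAlgebra.algebraMapInv, ExteriorAlgebra.lift_ι_apply, LinearMap.zero_apply]

theorem body_mul (a b : SuperFun U d) : body (a * b) = body a * body b :=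
  map_mul ExteriorAlgebra.algebraMapInv a b

theorem body_add (a b : SuperFun U d) : body (a + b) = body a + body b :=
  map_add ExteriorAlgebra.algebraMapInv a b

theorem body_sub (a b : SuperFun U d) : body (a - b) = body a - body b :=
  map_sub ExteriorAlgebra.algebraMapInv a b

theorem body_neg (a : SuperFun U d) : body (-a) = -body a :=
  map_neg ExteriorAlgebra.algebraMapInv a

theorem body_one : body (1 : SuperFun U d) = 1 := map_one ExteriorAlgebra.algebraMapInv

theorem body_parity (x : SuperFun U d) : body (parity U d x) = body x := by
  induction x using ExteriorAlgebra.induction with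
  | algebraMap r => rw [parity_algebraMap]
  | ι w => rw [parity_ι, body_neg, body_ι, neg_zero]
  | mul a b ha hb => rw [map_mul, body_mul, ha, hb, body_mul]
  | add a b ha hb => rw [map_add, body_add, ha, hb, body_add]

theorem body_of_odd {x : SuperFun U d} (hx : parity U d x = -x) : body x = 0 := by
  have h := body_parity x
  rw [hx, body_neg, neg_eq_iff_add_eq_zero, ← two_smul ℂ] at h
  exact (smul_eq_zero_iff_right two_ne_zero).1 h

variable (U d) in
/-- The ideal of the functions on `U × ℂ^{0|d}` that vanish at `θ = θ̄ = 0`. -/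
def augIdeal : Submodule (Smooth U) (SuperFun U d) :=
  LinearMap.ker (ExteriorAlgebra.algebraMapInv : SuperFun U d →ₐ[Smooth U] Smooth U).toLinearMap

theorem mem_augIdeal {x : SuperFun U d} : x ∈ augIdeal U d ↔ body x = 0 := Iff.rfl

theorem augIdeal_mul_le : augIdeal U d * augIdeal U d ≤ augIdeal U d := by
  refine Submodule.mul_le.2 fun a ha b _ => ?_
  rw [mem_augIdeal] at *
  rw [body_mul, ha, zero_mul]

/-- The exponent 0 is excluded because the zeroth power of a submodule consists of the scalars
C^∞(U) · 1, not of the whole algebra. -/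
theorem augIdeal_pow_succ_le {k : ℕ} (hk : k ≠ 0) : augIdeal U d ^ (k + 1) ≤ augIdeal U d ^ k := by
  obtain ⟨k, rfl⟩ := Nat.exists_eq_succ_of_ne_zero hk
  rw [pow_succ, pow_succ, mul_assoc]
  exact mul_le_mul_right augIdeal_mul_le _

/-- Every function is the sum of its terms of degree zero and one and of products of functions that
vanish at `θ = θ̄ = 0`. -/
theorem exists_sub_mem_augIdeal_sq (x : SuperFun U d) :
    ∃ v, x - algebraMap _ _ (body x) - ExteriorAlgebra.ι _ v ∈ augIdeal U d ^ 2 := by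
  induction x using ExteriorAlgebra.induction with
  | algebraMap r => exact ⟨0, by simp [body_algebraMap]⟩
  | ι w => exact ⟨w, by simp [body_ι]⟩
  | mul a b ha hb =>
    obtain ⟨v, hv⟩ := ha
    obtain ⟨w, hw⟩ := hb
    refine ⟨body a • w + body b • v, ?_⟩
    have h1 : (a - algebraMap _ _ (body a)) * (b - algebraMap _ _ (body b)) ∈
        augIdeal U d ^ 2 := by
      rw [pow_two]
      refine Submodule.mul_mem_mul ?_ ?_ <;>
        rw [mem_augIdeal, body_sub, body_algebraMap, sub_self]
    have e : a * b - algebraMap _ _ (body (a * b)) -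
        ExteriorAlgebra.ι _ (body a • w + body b • v) =
        (a - algebraMap _ _ (body a)) * (b - algebraMap _ _ (body b)) +
        (body a • (b - algebraMap _ _ (body b) - ExteriorAlgebra.ι _ w) +
          body b • (a - algebraMap _ _ (body a) - ExteriorAlgebra.ι _ v)) := by
      rw [map_add, map_smul, map_smul, body_mul, map_mul]
      simp only [Algebra.smul_def, mul_sub, sub_mul, Algebra.commutes (body b)]
      abel
    rw [e]
    exact add_mem h1 (add_mem (Submodule.smul_mem _ _ hw) (Submodule.smul_mem _ _ hv))
  | add a b ha hb =>
    obtain ⟨v, hv⟩ := ha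
    obtain ⟨w, hw⟩ := hb
    refine ⟨v + w, ?_⟩
    convert add_mem hv hw using 1
    rw [body_add, map_add, map_add]
    abel

theorem body_leftDeriv_of_mem {x : SuperFun U d} (hx : x ∈ augIdeal U d ^ 2) :
    body (leftDeriv δ x) = 0 := by
  rw [pow_two] at hx
  induction hx using Submodule.mul_induction_on' with
  | mem_mul_mem a ha b hb =>
    rw [mem_augIdeal] at ha hb
    rw [leftDeriv_mul, body_add, body_mul, body_mul, hb, body_parity, ha]
    ring
  | add a _ b _ ha hb => rw [map_add, body_add, ha, hb, add_zero]

/-- The linear part of x is recovered from the bodies of its first derivatives, since elements of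
the square of the ideal contribute nothing to them. -/
theorem sub_ι_mem_augIdeal_sq {x : SuperFun U d} (hx : body x = 0) :
    x - ExteriorAlgebra.ι _ (fun i => body (leftDeriv (LinearMap.proj i) x)) ∈
      augIdeal U d ^ 2 := by
  obtain ⟨v, hv⟩ := exists_sub_mem_augIdeal_sq x
  rw [hx, map_zero, sub_zero] at hv
  convert hv using 3
  funext i
  have := body_leftDeriv_of_mem (LinearMap.proj i) hv
  rw [map_sub, body_sub, leftDeriv_ι, body_algebraMap, sub_eq_zero] at this
  exact this

/-! #### The basis of monomials -/

theorem superBasis_empty : superBasis U d ∅ = 1 := by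
  have h : pairIndex (∅ : Finset (Fin d)) ∅ = ∅ := by simp [pairIndex]
  rw [← h, superBasis_pairIndex]
  simp [monomial]

theorem superBasis_mul_mem_span (s t : Finset (Fin d ⊕ₗ Fin d)) :
    superBasis U d s * superBasis U d t ∈
      Submodule.span (Smooth U) (superBasis U d '' {r | s.card + t.card ≤ r.card}) := by
  let s' : Set.powersetCard (Fin d ⊕ₗ Fin d) s.card := Set.powersetCard.ofCard rfl
  let t' : Set.powersetCard (Fin d ⊕ₗ Fin d) t.card := Set.powersetCard.ofCard rfl
  by_cases h : Disjoint s'.val t'.val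
  · have := ExteriorAlgebra.basis_mul_of_disjoint (Pi.basisFun (Smooth U) (Fin d ⊕ₗ Fin d)) s' t' h
    change superBasis U d s * superBasis U d t = _ at this
    rw [this, Units.smul_def]
    refine zsmul_mem (Submodule.subset_span (Set.mem_image_of_mem _ ?_)) _
    exact (Set.powersetCard.disjUnion h).2.ge
  · have := ExteriorAlgebra.basis_mul_of_not_disjoint
      (Pi.basisFun (Smooth U) (Fin d ⊕ₗ Fin d)) s' t' h
    change superBasis U d s * superBasis U d t = _ at this
    rw [this]
    exact zero_mem _

theorem exteriorBasis_apply {K n : Type*} [CommRing K] [LinearOrder n] [Finite n] (s : Finset n) :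
    (Pi.basisFun K n).ExteriorAlgebra s =
      (s.sort.map fun i => ExteriorAlgebra.ι K (Pi.single i 1 : n → K)).prod := by
  have hl : s.sort = List.ofFn (s.orderEmbOfFin rfl) := by
    apply List.ext_getElem
    · simp
    · intro i h1 h2
      simp [Finset.orderEmbOfFin_apply]
  rw [ExteriorAlgebra.basis_apply_ofCard _ rfl, hl, List.map_ofFn,
    ExteriorAlgebra.ιMulti_family, ExteriorAlgebra.ιMulti_apply]
  congr 2
  funext i
  simp [Set.powersetCard.ofFinEmbEquiv_symm_apply]

theorem superBasis_apply (s : Finset (Fin d ⊕ₗ Fin d)) : superBasis U d s =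
    (s.sort.map fun i => ExteriorAlgebra.ι (Smooth U)
      (Pi.single i 1 : Fin d ⊕ₗ Fin d → Smooth U)).prod :=
  exteriorBasis_apply s

theorem body_superBasis {s : Finset (Fin d ⊕ₗ Fin d)} (hs : s ≠ ∅) :
    body (superBasis U d s) = 0 := by
  obtain ⟨i, hi⟩ := Finset.nonempty_iff_ne_empty.2 hs
  rw [← Finset.mem_sort (· ≤ ·)] at hi
  rcases h : s.sort with _ | ⟨j, l⟩
  · simp [h] at hi
  · rw [superBasis_apply, h, List.map_cons, List.prod_cons, body_mul, body_ι, zero_mul]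

theorem body_eq_coord (x : SuperFun U d) : body x = (superBasis U d).coord ∅ x := by
  have : (ExteriorAlgebra.algebraMapInv : SuperFun U d →ₐ[Smooth U] Smooth U).toLinearMap =
      (superBasis U d).coord ∅ := by
    refine (superBasis U d).ext fun s => ?_
    rw [Module.Basis.coord_apply, Module.Basis.repr_self]
    change body _ = _
    by_cases hs : s = ∅
    · rw [hs, superBasis_empty, body_one, Finsupp.single_eq_same]
    · rw [body_superBasis hs, Finsupp.single_eq_of_ne (Ne.symm hs)]
  exact LinearMap.congr_fun this x

/-- A degree count: the k-th power is spanned by monomials with at least k generators, and a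
monomial has a bounded number of them. -/
theorem augIdeal_pow_eq_bot : ∃ k ≠ 0, augIdeal U d ^ k = ⊥ := by
  have key : ∀ k, augIdeal U d ^ (k + 1) ≤
      Submodule.span (Smooth U) (superBasis U d '' {r | k + 1 ≤ r.card}) := by
    have h1 : augIdeal U d ≤ Submodule.span (Smooth U) (superBasis U d '' {r | 1 ≤ r.card}) := by
      intro x hx
      rw [← (superBasis U d).sum_repr x]
      refine sum_mem fun s _ => ?_
      by_cases hs : s = ∅
      · have h0 : (superBasis U d).repr x ∅ = 0 := (body_eq_coord x).symm.trans hx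
        rw [hs, h0, zero_smul]
        exact zero_mem _
      · exact Submodule.smul_mem _ _ (Submodule.subset_span
          ⟨s, Finset.card_pos.2 (Finset.nonempty_iff_ne_empty.2 hs), rfl⟩)
    intro k
    induction k with
    | zero => rwa [zero_add, pow_one]
    | succ k ih =>
      rw [pow_succ]
      refine (mul_le_mul' ih h1).trans ?_
      rw [Submodule.span_mul_span, Submodule.span_le]
      rintro _ ⟨_, ⟨s, hs, rfl⟩, _, ⟨t, ht, rfl⟩, rfl⟩
      have hsub : {r : Finset (Fin d ⊕ₗ Fin d) | s.card + t.card ≤ r.card} ⊆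
          {r | k + 1 + 1 ≤ r.card} := by
        intro r hr
        simp only [Set.mem_ofPred_eq] at hs ht hr ⊢
        omega
      exact Submodule.span_mono (Set.image_mono hsub) (superBasis_mul_mem_span s t)
  obtain ⟨N, hN⟩ : ∃ N, ∀ r : Finset (Fin d ⊕ₗ Fin d), r.card ≤ N := ⟨_, Finset.card_le_univ⟩
  refine ⟨N + 1, N.succ_ne_zero, le_bot_iff.1 ((key N).trans ?_)⟩
  rw [Submodule.span_le]
  rintro _ ⟨r, hr, rfl⟩
  exact absurd (hN r) (not_le.2 hr)

end Grassmann

/-! ### Components of functions on U × ℂ^{0|d} and operators defined through them -/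

section Components

variable {m : ℕ} {U : TopologicalSpace.Opens (Fin m → ℂ)} {d : ℕ}

/-! #### Expansion in the monomials `θ^I θ̄^J` -/

/-- The sets of generators correspond to the pairs of sets of indices. -/
def pairEquiv (d : ℕ) : Finset (Fin d) × Finset (Fin d) ≃ Finset (Fin d ⊕ₗ Fin d) :=
  Finset.sumEquiv.symm.toEquiv.trans (Equiv.finsetCongr toLex)

theorem pairEquiv_apply (p : Finset (Fin d) × Finset (Fin d)) :
    pairEquiv d p = pairIndex p.1 p.2 := rfl

theorem sum_coeffIJ_smul_monomial (x : SuperFun U d) :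
    ∑ I, ∑ J, coeffIJ I J x • monomial U I J = x := by
  conv_rhs => rw [← (superBasis U d).sum_repr x]
  rw [← Fintype.sum_prod_type', ← (pairEquiv d).sum_comp]
  exact Finset.sum_congr rfl fun p _ => by rw [pairEquiv_apply, superBasis_pairIndex]; rfl

theorem coeffIJ_monomial (I J K L : Finset (Fin d)) :
    coeffIJ I J (monomial U K L) = if K = I ∧ L = J then 1 else 0 := by
  rw [coeffIJ, ← superBasis_pairIndex, Module.Basis.coord_apply, Module.Basis.repr_self,
    Finsupp.single_apply]
  have : pairIndex K L = pairIndex I J ↔ K = I ∧ L = J := by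
    rw [← pairEquiv_apply (K, L), ← pairEquiv_apply (I, J), (pairEquiv d).apply_eq_iff_eq,
      Prod.mk.injEq]
  simp only [this]

theorem coeffIJ_empty (x : SuperFun U d) : coeffIJ ∅ ∅ x = body x := by
  rw [body_eq_coord, coeffIJ]
  simp [pairIndex]

theorem superFun_ext {x y : SuperFun U d} (h : ∀ I J, coeffIJ I J x = coeffIJ I J y) : x = y := by
  rw [← sum_coeffIJ_smul_monomial x, ← sum_coeffIJ_smul_monomial y]
  simp only [h]

/-! #### Functions with constant coefficients -/

/-- The homomorphism from a Grassmann algebra over `ℂ` that sends the generators to linear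
combinations of the odd coordinates. -/
def constHom {n : Type*} [Fintype n] (w : n → Fin d ⊕ₗ Fin d → Smooth U) :
    ExteriorAlgebra ℂ (n → ℂ) →ₐ[ℂ] SuperFun U d :=
  ExteriorAlgebra.lift ℂ ⟨(ExteriorAlgebra.ι (Smooth U)).restrictScalars ℂ ∘ₗ
    Fintype.linearCombination ℂ w, fun _ => ExteriorAlgebra.ι_sq_zero _⟩

section ConstHom

variable {n : Type*} [Fintype n] (w : n → Fin d ⊕ₗ Fin d → Smooth U)

theorem constHom_ι (v : n → ℂ) : constHom w (ExteriorAlgebra.ι ℂ v) =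
    ExteriorAlgebra.ι (Smooth U) (Fintype.linearCombination ℂ w v) :=
  ExteriorAlgebra.lift_ι_apply _ _ _ _

theorem constHom_ι_single [DecidableEq n] (i : n) :
    constHom w (ExteriorAlgebra.ι ℂ (Pi.single i 1)) = ExteriorAlgebra.ι (Smooth U) (w i) := by
  rw [constHom_ι, Fintype.linearCombination_apply_single, one_smul]

theorem constHom_basis [LinearOrder n] (s : Finset n) :
    constHom w ((Pi.basisFun ℂ n).ExteriorAlgebra s) =
      (s.sort.map fun i => ExteriorAlgebra.ι (Smooth U) (w i)).prod := by
  rw [exteriorBasis_apply, map_list_prod, List.map_map]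
  congr 2
  funext i
  exact constHom_ι_single w i

theorem constHom_eq_sum [LinearOrder n] (z : ExteriorAlgebra ℂ (n → ℂ)) :
    constHom w z = ∑ s, (Pi.basisFun ℂ n).ExteriorAlgebra.repr z s •
      (s.sort.map fun i => ExteriorAlgebra.ι (Smooth U) (w i)).prod := by
  conv_lhs => rw [← (Pi.basisFun ℂ n).ExteriorAlgebra.sum_repr z, map_sum]
  exact Finset.sum_congr rfl fun s _ => by rw [map_smul, constHom_basis]

theorem parity_constHom (z : ExteriorAlgebra ℂ (n → ℂ)) :
    parity U d (constHom w z) = constHom w (CliffordAlgebra.involute z) := by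
  induction z using ExteriorAlgebra.induction with
  | algebraMap r => rw [AlgHom.commutes, AlgHom.commutes, AlgHom.commutes, AlgHom.commutes]
  | ι v =>
    rw [constHom_ι, parity_ι]
    have : CliffordAlgebra.involute (ExteriorAlgebra.ι ℂ v) = -ExteriorAlgebra.ι ℂ v :=
      CliffordAlgebra.involute_ι v
    rw [this, map_neg, constHom_ι]
  | mul a b ha hb => rw [map_mul, map_mul, ha, hb, map_mul, map_mul]
  | add a b ha hb => rw [map_add, map_add, ha, hb, map_add, map_add]

theorem leftDeriv_constHom {δ : Module.Dual (Smooth U) (Fin d ⊕ₗ Fin d → Smooth U)}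
    {δ' : Module.Dual ℂ (n → ℂ)}
    (h : ∀ v, δ (Fintype.linearCombination ℂ w v) = algebraMap ℂ _ (δ' v))
    (z : ExteriorAlgebra ℂ (n → ℂ)) :
    leftDeriv δ (constHom w z) = constHom w (CliffordAlgebra.contractLeft δ' z) := by
  induction z using CliffordAlgebra.left_induction with
  | algebraMap r =>
    rw [CliffordAlgebra.contractLeft_algebraMap, map_zero]
    refine (congrArg (leftDeriv δ) ((constHom w).commutes r)).trans ?_
    rw [IsScalarTower.algebraMap_apply ℂ (Smooth U), leftDeriv_algebraMap]
  | add a b ha hb => rw [map_add, map_add, ha, hb, map_add, map_add]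
  | ι_mul x v hx =>
    rw [CliffordAlgebra.contractLeft_ι_mul, map_mul, leftDeriv_mul, hx, map_sub, map_smul,
      map_mul]
    have : constHom w (CliffordAlgebra.ι 0 v) = ExteriorAlgebra.ι (Smooth U)
      (Fintype.linearCombination ℂ w v) := constHom_ι w v
    rw [this, leftDeriv_ι, h, parity_ι, ← IsScalarTower.algebraMap_apply, ← Algebra.smul_def,
      neg_mul, ← sub_eq_add_neg]

end ConstHom

/-- The generators `θ^1, …, θ^d, θ̄^1, …, θ̄^d` as vectors. -/
def genVec (U : TopologicalSpace.Opens (Fin m → ℂ)) (d : ℕ) (i : Fin d ⊕ₗ Fin d) :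
    Fin d ⊕ₗ Fin d → Smooth U := Pi.single i 1

theorem constHom_genVec_basis (s : Finset (Fin d ⊕ₗ Fin d)) :
    constHom (genVec U d) ((Pi.basisFun ℂ _).ExteriorAlgebra s) = superBasis U d s := by
  rw [constHom_basis, superBasis_apply]
  rfl

/-! #### Coefficientwise operators -/

/-- The operator on `C^∞(U × ℂ^{0|d})` that applies `T` to the coefficients of functions. -/
def coeffOp (T : Module.End ℂ (Smooth U)) : Module.End ℂ (SuperFun U d) :=
  ∑ s, (LinearMap.toSpanSingleton (Smooth U) _ (superBasis U d s)).restrictScalars ℂ ∘ₗ T ∘ₗ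
    ((superBasis U d).coord s).restrictScalars ℂ

theorem coeffOp_apply (T : Module.End ℂ (Smooth U)) (x : SuperFun U d) :
    coeffOp T x = ∑ s, T ((superBasis U d).repr x s) • superBasis U d s := by
  simp [coeffOp]

theorem repr_coeffOp (T : Module.End ℂ (Smooth U)) (x : SuperFun U d) (s) :
    (superBasis U d).repr (coeffOp T x) s = T ((superBasis U d).repr x s) := by
  rw [coeffOp_apply, Module.Basis.repr_sum_self]

theorem coeffIJ_coeffOp (T : Module.End ℂ (Smooth U)) (x : SuperFun U d) (I J : Finset (Fin d)) :
    coeffIJ I J (coeffOp T x) = T (coeffIJ I J x) :=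
  repr_coeffOp T x _

/-- T is only ℂ-linear, so it lets exactly the constant coefficients through. Products of constant
elements are again constant, and this replaces any computation of signs of products of monomials. -/
theorem coeffOp_smul_constHom (T : Module.End ℂ (Smooth U)) (r : Smooth U)
    (z : ExteriorAlgebra ℂ (Fin d ⊕ₗ Fin d → ℂ)) :
    coeffOp T (r • constHom (genVec U d) z) = T r • constHom (genVec U d) z := by
  have hz : constHom (genVec U d) z =
      ∑ s, (Pi.basisFun ℂ _).ExteriorAlgebra.repr z s • superBasis U d s := by
    rw [constHom_eq_sum]
    exact Finset.sum_congr rfl fun s _ => by rw [superBasis_apply]; rfl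
  have hr : ∀ r : Smooth U, r • constHom (genVec U d) z =
      ∑ s, ((Pi.basisFun ℂ _).ExteriorAlgebra.repr z s • r) • superBasis U d s := by
    intro r
    rw [hz, Finset.smul_sum]
    exact Finset.sum_congr rfl fun s _ => by rw [smul_comm, smul_assoc]
  rw [hr, hr, coeffOp_apply]
  refine Finset.sum_congr rfl fun s _ => ?_
  rw [Module.Basis.repr_sum_self, map_smul]

theorem linearMap_ext_smul_constHom {T S : Module.End ℂ (SuperFun U d)}
    (h : ∀ (r : Smooth U) z, T (r • constHom (genVec U d) z) = S (r • constHom (genVec U d) z)) :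
    T = S := by
  refine LinearMap.ext fun x => ?_
  rw [← (superBasis U d).sum_repr x, map_sum, map_sum]
  refine Finset.sum_congr rfl fun s _ => ?_
  rw [← constHom_genVec_basis, h]

theorem coeffOp_mul (T S : Module.End ℂ (Smooth U)) :
    (coeffOp (T * S) : Module.End ℂ (SuperFun U d)) = coeffOp T * coeffOp S :=
  linearMap_ext_smul_constHom fun r z => by
    simp only [Module.End.mul_apply, coeffOp_smul_constHom]

theorem coeffOp_sub (T S : Module.End ℂ (Smooth U)) :
    (coeffOp (T - S) : Module.End ℂ (SuperFun U d)) = coeffOp T - coeffOp S :=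
  linearMap_ext_smul_constHom fun r z => by
    simp only [LinearMap.sub_apply, coeffOp_smul_constHom, sub_smul]

theorem coeffOp_mulLeft (g : Smooth U) : (coeffOp (LinearMap.mulLeft ℂ g) :
    Module.End ℂ (SuperFun U d)) = LinearMap.mulLeft ℂ (algebraMap _ _ g) :=
  linearMap_ext_smul_constHom fun r z => by
    rw [coeffOp_smul_constHom, LinearMap.mulLeft_apply, LinearMap.mulLeft_apply,
      ← Algebra.smul_def, smul_smul]

theorem coeffOp_mul_mulLeft_constHom (T : Module.End ℂ (Smooth U))
    (z : ExteriorAlgebra ℂ (Fin d ⊕ₗ Fin d → ℂ)) :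
    coeffOp T * LinearMap.mulLeft ℂ (constHom (genVec U d) z) =
      LinearMap.mulLeft ℂ (constHom (genVec U d) z) * coeffOp T :=
  linearMap_ext_smul_constHom fun r y => by
    simp only [Module.End.mul_apply, LinearMap.mulLeft_apply, mul_smul_comm, ← map_mul,
      coeffOp_smul_constHom]

theorem parity_coeffOp (T : Module.End ℂ (Smooth U)) (x : SuperFun U d) :
    parity U d (coeffOp T x) = coeffOp T (parity U d x) := by
  have : (parity U d).toLinearMap * coeffOp T = coeffOp T * (parity U d).toLinearMap :=
    linearMap_ext_smul_constHom fun r z => by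
      simp only [Module.End.mul_apply, coeffOp_smul_constHom, AlgHom.toLinearMap_apply,
        parity_smul, parity_constHom]
  exact LinearMap.congr_fun this x

/-- A coefficientwise operator is even, so its graded commutator is the ordinary one; it also
commutes with the monomials, so only commutators with coefficients of f remain. -/
theorem superComm_coeffOp (f : SuperFun U d) (T : Module.End ℂ (Smooth U)) :
    superComm (parity U d) f (coeffOp T) = ∑ s, coeffOp (superComm (AlgHom.id ℂ _)
      ((superBasis U d).repr f s) T) ∘ₗ LinearMap.mulLeft ℂ (superBasis U d s) := by
  have h1 : superComm (parity U d) f (coeffOp T) =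
      LinearMap.mulLeft ℂ f * coeffOp T - coeffOp T * LinearMap.mulLeft ℂ f := by
    refine LinearMap.ext fun x => ?_
    rw [superComm_apply, parity_coeffOp, parity_parity, sub_sub, ← map_add, ← add_mul,
      evenPart_add_oddPart]
    rfl
  have h2 : LinearMap.mulLeft ℂ f = ∑ s, coeffOp (LinearMap.mulLeft ℂ
      ((superBasis U d).repr f s)) * LinearMap.mulLeft ℂ (superBasis U d s) := by
    conv_lhs => rw [← (superBasis U d).sum_repr f]
    refine LinearMap.ext fun x => ?_
    rw [LinearMap.mulLeft_apply, Finset.sum_mul, LinearMap.sum_apply]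
    refine Finset.sum_congr rfl fun s _ => ?_
    rw [coeffOp_mulLeft, Module.End.mul_apply, LinearMap.mulLeft_apply, LinearMap.mulLeft_apply,
      Algebra.smul_def, mul_assoc]
  rw [h1, h2, Finset.sum_mul, Finset.mul_sum, ← Finset.sum_sub_distrib]
  refine Finset.sum_congr rfl fun s _ => ?_
  rw [superComm_id, coeffOp_sub, ← constHom_genVec_basis, mul_assoc,
    ← coeffOp_mul_mulLeft_constHom, ← mul_assoc, ← mul_assoc, ← coeffOp_mul, ← coeffOp_mul,
    ← sub_mul]
  rfl

/-- The extension of a differential operator to the coefficients has the same order. -/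
theorem DiffOpOrderLT.coeffOp {n : ℕ} : ∀ {T : Module.End ℂ (Smooth U)},
    DiffOpOrderLT (AlgHom.id ℂ _) n T →
    DiffOpOrderLT (parity U d) n (coeffOp T : Module.End ℂ (SuperFun U d)) := by
  induction n with
  | zero =>
    rintro T rfl
    exact linearMap_ext_smul_constHom fun r z => by
      rw [coeffOp_smul_constHom, LinearMap.zero_apply, LinearMap.zero_apply, zero_smul]
  | succ n ih =>
    intro T hT f
    rw [superComm_coeffOp]
    exact .sum _ fun s _ => .comp parity_parity le_rfl (ih (hT _))
      (isSuperCommutative_parity.mulLeft parity_parity _)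

/-! #### Operators that act on the rows of the matrix of components -/

/-- The operator `T` acts on the rows of the matrices of components by a constant matrix. -/
def IsRowOp (T : SuperFun U d →ₗ[Smooth U] SuperFun U d) : Prop :=
  ∃ e : Finset (Fin d) → Finset (Fin d) → ℂ, ∀ x K L,
    coeffIJ K L (T x) = ∑ I, e K I • coeffIJ I L x

variable (U d) in
/-- The coordinates `θ^1, …, θ^d` as vectors. -/
def thetaVec (α : Fin d) : Fin d ⊕ₗ Fin d → Smooth U := Pi.single (toLex (Sum.inl α)) 1

theorem monomial_eq (I L : Finset (Fin d)) : monomial U I L =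
    constHom (thetaVec U d) ((Pi.basisFun ℂ _).ExteriorAlgebra I) *
      (L.sort.map (thetaBar U)).prod := by
  rw [constHom_basis]
  rfl

/-- The factor θ^I stands to the left of θ̄^L, so an operator that changes only the θ-part, with
constant coefficients, acts on the row index alone. -/
theorem isRowOp_of_constHom {T : SuperFun U d →ₗ[Smooth U] SuperFun U d}
    (t : ExteriorAlgebra ℂ (Fin d → ℂ) → ExteriorAlgebra ℂ (Fin d → ℂ))
    (h : ∀ z (L : Finset (Fin d)), T (constHom (thetaVec U d) z * (L.sort.map (thetaBar U)).prod) =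
      constHom (thetaVec U d) (t z) * (L.sort.map (thetaBar U)).prod) : IsRowOp T := by
  refine ⟨fun K I => (Pi.basisFun ℂ _).ExteriorAlgebra.repr
    (t ((Pi.basisFun ℂ _).ExteriorAlgebra I)) K, fun x K L => ?_⟩
  have hm : ∀ I L, T (monomial U I L) = ∑ K, (Pi.basisFun ℂ _).ExteriorAlgebra.repr
      (t ((Pi.basisFun ℂ _).ExteriorAlgebra I)) K • monomial U K L := by
    intro I L
    rw [monomial_eq, h, constHom_eq_sum, Finset.sum_mul]
    refine Finset.sum_congr rfl fun K _ => ?_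
    rw [smul_mul_assoc]
    rfl
  conv_lhs => rw [← sum_coeffIJ_smul_monomial x]
  simp only [map_sum, map_smul, hm]
  refine Finset.sum_congr rfl fun I _ => ?_
  have hc : ∀ (c : ℂ) (y : SuperFun U d), coeffIJ K L (c • y) = c • coeffIJ K L y := fun c y =>
    ((coeffIJ K L).restrictScalars ℂ).map_smul c y
  simp only [hc, coeffIJ_monomial]
  rw [Finset.sum_eq_single L]
  · rw [Finset.sum_eq_single K]
    · simp [mul_comm]
    · intro K' _ hK'
      simp [hK']
    · simp
  · intro L' _ hL'
    simp [hL']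
  · simp

theorem isRowOp_theta (α : Fin d) : IsRowOp (LinearMap.mulLeft (Smooth U) (theta U α)) := by
  refine isRowOp_of_constHom (fun z => ExteriorAlgebra.ι ℂ (Pi.single α 1) * z) fun z L => ?_
  rw [LinearMap.mulLeft_apply, map_mul, constHom_ι_single, mul_assoc]
  rfl

theorem isRowOp_dTheta (α : Fin d) :
    IsRowOp (leftDeriv (LinearMap.proj (toLex (Sum.inl α))) :
      SuperFun U d →ₗ[Smooth U] SuperFun U d) := by
  refine isRowOp_of_constHom (CliffordAlgebra.contractLeft (LinearMap.proj α)) fun z L => ?_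
  have h0 : ∀ l : List (Fin d), leftDeriv (LinearMap.proj (toLex (Sum.inl α)))
      (l.map (thetaBar U)).prod = 0 := by
    intro l
    induction l with
    | nil => exact leftDeriv_algebraMap _ 1
    | cons β l ih =>
      rw [List.map_cons, List.prod_cons, leftDeriv_mul, ih, mul_zero, add_zero, thetaBar,
        leftDeriv_ι, LinearMap.proj_apply, Pi.single_eq_of_ne (by simp), map_zero, zero_mul]
  rw [leftDeriv_mul, h0, mul_zero, add_zero, leftDeriv_constHom]
  intro v
  rw [Fintype.linearCombination_apply, map_sum]
  rw [Finset.sum_eq_single α]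
  · simp [thetaVec, Algebra.algebraMap_eq_smul_one]
  · intro i _ hi
    simp [thetaVec, Ne.symm hi]
  · simp

end Components

/-! ### Left star multiplication as a formal operator -/

section StarOp

variable {m : ℕ} {U : TopologicalSpace.Opens (Fin m → ℂ)}
  {C : ℕ → Smooth U →ₗ[ℂ] Smooth U →ₗ[ℂ] Smooth U}

theorem act_add_right {A : Type*} [Ring A] [Algebra ℂ A] (N : LaurentSeries (Module.End ℂ A))
    (x y : LaurentSeries A) : act N (x + y) = act N x + act N y :=
  congrArg (HahnModule.of (Module.End ℂ A)).symm
    (smul_add N (HahnModule.of _ x) (HahnModule.of _ y))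

/-- The formal operator of left star multiplication. -/
def starOp (C : ℕ → Smooth U →ₗ[ℂ] Smooth U →ₗ[ℂ] Smooth U) (f : LaurentSeries (Smooth U)) :
    LaurentSeries (Module.End ℂ (Smooth U)) :=
  HahnSeries.ofSuppBddBelow (fun n => ∑ᶠ r : ℕ, C r (f.coeff (n - r))) ⟨f.order, fun n hn => by
    by_contra hlt
    refine hn (finsum_eq_zero_of_forall_eq_zero fun r => ?_)
    rw [HahnSeries.coeff_eq_zero_of_lt_order (by omega), map_zero]⟩

theorem coeff_starOp {f : LaurentSeries (Smooth U)} {a : ℤ} (hf : ∀ k < a, f.coeff k = 0) {n : ℤ}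
    {M : ℕ} (hM : n - a < M) :
    (starOp C f).coeff n = ∑ r ∈ Finset.range M, C r (f.coeff (n - r)) := by
  refine finsum_eq_sum_of_support_subset _ fun r hr => ?_
  rw [Finset.coe_range, Set.mem_Iio]
  by_contra hlt
  exact hr (by dsimp only; rw [hf _ (by omega), map_zero])

theorem act_starOp (f g : LaurentSeries (Smooth U)) : act (starOp C f) g = starMul C f g := by
  obtain ⟨a, ha⟩ := exists_coeff_eq_zero_of_lt f
  obtain ⟨b, hb⟩ := exists_coeff_eq_zero_of_lt g
  have h0 : ∀ k < a, (starOp C f).coeff k = 0 := fun k hk => by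
    rw [coeff_starOp (M := 0) ha (by simp; omega), Finset.sum_range_zero]
  ext n
  -- Pairs (r, q) are reindexed by (r, k), where k = q + r is the power of ν in the operator.
  let e : ℕ × ℤ ≃ ℕ × ℤ :=
    { toFun := fun p => (p.1, p.2 - p.1)
      invFun := fun p => (p.1, p.2 + p.1)
      left_inv := fun p => by simp
      right_inv := fun p => by simp }
  rw [coeff_act h0 hb, coeff_starMul, ← finsum_comp_equiv e,
    finsum_eq_sum_of_support_subset (s := Finset.range (n - b - a + 1).toNat ×ˢ
      Finset.Icc a (n - b)), Finset.sum_product_right]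
  · refine Finset.sum_congr rfl fun k hk => ?_
    rw [Finset.mem_Icc] at hk
    rw [coeff_starOp (M := (n - b - a + 1).toNat) ha (by omega), LinearMap.sum_apply]
    refine Finset.sum_congr rfl fun r _ => ?_
    simp only [e, Equiv.coe_fn_mk]
    rw [show n - (r : ℤ) - (k - r) = n - k by ring]
  · rintro ⟨r, k⟩ h
    simp only [e, Equiv.coe_fn_mk, Function.mem_support] at h
    have h1 : a ≤ k - r := by
      by_contra hlt
      exact h (by rw [ha _ (by omega), map_zero, LinearMap.zero_apply])
    have h2 : b ≤ n - r - (k - r) := by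
      by_contra hlt
      exact h (by rw [hb (n - r - (k - r)) (by omega), map_zero])
    simp only [Finset.coe_product, Set.mem_prod, Finset.mem_coe, Finset.mem_range, Finset.mem_Icc]
    omega

theorem starMul_add (f g h : LaurentSeries (Smooth U)) :
    starMul C f (g + h) = starMul C f g + starMul C f h := by
  rw [← act_starOp, act_add_right, act_starOp, act_starOp]

theorem add_starMul (f g h : LaurentSeries (Smooth U)) :
    starMul C (f + g) h = starMul C f h + starMul C g h := by
  rw [← starMul_flip, starMul_add, starMul_flip, starMul_flip]

theorem starMul_zero (f : LaurentSeries (Smooth U)) : starMul C f 0 = 0 := by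
  have := starMul_add (C := C) f 0 0
  rwa [add_zero, left_eq_add] at this

theorem zero_starMul (f : LaurentSeries (Smooth U)) : starMul C 0 f = 0 := by
  rw [← starMul_flip, starMul_zero]

theorem starMul_sum {ι : Type*} (s : Finset ι) (f : LaurentSeries (Smooth U))
    (g : ι → LaurentSeries (Smooth U)) :
    starMul C f (∑ i ∈ s, g i) = ∑ i ∈ s, starMul C f (g i) :=
  map_sum (AddMonoidHom.mk' (starMul C f) (starMul_add f)) g s

theorem sum_starMul {ι : Type*} (s : Finset ι) (f : LaurentSeries (Smooth U))
    (g : ι → LaurentSeries (Smooth U)) :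
    starMul C (∑ i ∈ s, g i) f = ∑ i ∈ s, starMul C (g i) f :=
  map_sum (AddMonoidHom.mk' (fun g => starMul C g f) fun _ _ => add_starMul _ _ _) g s

theorem coeff_starMul_eq_zero {f g : LaurentSeries (Smooth U)} {a b n : ℤ}
    (hf : ∀ k < a, f.coeff k = 0) (hg : ∀ k < b, g.coeff k = 0) (hn : n < a + b) :
    (starMul C f g).coeff n = 0 := by
  rw [← act_starOp]
  refine coeff_act_eq_zero (fun k hk => ?_) hg hn
  rw [coeff_starOp (M := 0) hf (by simp; omega), Finset.sum_range_zero]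

theorem single_mul_starMul (k : ℤ) (f g : LaurentSeries (Smooth U)) :
    starMul C (HahnSeries.single k 1 * f) g = HahnSeries.single k 1 * starMul C f g := by
  ext n
  let e : ℕ × ℤ ≃ ℕ × ℤ := (Equiv.refl ℕ).prodCongr (Equiv.addRight k)
  rw [HahnSeries.coeff_single_mul, one_mul, coeff_starMul, coeff_starMul, ← finsum_comp_equiv e]
  refine finsum_congr fun p => ?_
  simp only [e, Equiv.prodCongr_apply, Equiv.coe_refl, Prod.map_fst, id_eq, Prod.map_snd,
    Equiv.coe_addRight]
  rw [HahnSeries.coeff_single_mul, one_mul, add_sub_cancel_right,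
    show n - (p.1 : ℤ) - (p.2 + k) = n - k - p.1 - p.2 by ring]

/-- Read off from 1 ⋆ g = g; it makes constants act as scalars under ⋆. -/
theorem IsNaturalStar.C_one (hC : IsNaturalStar C) {r : ℕ} (hr : r ≠ 0) (c : ℂ) (g : Smooth U) :
    C r (algebraMap ℂ _ c) g = 0 := by
  have := congrArg (fun F => F.coeff (r : ℤ)) (hC.one_star (HahnSeries.C g))
  rw [← map_one HahnSeries.C, coeff_C_starMul_C, if_pos (by positivity), Int.toNat_natCast,
    HahnSeries.C_apply, HahnSeries.coeff_single_of_ne (by omega)] at this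
  rw [Algebra.algebraMap_eq_smul_one, map_smul, LinearMap.smul_apply, this, smul_zero]

theorem IsNaturalStar.single_starMul (hC : IsNaturalStar C) (j : ℤ) (c : ℂ)
    (g : LaurentSeries (Smooth U)) (n : ℤ) :
    (starMul C (HahnSeries.single j (algebraMap ℂ _ c)) g).coeff n = c • g.coeff (n - j) := by
  have : HahnSeries.single j (algebraMap ℂ (Smooth U) c) =
      HahnSeries.single j 1 * HahnSeries.C (algebraMap ℂ _ c) := by
    rw [HahnSeries.C_apply, HahnSeries.single_mul_single, add_zero, one_mul]
  rw [this, single_mul_starMul, HahnSeries.coeff_single_mul, one_mul,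
    C_starMul_eq_mul hC.C_zero (fun r hr => hC.C_one hr c), HahnSeries.C_apply,
    HahnSeries.coeff_single_zero_mul, Algebra.smul_def]

theorem coeff_starOp_C (f : Smooth U) (n : ℤ) :
    (starOp C (HahnSeries.C f)).coeff n = if 0 ≤ n then C n.toNat f else 0 := by
  change ∑ᶠ r : ℕ, C r _ = _
  split_ifs with h
  · rw [finsum_eq_single _ n.toNat]
    · rw [HahnSeries.C_apply, show n - (n.toNat : ℤ) = 0 by omega, HahnSeries.coeff_single_same]
    · intro r hr
      rw [HahnSeries.C_apply, HahnSeries.coeff_single_of_ne (by omega), map_zero]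
  · refine finsum_eq_zero_of_forall_eq_zero fun r => ?_
    rw [HahnSeries.C_apply, HahnSeries.coeff_single_of_ne (by omega), map_zero]

end StarOp

/-! ### Matrices over the star algebra -/

section Matrices

variable {m d : ℕ} {U : TopologicalSpace.Opens (Fin m → ℂ)}
  {C : ℕ → Smooth U →ₗ[ℂ] Smooth U →ₗ[ℂ] Smooth U}

/-- Matrices of formal functions, indexed by the subsets of `{1, …, d}`. -/
abbrev CompMatrix (U : TopologicalSpace.Opens (Fin m → ℂ)) (d : ℕ) : Type :=
  Matrix (Finset (Fin d)) (Finset (Fin d)) (LaurentSeries (Smooth U))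

/-- The product of matrices over the star algebra. -/
def matStar (C : ℕ → Smooth U →ₗ[ℂ] Smooth U →ₗ[ℂ] Smooth U) (F G : CompMatrix U d) :
    CompMatrix U d :=
  fun K J => ∑ I, starMul C (F K I) (G I J)

theorem matStar_apply (F G : CompMatrix U d) (K J : Finset (Fin d)) :
    matStar C F G K J = ∑ I, starMul C (F K I) (G I J) := rfl

theorem matMul_eq_matStar (S : StarProductSV U) (F G : CompMatrix U d) :
    matMul S F G = matStar S.C F G := rfl

theorem IsNaturalStar.matStar_assoc (hC : IsNaturalStar C) (F G H : CompMatrix U d) :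
    matStar C (matStar C F G) H = matStar C F (matStar C G H) := by
  ext1 K J
  simp only [matStar, sum_starMul, starMul_sum, hC.assoc]
  exact Finset.sum_comm

theorem IsNaturalStar.one_matStar (hC : IsNaturalStar C) (F : CompMatrix U d) :
    matStar C 1 F = F := by
  ext1 K J
  rw [matStar, Finset.sum_eq_single K, Matrix.one_apply_eq, hC.one_star]
  · intro I _ hI
    rw [Matrix.one_apply_ne hI.symm, zero_starMul]
  · simp

theorem IsNaturalStar.matStar_one (hC : IsNaturalStar C) (F : CompMatrix U d) :
    matStar C F 1 = F := by
  ext1 K J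
  rw [matStar, Finset.sum_eq_single J, Matrix.one_apply_eq, hC.star_one]
  · intro I _ hI
    rw [Matrix.one_apply_ne hI, starMul_zero]
  · simp

theorem add_matStar (F G H : CompMatrix U d) :
    matStar C (F + G) H = matStar C F H + matStar C G H := by
  ext1 K J
  simp only [matStar, Matrix.add_apply, add_starMul, Finset.sum_add_distrib]

/-- Multiplication of a matrix by `ν^k`. -/
def shiftMat (k : ℤ) (F : CompMatrix U d) : CompMatrix U d :=
  fun K I => HahnSeries.single k 1 * F K I

theorem shiftMat_matStar (k : ℤ) (F G : CompMatrix U d) :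
    matStar C (shiftMat k F) G = shiftMat k (matStar C F G) := by
  ext1 K J
  simp only [matStar, shiftMat, single_mul_starMul, Finset.mul_sum]

theorem coeff_matStar_eq_zero {F G : CompMatrix U d} {a b n : ℤ}
    (hF : ∀ K I, ∀ k < a, (F K I).coeff k = 0) (hG : ∀ K I, ∀ k < b, (G K I).coeff k = 0)
    (hn : n < a + b) (K I) : (matStar C F G K I).coeff n = 0 := by
  rw [matStar, HahnSeries.coeff_sum]
  exact Finset.sum_eq_zero fun J _ => coeff_starMul_eq_zero (hF K J) (hG J I) hn

/-! #### Components of formal functions -/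

/-- The matrix of the components of a formal function. -/
def compMat (f : LaurentSeries (SuperFun U d)) : CompMatrix U d := comp f

theorem coeff_compMat (f : LaurentSeries (SuperFun U d)) (I J : Finset (Fin d)) (n : ℤ) :
    (compMat f I J).coeff n = coeffIJ I J (f.coeff n) := rfl

theorem compMat_add (f g : LaurentSeries (SuperFun U d)) :
    compMat (f + g) = compMat f + compMat g := by
  ext I J n
  exact map_add (coeffIJ I J) _ _

theorem compMat_injective :
    Function.Injective (compMat : LaurentSeries (SuperFun U d) → CompMatrix U d) := by
  intro f g h
  ext n
  refine superFun_ext fun I J => ?_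
  rw [← coeff_compMat, ← coeff_compMat, h]

theorem coeff_ofComp (h : CompMatrix U d) (n : ℤ) :
    (ofComp h).coeff n = ∑ I, ∑ J, (h I J).coeff n • monomial U I J := by
  simp only [ofComp, HahnSeries.coeff_sum]
  rfl

theorem compMat_ofComp (h : CompMatrix U d) : compMat (ofComp h) = h := by
  ext I J n
  rw [coeff_compMat, coeff_ofComp]
  simp only [map_sum, map_smul, coeffIJ_monomial]
  rw [Finset.sum_eq_single I]
  · rw [Finset.sum_eq_single J]
    · simp
    · intro J' _ hJ
      simp [hJ]
    · simp
  · intro I' _ hI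
    simp [hI]
  · simp

theorem compMat_single_mul (k : ℤ) (f : LaurentSeries (SuperFun U d)) :
    compMat (HahnSeries.single k 1 * f) = shiftMat k (compMat f) := by
  ext I J n
  change _ = (HahnSeries.single k 1 * compMat f I J).coeff n
  rw [coeff_compMat, HahnSeries.coeff_single_mul, HahnSeries.coeff_single_mul, one_mul,
    one_mul, coeff_compMat]

end Matrices

/-! ### Matrices that act by natural operators -/

section Rep

variable {m d : ℕ} {U : TopologicalSpace.Opens (Fin m → ℂ)}
  {C : ℕ → Smooth U →ₗ[ℂ] Smooth U →ₗ[ℂ] Smooth U} {u : LaurentSeries (SuperFun U d)}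

/-- The matrix `F` over the star algebra, which has no negative powers of `ν`, acts on formal
functions (by multiplication of the matrix of components of `u x` from the left) by the natural
operator `N`. -/
structure IsRep (C : ℕ → Smooth U →ₗ[ℂ] Smooth U →ₗ[ℂ] Smooth U) (u : LaurentSeries (SuperFun U d))
    (F : CompMatrix U d) (N : LaurentSeries (Module.End ℂ (SuperFun U d))) : Prop where
  nonneg : ∀ K I, ∀ n < 0, (F K I).coeff n = 0
  natural : IsNaturalOp (parity U d) N
  comp_eq : ∀ x, compMat (u * act N x) = matStar C F (compMat (u * x))

theorem IsRep.add {F F' : CompMatrix U d} {N N'} (h : IsRep C u F N) (h' : IsRep C u F' N') :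
    IsRep C u (F + F') (N + N') where
  nonneg K I n hn := by
    rw [Matrix.add_apply, HahnSeries.coeff_add, h.nonneg K I n hn, h'.nonneg K I n hn, add_zero]
  natural := h.natural.add h'.natural
  comp_eq x := by rw [act_add, mul_add, compMat_add, h.comp_eq, h'.comp_eq, add_matStar]

theorem IsRep.mul (hC : IsNaturalStar C) {F F' : CompMatrix U d} {N N'} (h : IsRep C u F N)
    (h' : IsRep C u F' N') : IsRep C u (matStar C F F') (N * N') where
  nonneg K I n hn := coeff_matStar_eq_zero h.nonneg h'.nonneg (by omega) K I
  natural := h.natural.mul parity_parity h'.natural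
  comp_eq x := by rw [act_mul, h.comp_eq, h'.comp_eq, hC.matStar_assoc]

theorem IsNaturalOp.shift {N : LaurentSeries (Module.End ℂ (SuperFun U d))}
    (h : IsNaturalOp (parity U d) N) (k : ℕ) :
    IsNaturalOp (parity U d) (HahnSeries.single (k : ℤ) 1 * N) := by
  intro n
  rw [HahnSeries.coeff_single_mul, one_mul]
  exact (h _).mono (by omega)

theorem act_single_mul (k : ℤ) (N : LaurentSeries (Module.End ℂ (SuperFun U d)))
    (x : LaurentSeries (SuperFun U d)) :
    act (HahnSeries.single k 1 * N) x = HahnSeries.single k 1 * act N x := by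
  ext1
  funext n
  rw [act_mul, coeff_act_single, HahnSeries.coeff_single_mul, one_mul, Module.End.one_apply]

theorem mul_single_mul (k : ℤ) (x y : LaurentSeries (SuperFun U d)) :
    x * (HahnSeries.single k 1 * y) = HahnSeries.single k 1 * (x * y) := by
  rw [← mul_assoc, ← mul_assoc]
  congr 1
  ext1
  funext n
  rw [HahnSeries.coeff_single_mul, HahnSeries.coeff_mul_single, one_mul, mul_one]

theorem IsRep.shift {F : CompMatrix U d} {N} (h : IsRep C u F N) (k : ℕ) :
    IsRep C u (shiftMat k F) (HahnSeries.single (k : ℤ) 1 * N) where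
  nonneg K I n hn := by
    change (HahnSeries.single (k : ℤ) 1 * F K I).coeff n = 0
    rw [HahnSeries.coeff_single_mul, one_mul, h.nonneg K I _ (by omega)]
  natural := h.natural.shift k
  comp_eq x := by
    rw [act_single_mul, mul_single_mul, compMat_single_mul, h.comp_eq, shiftMat_matStar]

/-- The coefficient of a formal function at `ν^n` depends on finitely many coefficients of the
operator. -/
theorem coeff_act_congr {A : Type*} [Ring A] [Algebra ℂ A]
    {N N' : LaurentSeries (Module.End ℂ A)} {x : LaurentSeries A} {a b n : ℤ}
    (hN : ∀ k < a, N.coeff k = N'.coeff k) (hx : ∀ k < b, x.coeff k = 0) (hn : n < a + b) :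
    (act N x).coeff n = (act N' x).coeff n := by
  rw [← sub_eq_zero, ← HahnSeries.coeff_sub, ← act_sub]
  exact coeff_act_eq_zero (fun k hk => by rw [HahnSeries.coeff_sub, hN k hk, sub_self]) hx hn

theorem coeff_matStar_congr {F F' G : CompMatrix U d} {a b n : ℤ}
    (hF : ∀ K I, ∀ k < a, (F K I).coeff k = (F' K I).coeff k)
    (hG : ∀ K I, ∀ k < b, (G K I).coeff k = 0) (hn : n < a + b) (K I) :
    (matStar C F G K I).coeff n = (matStar C F' G K I).coeff n := by
  have e : F = (F - F') + F' := (sub_add_cancel F F').symm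
  rw [e, add_matStar, Matrix.add_apply, HahnSeries.coeff_add, coeff_matStar_eq_zero (a := a)
    (fun K I k hk => ?_) hG hn, zero_add]
  rw [Matrix.sub_apply, HahnSeries.coeff_sub, hF K I k hk, sub_self]

theorem exists_comp_coeff_eq_zero (x : LaurentSeries (SuperFun U d)) :
    ∃ b : ℤ, ∀ I J, ∀ k < b, (compMat x I J).coeff k = 0 := by
  obtain ⟨b, hb⟩ := exists_coeff_eq_zero_of_lt x
  exact ⟨b, fun I J k hk => by rw [coeff_compMat, hb k hk, map_zero]⟩

/-- Limits in the `ν`-adic topology. -/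
theorem IsRep.of_limit {F : CompMatrix U d} {N : LaurentSeries (Module.End ℂ (SuperFun U d))}
    {Fs : ℕ → CompMatrix U d} {Ns : ℕ → LaurentSeries (Module.End ℂ (SuperFun U d))}
    (h : ∀ k, IsRep C u (Fs k) (Ns k))
    (hF : ∀ (k : ℕ) K I, ∀ n < (k : ℤ), (F K I).coeff n = (Fs k K I).coeff n)
    (hN : ∀ (k : ℕ), ∀ n < (k : ℤ), N.coeff n = (Ns k).coeff n) : IsRep C u F N where
  nonneg K I n hn := by rw [hF 0 K I n hn, (h 0).nonneg K I n hn]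
  natural n := by
    rw [hN (n + 1).toNat n (by omega)]
    exact (h _).natural n
  comp_eq x := by
    obtain ⟨b, hb⟩ := exists_comp_coeff_eq_zero (u * x)
    obtain ⟨a, ha⟩ := exists_coeff_eq_zero_of_lt u
    obtain ⟨c, hc⟩ := exists_coeff_eq_zero_of_lt x
    ext K I n
    -- The stage k is so late that neither the change of F, against the series u x starting at ν^b,
    -- nor the change of N, against x starting at ν^c and u at ν^a, reaches ν^n.
    obtain ⟨k, hk⟩ : ∃ k : ℕ, n < k + b ∧ n - a < k + c :=
      ⟨(max (n - b) (n - a - c) + 1).toNat, by omega, by omega⟩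
    rw [coeff_matStar_congr (hF k) hb hk.1, ← (h k).comp_eq, coeff_compMat, coeff_compMat]
    congr 1
    have h0 : ∀ j < (k : ℤ) + c, (act N x - act (Ns k) x).coeff j = 0 := fun j hj => by
      rw [HahnSeries.coeff_sub, coeff_act_congr (hN k) hc hj, sub_self]
    rw [← sub_eq_zero, ← HahnSeries.coeff_sub, ← mul_sub, coeff_mul_eq_sum ha h0,
      Finset.Icc_eq_empty (by omega), Finset.sum_empty]

end Rep

/-! ### The generating natural operators -/

section Potential

variable {m d : ℕ} {U : TopologicalSpace.Opens (Fin m → ℂ)}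
  {C : ℕ → Smooth U →ₗ[ℂ] Smooth U →ₗ[ℂ] Smooth U} {Y : LaurentSeries (SuperFun U d)}

theorem opMul_exp_conj_eq_add {A : Type*} [Ring A] [Algebra ℂ A]
    [Algebra ℚ (LaurentSeries (Module.End ℂ A))] [Module ℚ (LaurentSeries A)]
    {N : LaurentSeries (Module.End ℂ A)} {X : LaurentSeries A} (hX : IsNilpotent X)
    (h : Commute (N * opMul X - opMul X * N) (opMul X)) :
    opMul (IsNilpotent.exp (-X)) * N * opMul (IsNilpotent.exp X) =
      N + (N * opMul X - opMul X * N) := by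
  rw [opMul_exp hX, opMul_exp hX.neg, map_neg]
  exact exp_conj_eq_add (hX.map opMul) h

theorem commute_of_isEven {f : LaurentSeries (SuperFun U d)} (hf : IsEven f)
    (g : LaurentSeries (SuperFun U d)) : f * g = g * f := by
  obtain ⟨a, ha⟩ := exists_coeff_eq_zero_of_lt f
  obtain ⟨b, hb⟩ := exists_coeff_eq_zero_of_lt g
  ext n
  rw [coeff_mul_eq_sum ha hb, coeff_mul_eq_sum' hb ha]
  exact Finset.sum_congr rfl fun k _ => commute_of_even (hf k) _

theorem isEven_exp (he : IsEven Y) (hn : IsNilpotent Y) : IsEven (IsNilpotent.exp Y) := by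
  have h1 : laurentMap (parity U d).toRingHom Y = Y := by
    ext n
    exact he n
  have h2 := hn.map_exp (laurentMap (parity U d).toRingHom)
  rw [h1] at h2
  intro n
  exact congrArg (fun f => f.coeff n) h2

/-- Conjugation turns an operator that acts on the components of x into one that acts on the
components of u x. -/
theorem isRep_of_comp (he : IsEven Y) (hn : IsNilpotent Y) (h1 : ∀ n < -1, Y.coeff n = 0)
    {F : CompMatrix U d} {N : LaurentSeries (Module.End ℂ (SuperFun U d))}
    (hF : ∀ K I, ∀ n < 0, (F K I).coeff n = 0) (hN : IsNaturalOp (parity U d) N)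
    (h : ∀ x, compMat (act N x) = matStar C F (compMat x)) :
    IsRep C (IsNilpotent.exp Y) F
      (opMul (IsNilpotent.exp (-Y)) * N * opMul (IsNilpotent.exp Y)) where
  nonneg := hF
  natural := hN.exp_conj h1 he hn
  comp_eq x := by
    rw [act_opMul_mul_mul, ← mul_assoc, IsNilpotent.exp_mul_exp_neg_self hn, one_mul, h]

/-- Constants act as scalars under ⋆, so a row operator is star multiplication by a constant matrix.
-/
theorem comp_act_of_isRowOp (hC : IsNaturalStar C) {T : SuperFun U d →ₗ[Smooth U] SuperFun U d}
    (hT : IsRowOp T) (j : ℤ) : ∃ F : CompMatrix U d, (∀ K I, ∀ n < j, (F K I).coeff n = 0) ∧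
      ∀ x, compMat (act (HahnSeries.single j (T.restrictScalars ℂ)) x) =
        matStar C F (compMat x) := by
  obtain ⟨e, he⟩ := hT
  refine ⟨Matrix.of fun K I => HahnSeries.single j (algebraMap ℂ _ (e K I)),
    fun K I n hn => HahnSeries.coeff_single_of_ne hn.ne, fun x => ?_⟩
  ext K L n
  rw [coeff_compMat, coeff_act_single, matStar_apply, HahnSeries.coeff_sum]
  refine (he _ K L).trans (Finset.sum_congr rfl fun I _ => ?_)
  rw [Matrix.of_apply, hC.single_starMul, coeff_compMat]

/-- Coefficientwise operators, as an additive map. -/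
def coeffOpHom (U : TopologicalSpace.Opens (Fin m → ℂ)) (d : ℕ) :
    Module.End ℂ (Smooth U) →+ Module.End ℂ (SuperFun U d) :=
  AddMonoidHom.ofMapSub coeffOp coeffOp_sub

/-- The formal operator of coefficientwise left star multiplication by `f`. -/
def coeffStarOp (C : ℕ → Smooth U →ₗ[ℂ] Smooth U →ₗ[ℂ] Smooth U) (d : ℕ) (f : Smooth U) :
    LaurentSeries (Module.End ℂ (SuperFun U d)) :=
  (starOp C (HahnSeries.C f)).map (coeffOpHom U d)

theorem coeff_coeffStarOp (f : Smooth U) (n : ℤ) : (coeffStarOp C d f).coeff n =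
    coeffOp ((starOp C (HahnSeries.C f)).coeff n) := rfl

theorem coeffStarOp_coeff_eq_zero (f : Smooth U) {n : ℤ} (hn : n < 0) :
    (coeffStarOp C d f).coeff n = 0 := by
  rw [coeff_coeffStarOp, coeff_starOp_C, if_neg (not_le.2 hn)]
  exact map_zero (coeffOpHom U d)

theorem IsNaturalStar.isNaturalOp_coeffStarOp (hC : IsNaturalStar C) (f : Smooth U) :
    IsNaturalOp (parity U d) (coeffStarOp C d f) := by
  intro n
  by_cases hn : 0 ≤ n
  · rw [coeff_coeffStarOp, coeff_starOp_C, if_pos hn]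
    exact ((hC.natural f n.toNat).mono (by omega)).coeffOp
  · rw [coeffStarOp_coeff_eq_zero f (not_le.1 hn)]
    exact .zero _

theorem compMat_act_coeffStarOp (f : Smooth U) (x : LaurentSeries (SuperFun U d)) (I J) :
    compMat (act (coeffStarOp C d f) x) I J = starMul C (HahnSeries.C f) (compMat x I J) := by
  obtain ⟨b, hb⟩ := exists_coeff_eq_zero_of_lt x
  rw [← act_starOp]
  ext n
  rw [coeff_compMat, coeff_act (fun k hk => coeffStarOp_coeff_eq_zero f hk) hb,
    coeff_act (a := 0) (b := b) (fun k hk => by rw [coeff_starOp_C, if_neg (not_le.2 hk)])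
      (fun k hk => by rw [coeff_compMat, hb k hk, map_zero]), map_sum]
  refine Finset.sum_congr rfl fun k _ => ?_
  rw [coeff_coeffStarOp, coeffIJ_coeffOp, coeff_compMat]

theorem compMat_act_coeffStarOp' (f : Smooth U) (x : LaurentSeries (SuperFun U d)) :
    compMat (act (coeffStarOp C d f) x) =
      matStar C (Matrix.diagonal fun _ => HahnSeries.C f) (compMat x) := by
  ext1 K J
  rw [compMat_act_coeffStarOp, matStar_apply, Finset.sum_eq_single K, Matrix.diagonal_apply_eq]
  · intro I _ hI
    rw [Matrix.diagonal_apply_ne _ hI.symm, zero_starMul]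
  · simp

/-! #### Leading terms -/

/-- The function `g` is the leading term of a formal function `N 1`, where `N` is a natural operator
by which a matrix over the star algebra acts. -/
def IsLeading (C : ℕ → Smooth U →ₗ[ℂ] Smooth U →ₗ[ℂ] Smooth U) (u : LaurentSeries (SuperFun U d))
    (g : SuperFun U d) : Prop :=
  ∃ F N, IsRep C u F N ∧ N.coeff 0 1 = g

theorem coeff_one_of_neg {k : ℤ} (hk : k < 0) : (1 : LaurentSeries (SuperFun U d)).coeff k = 0 := by
  rw [HahnSeries.coeff_one, if_neg hk.ne]

theorem IsNaturalOp.coeff_zero_act {N : LaurentSeries (Module.End ℂ (SuperFun U d))}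
    (h : IsNaturalOp (parity U d) N) {x : LaurentSeries (SuperFun U d)}
    (hx : ∀ k < 0, x.coeff k = 0) : (act N x).coeff 0 = N.coeff 0 (x.coeff 0) :=
  coeff_act_add (a := 0) (b := 0) (fun _ => h.coeff_eq_zero) hx

theorem IsLeading.iff_act {u : LaurentSeries (SuperFun U d)} {g : SuperFun U d} :
    IsLeading C u g ↔ ∃ F N, IsRep C u F N ∧ (act N 1).coeff 0 = g := by
  refine exists_congr fun F => exists_congr fun N => and_congr_right fun h => ?_
  rw [h.natural.coeff_zero_act fun _ => coeff_one_of_neg, HahnSeries.coeff_one, if_pos rfl]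

variable {u : LaurentSeries (SuperFun U d)} {g g' : SuperFun U d}

theorem IsLeading.add (h : IsLeading C u g) (h' : IsLeading C u g') : IsLeading C u (g + g') := by
  obtain ⟨F, N, h, rfl⟩ := h
  obtain ⟨F', N', h', rfl⟩ := h'
  exact ⟨_, _, h.add h', rfl⟩

/-- The ν⁰ term of N N' is N_0 N'_0, and N_0 is multiplication by N_0 1. -/
theorem IsLeading.mul (hC : IsNaturalStar C) (h : IsLeading C u g) (h' : IsLeading C u g') :
    IsLeading C u (g * g') := by
  obtain ⟨F, N, h, rfl⟩ := h
  obtain ⟨F', N', h', rfl⟩ := h'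
  refine ⟨_, _, h.mul hC h', ?_⟩
  have h1 : N.coeff 0 = LinearMap.mulLeft ℂ (N.coeff 0 1) :=
    DiffOpOrderLT.eq_mulLeft isSuperCommutative_parity parity_parity (h.natural 0)
  have h2 := coeff_mul_eq_sum (x := N) (y := N') (fun k => h.natural.coeff_eq_zero)
    (fun k => h'.natural.coeff_eq_zero) 0
  rw [sub_zero, Finset.Icc_self, Finset.sum_singleton, sub_zero] at h2
  rw [h2, Module.End.mul_apply]
  conv_lhs => rw [h1]
  rw [LinearMap.mulLeft_apply]

theorem IsNondegeneratePotential.isRep_conj (hY : IsNondegeneratePotential Y)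
    {F : CompMatrix U d} {N : LaurentSeries (Module.End ℂ (SuperFun U d))}
    (hF : ∀ K I, ∀ n < 0, (F K I).coeff n = 0) (hN : IsNaturalOp (parity U d) N)
    (h : ∀ x, compMat (act N x) = matStar C F (compMat x)) :
    IsRep C (IsNilpotent.exp Y) F
      (opMul (IsNilpotent.exp (-Y)) * N * opMul (IsNilpotent.exp Y)) :=
  isRep_of_comp hY.even hY.nilpotent hY.coeff_eq_zero hF hN h

/-- Multiplication by θ^α is unchanged by conjugation, since e^Y is even. -/
theorem IsNondegeneratePotential.isLeading_theta (hY : IsNondegeneratePotential Y)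
    (hC : IsNaturalStar C) (α : Fin d) : IsLeading C (IsNilpotent.exp Y) (theta U α) := by
  obtain ⟨F, hF, h⟩ := comp_act_of_isRowOp hC (isRowOp_theta α) 0
  have hN : IsNaturalOp (parity U d) (HahnSeries.single ((0 : ℕ) : ℤ)
      ((LinearMap.mulLeft (Smooth U) (theta U α)).restrictScalars ℂ)) :=
    .single (isSuperCommutative_parity.mulLeft parity_parity _)
  refine IsLeading.iff_act.2 ⟨F, _, hY.isRep_conj hF hN h, ?_⟩
  rw [act_opMul_mul_mul, mul_one]
  have e : act (HahnSeries.single ((0 : ℕ) : ℤ)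
      ((LinearMap.mulLeft (Smooth U) (theta U α)).restrictScalars ℂ)) (IsNilpotent.exp Y) =
      IsNilpotent.exp Y * HahnSeries.C (theta U α) := by
    rw [commute_of_isEven (isEven_exp hY.even hY.nilpotent)]
    ext1
    funext n
    rw [coeff_act_single, HahnSeries.C_apply, HahnSeries.coeff_single_zero_mul, Nat.cast_zero,
      sub_zero]
    rfl
  rw [e, ← mul_assoc, IsNilpotent.exp_neg_mul_exp_self hY.nilpotent, one_mul, HahnSeries.C_apply,
    HahnSeries.coeff_single_same]

/-- The conjugate of ν ∂/∂θ^α is ν ∂/∂θ^α + ν ∂Y/∂θ^α. Its value at 1 has ν⁰ term ∂Y_{-1}/∂θ^α. -/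
theorem IsNondegeneratePotential.isLeading_dTheta (hY : IsNondegeneratePotential Y)
    (hC : IsNaturalStar C) (α : Fin d) :
    IsLeading C (IsNilpotent.exp Y) (dTheta α (Y.coeff (-1))) := by
  let D : SuperFun U d →ₗ[Smooth U] SuperFun U d := leftDeriv (LinearMap.proj (toLex (Sum.inl α)))
  obtain ⟨F, hF, h⟩ := comp_act_of_isRowOp hC (isRowOp_dTheta α) 1
  let N : LaurentSeries (Module.End ℂ (SuperFun U d)) :=
    HahnSeries.single ((1 : ℕ) : ℤ) (D.restrictScalars ℂ)
  have hN : IsNaturalOp (parity U d) N := .single (diffOpOrderLT_leftDeriv _)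
  -- Y is even, so the Leibniz rule leaves only multiplication by ν ∂Y/∂θ^α, which commutes with
  -- multiplication by Y.
  have hNY : N * opMul Y - opMul Y * N = opMul (act N Y) := by
    ext1
    funext n
    rw [HahnSeries.coeff_sub, HahnSeries.coeff_single_mul, HahnSeries.coeff_mul_single, coeff_opMul,
      coeff_opMul, coeff_act_single]
    refine LinearMap.ext fun x => ?_
    change D (Y.coeff _ * x) - Y.coeff _ * D x = D (Y.coeff _) * x
    rw [leftDeriv_mul, hY.even, add_sub_cancel_right]
  have hcomm : Commute (N * opMul Y - opMul Y * N) (opMul Y) := by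
    rw [hNY]
    change _ * _ = _ * _
    rw [← map_mul, ← map_mul, commute_of_isEven hY.even]
  refine IsLeading.iff_act.2 ⟨F, _, hY.isRep_conj (fun K I n hn => hF K I n (by omega)) hN h, ?_⟩
  rw [opMul_exp_conj_eq_add hY.nilpotent hcomm, hNY, act_add, act_opMul, mul_one,
    HahnSeries.coeff_add, coeff_act_single, coeff_act_single, HahnSeries.coeff_one,
    if_neg (by norm_num), map_zero, zero_add]
  rfl

/-- The value of a formal function at `θ = θ̄ = 0`. -/
def bodyHom (U : TopologicalSpace.Opens (Fin m → ℂ)) (d : ℕ) :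
    LaurentSeries (SuperFun U d) →+* LaurentSeries (Smooth U) :=
  laurentMap (ExteriorAlgebra.algebraMapInv : SuperFun U d →ₐ[Smooth U] Smooth U).toRingHom

theorem bodyHom_eq_comp (x : LaurentSeries (SuperFun U d)) : bodyHom U d x = compMat x ∅ ∅ := by
  ext n
  rw [coeff_compMat, coeffIJ_empty]
  rfl

/-- Evaluation at a point of U lands in Laurent series over ℂ, which have no nonzero nilpotents. -/
theorem eq_zero_of_isNilpotent {x : LaurentSeries (Smooth U)} (hx : IsNilpotent x) : x = 0 := by
  ext n
  refine Smooth.ext_eval fun p => ?_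
  have h := (hx.map (laurentMap (Smooth.eval p).toRingHom)).eq_zero
  rw [HahnSeries.coeff_zero, map_zero]
  exact congrArg (fun y => y.coeff n) h

theorem bodyHom_exp {X : LaurentSeries (SuperFun U d)} (hX : IsNilpotent X) :
    bodyHom U d (IsNilpotent.exp X) = 1 := by
  rw [hX.map_exp (bodyHom U d), eq_zero_of_isNilpotent (hX.map (bodyHom U d)),
    IsNilpotent.exp_zero]

/-- The conjugate of f ⋆ need not have leading term f, but its value at 1 has body f ⋆ 1 = f,
because e^Y and e^{-Y} have body 1. -/
theorem IsNondegeneratePotential.exists_isLeading_body (hY : IsNondegeneratePotential Y)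
    (hC : IsNaturalStar C) (f : Smooth U) :
    ∃ g, IsLeading C (IsNilpotent.exp Y) g ∧ body g = f := by
  refine ⟨_, IsLeading.iff_act.2 ⟨_, _, hY.isRep_conj (fun K I n hn => ?_)
    (hC.isNaturalOp_coeffStarOp f) (compMat_act_coeffStarOp' f), rfl⟩, ?_⟩
  · rw [Matrix.diagonal_apply]
    split_ifs
    · rw [HahnSeries.C_apply, HahnSeries.coeff_single_of_ne hn.ne]
    · exact HahnSeries.coeff_zero
  · rw [act_opMul_mul_mul, mul_one]
    change (bodyHom U d _).coeff 0 = f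
    rw [map_mul, bodyHom_exp hY.nilpotent.neg, one_mul, bodyHom_eq_comp, compMat_act_coeffStarOp,
      ← bodyHom_eq_comp, bodyHom_exp hY.nilpotent, hC.star_one, HahnSeries.C_apply,
      HahnSeries.coeff_single_same]

end Potential

/-! ### All functions are leading terms -/

section Density

variable {m d : ℕ} {U : TopologicalSpace.Opens (Fin m → ℂ)}

theorem Smooth.isUnit_of_eval_ne_zero {f : Smooth U} (hf : ∀ x, Smooth.eval x f ≠ 0) :
    IsUnit f := by
  obtain ⟨F, hF, rfl⟩ := f.exists_restrict
  refine .of_mul_eq_one (Smooth.restrict U (fun x => (F x)⁻¹) (hF.inv fun x hx => hf ⟨x, hx⟩)) ?_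
  refine Smooth.ext_eval fun x => ?_
  rw [map_mul, map_one, Smooth.eval_restrict, Smooth.eval_restrict]
  exact mul_inv_cancel₀ (hf x)

variable {B : NonUnitalSubsemiring (SuperFun U d)}

theorem augIdeal_sq_le : augIdeal U d ^ 2 ≤ augIdeal U d := by
  rw [pow_two]
  exact augIdeal_mul_le

/-- The elements of the augmentation ideal that belong to `B` modulo the square of the ideal. -/
def modSquare (hB : ∀ f, ∃ g ∈ B, body g = f) : Submodule (Smooth U) (SuperFun U d) where
  carrier := {x | x ∈ augIdeal U d ∧ ∃ b ∈ B, x - b ∈ augIdeal U d ^ 2}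
  zero_mem' := ⟨zero_mem _, 0, zero_mem _, by rw [sub_zero]; exact zero_mem _⟩
  add_mem' := by
    rintro x y ⟨hx, b, hb, h⟩ ⟨hy, c, hc, h'⟩
    exact ⟨add_mem hx hy, b + c, add_mem hb hc, by rw [add_sub_add_comm]; exact add_mem h h'⟩
  smul_mem' := by
    rintro r x ⟨hx, b, hb, h⟩
    -- B need not be closed under multiplication by C^∞(U). The scalar r is replaced by an element g
    -- of B with body r; the error (r - g) b lies in the square of the ideal.
    obtain ⟨g, hg, rfl⟩ := hB r
    refine ⟨Submodule.smul_mem _ _ hx, g * b, mul_mem hg hb, ?_⟩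
    have h1 : b ∈ augIdeal U d := by
      have := sub_mem hx (augIdeal_sq_le h)
      rwa [sub_sub_cancel] at this
    have h2 : algebraMap _ _ (body g) - g ∈ augIdeal U d := by
      rw [mem_augIdeal, body_sub, body_algebraMap, sub_self]
    have h3 : body g • x - g * b = body g • (x - b) + (algebraMap _ _ (body g) - g) * b := by
      rw [sub_mul, ← Algebra.smul_def, smul_sub]
      abel
    rw [h3]
    refine add_mem (Submodule.smul_mem _ _ h) ?_
    rw [pow_two]
    exact Submodule.mul_mem_mul h2 h1

theorem mem_modSquare_of_mem (hB : ∀ f, ∃ g ∈ B, body g = f) {x : SuperFun U d} (hx : x ∈ B)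
    (h0 : body x = 0) : x ∈ modSquare hB :=
  ⟨h0, x, hx, by rw [sub_self]; exact zero_mem _⟩

theorem mem_modSquare_of_sub (hB : ∀ f, ∃ g ∈ B, body g = f) {x y : SuperFun U d}
    (hx : x ∈ modSquare hB) (h : x - y ∈ augIdeal U d ^ 2) : y ∈ modSquare hB := by
  obtain ⟨hx, b, hb, h'⟩ := hx
  refine ⟨?_, b, hb, ?_⟩
  · have := sub_mem hx (augIdeal_sq_le h)
    rwa [sub_sub_cancel] at this
  · have := sub_mem h' h
    rwa [sub_sub_sub_cancel_left] at this

/-- Modulo the square of the ideal everything is a combination of θ^α and θ̄^β. The θ^α are in B,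
and the linear part of η_α is a combination of the θ's plus ∑ M_{αβ} θ̄^β; inverting M gives each
θ̄^β. -/
theorem modSquare_eq (hB : ∀ f, ∃ g ∈ B, body g = f) (hθ : ∀ α, theta U α ∈ B)
    {η : Fin d → SuperFun U d} (hη : ∀ α, η α ∈ B) (hη0 : ∀ α, body (η α) = 0)
    (hdet : IsUnit (Matrix.of fun α β =>
      body (leftDeriv (LinearMap.proj (toLex (Sum.inr β))) (η α))).det)
    {x : SuperFun U d} (hx : body x = 0) : x ∈ modSquare hB := by
  set M := Matrix.of fun α β => body (leftDeriv (LinearMap.proj (toLex (Sum.inr β))) (η α)) with hM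
  have hsum : ∀ v : Fin d ⊕ₗ Fin d → Smooth U, v =
      (∑ α, v (toLex (.inl α)) • Pi.single (toLex (.inl α)) 1) +
        ∑ β, v (toLex (.inr β)) • Pi.single (toLex (.inr β)) 1 := by
    intro v
    have h1 := pi_eq_sum_univ' v
    rw [← Fintype.sum_equiv toLex (fun i => v (toLex i) • Pi.single (toLex i) 1) _ fun _ => rfl,
      Fintype.sum_sum_type] at h1
    exact h1
  let V := (modSquare hB).comap (ExteriorAlgebra.ι (Smooth U))
  have hV1 : ∀ α, (Pi.single (toLex (.inl α)) 1 : Fin d ⊕ₗ Fin d → Smooth U) ∈ V := fun α =>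
    mem_modSquare_of_mem hB (hθ α) (body_ι _)
  have hV2 : ∀ α, ∑ β, M α β • (Pi.single (toLex (.inr β)) 1 : Fin d ⊕ₗ Fin d → Smooth U) ∈ V := by
    intro α
    have h1 : (fun i => body (leftDeriv (LinearMap.proj i) (η α))) ∈ V :=
      mem_modSquare_of_sub hB (mem_modSquare_of_mem hB (hη α) (hη0 α))
        (sub_ι_mem_augIdeal_sq (hη0 α))
    rw [hsum fun i => body (leftDeriv (LinearMap.proj i) (η α))] at h1
    exact (Submodule.add_mem_iff_right _
      (Submodule.sum_mem _ fun β _ => Submodule.smul_mem _ _ (hV1 β))).1 h1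
  have hV3 : ∀ γ, (Pi.single (toLex (.inr γ)) 1 : Fin d ⊕ₗ Fin d → Smooth U) ∈ V := by
    intro γ
    have h1 : ∑ α, M⁻¹ γ α • ∑ β, M α β •
        (Pi.single (toLex (.inr β)) 1 : Fin d ⊕ₗ Fin d → Smooth U) ∈ V :=
      Submodule.sum_mem _ fun α _ => Submodule.smul_mem _ _ (hV2 α)
    simp only [Finset.smul_sum, smul_smul] at h1
    rw [Finset.sum_comm] at h1
    simp only [← Finset.sum_smul] at h1
    have h2 : ∀ β, ∑ α, M⁻¹ γ α * M α β = (1 : Matrix (Fin d) (Fin d) (Smooth U)) γ β := fun β => by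
      rw [← Matrix.nonsing_inv_mul M hdet, Matrix.mul_apply]
    simp only [h2, Matrix.one_apply, ite_smul, one_smul, zero_smul, Finset.sum_ite_eq,
      Finset.mem_univ, if_true] at h1
    exact h1
  have hV : ∀ v, ExteriorAlgebra.ι (Smooth U) v ∈ modSquare hB := by
    intro v
    change v ∈ V
    rw [hsum v]
    exact add_mem (Submodule.sum_mem _ fun β _ => Submodule.smul_mem _ _ (hV1 β))
      (Submodule.sum_mem _ fun β _ => Submodule.smul_mem _ _ (hV3 β))
  refine mem_modSquare_of_sub hB (hV fun i => body (leftDeriv (LinearMap.proj i) x)) ?_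
  rw [← neg_sub]
  exact neg_mem (sub_ι_mem_augIdeal_sq hx)

/-- A product a c is approximated factor by factor: a c - a' c' = (a - a') c + a' (c - c'), where a'
lies in the same power of the ideal as a. -/
theorem exists_sub_mem_pow (p : ∀ x ∈ augIdeal U d, ∃ b ∈ B, x - b ∈ augIdeal U d ^ 2) {k : ℕ}
    {x : SuperFun U d} (hx : x ∈ augIdeal U d ^ (k + 1)) :
    ∃ b ∈ B, x - b ∈ augIdeal U d ^ (k + 2) := by
  induction k generalizing x with
  | zero => exact p x (by rwa [zero_add, pow_one] at hx)
  | succ k ih =>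
    rw [pow_succ] at hx
    induction hx using Submodule.mul_induction_on' with
    | mem_mul_mem a ha c hc =>
      obtain ⟨a', ha', h1⟩ := ih ha
      obtain ⟨c', hc', h2⟩ := p c hc
      refine ⟨a' * c', mul_mem ha' hc', ?_⟩
      have h3 : a' ∈ augIdeal U d ^ (k + 1) := by
        have := sub_mem ha (augIdeal_pow_succ_le (by omega) h1)
        rwa [sub_sub_cancel] at this
      have h4 : a * c - a' * c' = (a - a') * c + a' * (c - c') := by
        rw [sub_mul, mul_sub]
        abel
      rw [h4]
      refine add_mem ?_ ?_
      · rw [pow_succ]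
        exact Submodule.mul_mem_mul h1 hc
      · rw [show k + 1 + 2 = (k + 1) + 2 by ring, pow_add]
        exact Submodule.mul_mem_mul h3 h2
    | add x _ y _ hx hy =>
      obtain ⟨b, hb, h⟩ := hx
      obtain ⟨c, hc, h'⟩ := hy
      exact ⟨b + c, add_mem hb hc, by rw [add_sub_add_comm]; exact add_mem h h'⟩

/-- A subring that contains `θ^α`, functions `η_α` whose linear parts together with `θ^α` generate
the odd functions modulo higher terms, and functions with an arbitrary value at `θ = θ̄ = 0`,
contains all functions. -/
theorem mem_of_isUnit_det (hB : ∀ f, ∃ g ∈ B, body g = f) (hθ : ∀ α, theta U α ∈ B)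
    {η : Fin d → SuperFun U d} (hη : ∀ α, η α ∈ B) (hη0 : ∀ α, body (η α) = 0)
    (hdet : IsUnit (Matrix.of fun α β =>
      body (leftDeriv (LinearMap.proj (toLex (Sum.inr β))) (η α))).det)
    (x : SuperFun U d) : x ∈ B := by
  have h2 : ∀ x ∈ augIdeal U d, ∃ b ∈ B, x - b ∈ augIdeal U d ^ 2 := fun x hx =>
    (modSquare_eq hB hθ hη hη0 hdet hx).2
  have key : ∀ k, ∃ b ∈ B, x - b ∈ augIdeal U d ^ (k + 1) := by
    intro k
    induction k with
    | zero =>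
      obtain ⟨b, hb, h⟩ := hB (body x)
      exact ⟨b, hb, by rw [zero_add, pow_one, mem_augIdeal, body_sub, h, sub_self]⟩
    | succ k ih =>
      obtain ⟨b, hb, h⟩ := ih
      obtain ⟨c, hc, h'⟩ := exists_sub_mem_pow h2 h
      exact ⟨b + c, add_mem hb hc, by rwa [← sub_sub]⟩
  obtain ⟨k, hk, h0⟩ := augIdeal_pow_eq_bot (U := U) (d := d)
  obtain ⟨b, hb, h⟩ := key (k - 1)
  rw [Nat.sub_add_cancel (by omega), h0, Submodule.mem_bot, sub_eq_zero] at h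
  rwa [h]

end Density

/-! ### Formal functions as values at 1 of natural operators, and a left inverse of the matrix of
e^Y -/

section LeadingTerms

variable {m d : ℕ} {U : TopologicalSpace.Opens (Fin m → ℂ)}
  {C : ℕ → Smooth U →ₗ[ℂ] Smooth U →ₗ[ℂ] Smooth U} {Y : LaurentSeries (SuperFun U d)}

theorem zero_matStar (G : CompMatrix U d) : matStar C 0 G = 0 := by
  have := add_matStar (C := C) 0 0 G
  rwa [add_zero, left_eq_add] at this

theorem isRep_zero (u : LaurentSeries (SuperFun U d)) : IsRep C u 0 0 where
  nonneg _ _ _ _ := rfl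
  natural := .zero
  comp_eq x := by
    rw [act_zero, mul_zero, zero_matStar]
    ext I J n
    exact map_zero (coeffIJ I J)

/-- The subring of leading terms. -/
def leadingTerms (hC : IsNaturalStar C) (u : LaurentSeries (SuperFun U d)) :
    NonUnitalSubsemiring (SuperFun U d) where
  carrier := {g | IsLeading C u g}
  zero_mem' := ⟨0, 0, isRep_zero u, rfl⟩
  add_mem' := IsLeading.add
  mul_mem' := IsLeading.mul hC

theorem IsNondegeneratePotential.isLeading (hY : IsNondegeneratePotential Y)
    (hC : IsNaturalStar C) (g : SuperFun U d) : IsLeading C (IsNilpotent.exp Y) g := by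
  have hodd : ∀ α, parity U d (dTheta α (Y.coeff (-1))) = -dTheta α (Y.coeff (-1)) := fun α => by
    rw [dTheta_eq, ← neg_eq_iff_eq_neg, ← leftDeriv_parity, hY.even]
  refine mem_of_isUnit_det (B := leadingTerms hC (IsNilpotent.exp Y))
    (fun f => hY.exists_isLeading_body hC f) (hY.isLeading_theta hC) (hY.isLeading_dTheta hC)
    (fun α => body_of_odd (hodd α)) (Smooth.isUnit_of_eval_ne_zero fun x => ?_) g
  rw [← AlgHom.coe_toRingHom, RingHom.map_det]
  convert hY.nondegenerate x using 2
  ext α β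
  simp only [RingHom.mapMatrix_apply, Matrix.map_apply, Matrix.of_apply, AlgHom.coe_toRingHom]
  -- On the odd function ∂Y_{-1}/∂θ^α the right and left derivatives in θ̄^β coincide, so this is
  -- the matrix of the nondegeneracy condition.
  rw [dThetaBarRight_eq, hodd, map_neg, neg_neg]
  rfl

variable (C Y) in
/-- The successive approximations to a matrix with given value `N 1`. -/
theorem IsNondegeneratePotential.exists_isRep_step (hY : IsNondegeneratePotential Y)
    (hC : IsNaturalStar C) (f : LaurentSeries (SuperFun U d)) (k : ℕ)
    (p : CompMatrix U d × LaurentSeries (Module.End ℂ (SuperFun U d)))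
    (hp : IsRep C (IsNilpotent.exp Y) p.1 p.2 ∧ ∀ n < (k : ℤ), (act p.2 1).coeff n = f.coeff n) :
    ∃ q : CompMatrix U d × LaurentSeries (Module.End ℂ (SuperFun U d)),
      (IsRep C (IsNilpotent.exp Y) q.1 q.2 ∧ ∀ n < ((k + 1 : ℕ) : ℤ),
        (act q.2 1).coeff n = f.coeff n) ∧
      (∀ K I, ∀ n < (k : ℤ), (q.1 K I).coeff n = (p.1 K I).coeff n) ∧
      ∀ n < (k : ℤ), q.2.coeff n = p.2.coeff n := by
  obtain ⟨hp1, hp2⟩ := hp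
  obtain ⟨F, N, h, hN⟩ := hY.isLeading hC (f.coeff k - (act p.2 1).coeff k)
  refine ⟨(p.1 + shiftMat k F, p.2 + HahnSeries.single (k : ℤ) 1 * N),
    ⟨hp1.add (h.shift k), fun n hn => ?_⟩, fun K I n hn => ?_, fun n hn => ?_⟩
  · rw [act_add, HahnSeries.coeff_add, act_single_mul, HahnSeries.coeff_single_mul, one_mul]
    rcases lt_or_eq_of_le (show n ≤ k by push_cast at hn; omega) with hn | rfl
    · rw [hp2 n hn, coeff_act_eq_zero (a := 0) (b := 0) (fun _ => h.natural.coeff_eq_zero)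
        (fun _ => coeff_one_of_neg) (by omega), add_zero]
    · rw [sub_self, h.natural.coeff_zero_act fun _ => coeff_one_of_neg, HahnSeries.coeff_one,
        if_pos rfl, hN, add_sub_cancel]
  · change ((p.1 K I) + HahnSeries.single (k : ℤ) 1 * F K I).coeff n = _
    rw [HahnSeries.coeff_add, HahnSeries.coeff_single_mul, h.nonneg K I _ (by omega), mul_zero,
      add_zero]
  · rw [HahnSeries.coeff_add, HahnSeries.coeff_single_mul, h.natural.coeff_eq_zero (by omega),
      mul_zero, add_zero]

/-- Every formal function without negative powers of `ν` is the value at `1` of a natural operator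
by which a matrix over the star algebra acts. -/
theorem IsNondegeneratePotential.exists_isRep (hY : IsNondegeneratePotential Y)
    (hC : IsNaturalStar C) {f : LaurentSeries (SuperFun U d)} (hf : ∀ n < 0, f.coeff n = 0) :
    ∃ F N, IsRep C (IsNilpotent.exp Y) F N ∧ act N 1 = f := by
  let X := CompMatrix U d × LaurentSeries (Module.End ℂ (SuperFun U d))
  let P : ℕ → X → Prop := fun k p => IsRep C (IsNilpotent.exp Y) p.1 p.2 ∧
    ∀ n < (k : ℤ), (act p.2 1).coeff n = f.coeff n
  choose! next h1 h2 h3 using fun k p => hY.exists_isRep_step C Y hC f k p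
  -- The start (0, 0) is admissible because f has no negative powers of ν.
  let s : ℕ → X := fun k => Nat.rec 0 next k
  have hs : ∀ k, P k (s k) := by
    intro k
    induction k with
    | zero =>
      refine ⟨isRep_zero _, fun n hn => ?_⟩
      rw [hf n (by simpa using hn)]
      change (act 0 1).coeff n = 0
      rw [act_zero, HahnSeries.coeff_zero]
    | succ k ih => exact h1 k _ ih
  have hF : ∀ k l : ℕ, k ≤ l → (∀ K I, ∀ n < (k : ℤ), ((s l).1 K I).coeff n =
      ((s k).1 K I).coeff n) ∧ ∀ n < (k : ℤ), (s l).2.coeff n = (s k).2.coeff n := by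
    intro k l hkl
    induction l, hkl using Nat.le_induction with
    | base => exact ⟨fun _ _ _ _ => rfl, fun _ _ => rfl⟩
    | succ l hl ih =>
      exact ⟨fun K I n hn => (h2 l _ (hs l) K I n (by omega)).trans (ih.1 K I n hn),
        fun n hn => (h3 l _ (hs l) n (by omega)).trans (ih.2 n hn)⟩
  -- The limit takes its coefficient at ν^n from stage n + 1, from which on that coefficient no
  -- longer changes.
  have hbF : ∀ K I, BddBelow (Function.support fun n : ℤ => ((s (n + 1).toNat).1 K I).coeff n) :=
    fun K I => ⟨0, fun n hn => by
      by_contra hlt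
      exact hn ((hs _).1.nonneg K I n (by omega))⟩
  have hbN : BddBelow (Function.support fun n : ℤ => (s (n + 1).toNat).2.coeff n) :=
    ⟨0, fun n hn => by
      by_contra hlt
      exact hn ((hs _).1.natural.coeff_eq_zero (by omega))⟩
  let F : CompMatrix U d := Matrix.of fun K I => HahnSeries.ofSuppBddBelow _ (hbF K I)
  let N : LaurentSeries (Module.End ℂ (SuperFun U d)) := HahnSeries.ofSuppBddBelow _ hbN
  have hlF : ∀ (k : ℕ) K I, ∀ n < (k : ℤ), (F K I).coeff n = ((s k).1 K I).coeff n := by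
    intro k K I n hn
    exact ((hF (n + 1).toNat k (by omega)).1 K I n (by omega)).symm
  have hlN : ∀ (k : ℕ), ∀ n < (k : ℤ), N.coeff n = (s k).2.coeff n := by
    intro k n hn
    exact ((hF (n + 1).toNat k (by omega)).2 n (by omega)).symm
  refine ⟨F, N, IsRep.of_limit (fun k => (hs k).1) hlF hlN, ?_⟩
  ext n
  rw [coeff_act_congr (hlN (n + 1).toNat) (fun _ => coeff_one_of_neg) (by omega)]
  exact (hs _).2 n (by omega)

theorem single_mul_single_mul {R : Type*} [Semiring R] (k : ℤ) (x : LaurentSeries R) :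
    HahnSeries.single (-k) 1 * (HahnSeries.single k 1 * x) = x := by
  rw [← mul_assoc, HahnSeries.single_mul_single, neg_add_cancel, mul_one,
    HahnSeries.single_zero_one, one_mul]

/-- The matrix of components of the exponential of a nondegenerate potential has a left inverse. -/
theorem IsNondegeneratePotential.exists_matStar_eq_one (hY : IsNondegeneratePotential Y)
    (hC : IsNaturalStar C) : ∃ F, matStar C F (compMat (IsNilpotent.exp Y)) = 1 := by
  -- Chosen so that the component matrix of e^Y f is the identity. The factor ν^{-a} removes
  -- negative powers of ν and is compensated in the inverse by ν^a.
  let f := IsNilpotent.exp (-Y) * ofComp (1 : CompMatrix U d)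
  obtain ⟨a, ha⟩ := exists_coeff_eq_zero_of_lt f
  obtain ⟨F, N, h, hN⟩ := hY.exists_isRep hC (f := HahnSeries.single (-a) 1 * f) fun n hn => by
    rw [HahnSeries.coeff_single_mul, ha _ (by omega), mul_zero]
  refine ⟨shiftMat a F, ?_⟩
  have h1 := h.comp_eq 1
  rw [mul_one, hN, mul_single_mul, compMat_single_mul, ← mul_assoc,
    IsNilpotent.exp_mul_exp_neg_self hY.nilpotent, one_mul, compMat_ofComp] at h1
  rw [shiftMat_matStar, ← h1]
  ext1 I J
  have := single_mul_single_mul (-a) ((1 : CompMatrix U d) I J)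
  rwa [neg_neg] at this

end LeadingTerms

/-! ### Interchanging the odd coordinates `θ` and `θ̄` -/

section Mirror

variable {m d : ℕ} {U : TopologicalSpace.Opens (Fin m → ℂ)}

theorem linearMap_ext_monomial {M : Type*} [AddCommMonoid M] [Module (Smooth U) M]
    {S T : SuperFun U d →ₗ[Smooth U] M} (h : ∀ I J, S (monomial U I J) = T (monomial U I J)) :
    S = T := by
  refine (superBasis U d).ext fun s => ?_
  obtain ⟨⟨I, J⟩, rfl⟩ := (pairEquiv d).surjective s
  rw [pairEquiv_apply, superBasis_pairIndex, h]

theorem prod_map_ι_mul {ι : Type*} (v : ι → Fin d ⊕ₗ Fin d → Smooth U) {x : SuperFun U d} {c : ℤ}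
    (hx : parity U d x = c • x) (l : List ι) :
    (l.map fun i => ExteriorAlgebra.ι (Smooth U) (v i)).prod * x =
      c ^ l.length • (x * (l.map fun i => ExteriorAlgebra.ι (Smooth U) (v i)).prod) := by
  induction l with
  | nil => simp
  | cons i l ih =>
    rw [List.map_cons, List.prod_cons, mul_assoc, ih, mul_smul_comm, ← mul_assoc,
      ι_mul_eq_parity_mul_ι, hx, smul_mul_assoc, smul_mul_assoc, smul_smul, List.length_cons,
      pow_succ, mul_assoc]

theorem parity_prod_map_ι {ι : Type*} (v : ι → Fin d ⊕ₗ Fin d → Smooth U) (l : List ι) :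
    parity U d (l.map fun i => ExteriorAlgebra.ι (Smooth U) (v i)).prod =
      (-1 : ℤ) ^ l.length • (l.map fun i => ExteriorAlgebra.ι (Smooth U) (v i)).prod := by
  induction l with
  | nil => simp
  | cons i l ih =>
    rw [List.map_cons, List.prod_cons, map_mul, ih, parity_ι, List.length_cons, pow_succ,
      mul_neg_one, neg_smul, neg_mul, mul_smul_comm]

theorem parity_monomial (I J : Finset (Fin d)) :
    parity U d (monomial U I J) = (-1 : ℤ) ^ (I.card + J.card) • monomial U I J := by
  have h1 := parity_prod_map_ι
    (fun α => (Pi.single (toLex (Sum.inl α)) 1 : Fin d ⊕ₗ Fin d → Smooth U)) I.sort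
  have h2 := parity_prod_map_ι
    (fun α => (Pi.single (toLex (Sum.inr α)) 1 : Fin d ⊕ₗ Fin d → Smooth U)) J.sort
  rw [Finset.length_sort] at h1 h2
  rw [monomial, map_mul]
  refine (congrArg₂ (· * ·) h1 h2).trans ?_
  rw [smul_mul_smul_comm, ← pow_add]
  rfl

theorem coeffIJ_parity (I J : Finset (Fin d)) (x : SuperFun U d) :
    coeffIJ I J (parity U d x) = (-1 : ℤ) ^ (I.card + J.card) • coeffIJ I J x := by
  have : coeffIJ I J ∘ₗ (CliffordAlgebra.involute (Q := (0 : QuadraticForm (Smooth U)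
      (Fin d ⊕ₗ Fin d → Smooth U)))).toLinearMap = (-1 : ℤ) ^ (I.card + J.card) • coeffIJ I J := by
    refine linearMap_ext_monomial fun K L => ?_
    refine (congrArg (coeffIJ I J) (parity_monomial K L)).trans ?_
    rw [map_zsmul, LinearMap.smul_apply, coeffIJ_monomial]
    split_ifs with h
    · rw [h.1, h.2]
    · rw [smul_zero, smul_zero]
  exact LinearMap.congr_fun this x

/-- The interchange of the coordinates `θ^α` and `θ̄^α`, on vectors. -/
def swapVec (U : TopologicalSpace.Opens (Fin m → ℂ)) (d : ℕ) :
    (Fin d ⊕ₗ Fin d → Smooth U) →ₗ[Smooth U] (Fin d ⊕ₗ Fin d → Smooth U) :=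
  LinearMap.funLeft (Smooth U) (Smooth U) fun i => toLex (ofLex i).swap

theorem swapVec_single (i : Fin d ⊕ₗ Fin d) :
    swapVec U d (Pi.single i 1) = Pi.single (toLex (ofLex i).swap) 1 := by
  ext1 j
  rw [swapVec, LinearMap.funLeft_apply, Pi.single_apply, Pi.single_apply]
  congr 1
  rw [eq_iff_iff]
  constructor
  · rintro rfl
    rw [ofLex_toLex, Sum.swap_swap, toLex_ofLex]
  · rintro rfl
    rw [ofLex_toLex, Sum.swap_swap, toLex_ofLex]

/-- The automorphism that interchanges `θ^α` and `θ̄^α`. -/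
def mirror (U : TopologicalSpace.Opens (Fin m → ℂ)) (d : ℕ) :
    SuperFun U d →ₐ[Smooth U] SuperFun U d :=
  ExteriorAlgebra.map (swapVec U d)

theorem mirror_ι (v : Fin d ⊕ₗ Fin d → Smooth U) :
    mirror U d (ExteriorAlgebra.ι _ v) = ExteriorAlgebra.ι _ (swapVec U d v) :=
  ExteriorAlgebra.map_apply_ι _ v

theorem mirror_theta (α : Fin d) : mirror U d (theta U α) = thetaBar U α := by
  rw [theta, mirror_ι, swapVec_single]
  rfl

theorem mirror_thetaBar (α : Fin d) : mirror U d (thetaBar U α) = theta U α := by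
  rw [thetaBar, mirror_ι, swapVec_single]
  rfl

theorem mirror_monomial (I J : Finset (Fin d)) :
    mirror U d (monomial U I J) = (-1 : ℤ) ^ (I.card * J.card) • monomial U J I := by
  have h1 := parity_prod_map_ι
    (fun α => (Pi.single (toLex (Sum.inl α)) 1 : Fin d ⊕ₗ Fin d → Smooth U)) J.sort
  have h2 := prod_map_ι_mul
    (fun α => (Pi.single (toLex (Sum.inr α)) 1 : Fin d ⊕ₗ Fin d → Smooth U)) h1 I.sort
  rw [Finset.length_sort, Finset.length_sort, ← pow_mul, mul_comm] at h2
  rw [monomial, map_mul, map_list_prod, map_list_prod, List.map_map, List.map_map,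
    show ⇑(mirror U d) ∘ theta U = thetaBar U from funext mirror_theta,
    show ⇑(mirror U d) ∘ thetaBar U = theta U from funext mirror_thetaBar]
  exact h2

theorem coeffIJ_mirror (I J : Finset (Fin d)) (x : SuperFun U d) :
    coeffIJ I J (mirror U d x) = (-1 : ℤ) ^ (I.card * J.card) • coeffIJ J I x := by
  have : coeffIJ I J ∘ₗ (mirror U d).toLinearMap =
      (-1 : ℤ) ^ (I.card * J.card) • coeffIJ J I := by
    refine linearMap_ext_monomial fun K L => ?_
    refine (congrArg (coeffIJ I J) (mirror_monomial K L)).trans ?_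
    rw [map_zsmul, LinearMap.smul_apply, coeffIJ_monomial, coeffIJ_monomial]
    by_cases h : K = J ∧ L = I
    · rw [if_pos h, if_pos h.symm, h.1, h.2, mul_comm]
    · rw [if_neg h, if_neg fun h' => h h'.symm, smul_zero, smul_zero]
  exact LinearMap.congr_fun this x

/-- For even x only index sets with |I| ≡ |J| mod 2 contribute, and then (-1)^{|I||J|} = (-1)^{|I|}.
A sign depending on one index can be absorbed into an inverse matrix. -/
theorem coeffIJ_mirror_of_even {x : SuperFun U d} (hx : parity U d x = x) (I J : Finset (Fin d)) :
    coeffIJ I J (mirror U d x) = (-1 : ℤ) ^ I.card • coeffIJ J I x := by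
  rw [coeffIJ_mirror]
  rcases Nat.even_or_odd (J.card + I.card) with h | h
  · congr 1
    rw [Nat.even_add] at h
    by_cases hI : Even I.card
    · rw [hI.neg_one_pow, (hI.mul_right _).neg_one_pow]
    · have hJ := Nat.not_even_iff_odd.1 fun hJ => hI (h.1 hJ)
      rw [Nat.not_even_iff_odd] at hI
      rw [hI.neg_one_pow, (hI.mul hJ).neg_one_pow]
  · have h1 := coeffIJ_parity J I x
    rw [hx, h.neg_one_pow, neg_one_smul, eq_neg_iff_add_eq_zero, ← two_smul ℂ] at h1
    rw [(smul_eq_zero_iff_right two_ne_zero).1 h1, smul_zero, smul_zero]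

theorem parity_mirror (x : SuperFun U d) :
    parity U d (mirror U d x) = mirror U d (parity U d x) := by
  induction x using ExteriorAlgebra.induction with
  | algebraMap r => rw [parity_algebraMap, AlgHom.commutes, parity_algebraMap]
  | ι w => rw [parity_ι, map_neg, mirror_ι, parity_ι]
  | mul a b ha hb => rw [map_mul, map_mul, map_mul, map_mul, ha, hb]
  | add a b ha hb => rw [map_add, map_add, map_add, map_add, ha, hb]

theorem body_mirror (x : SuperFun U d) : body (mirror U d x) = body x := by
  induction x using ExteriorAlgebra.induction with
  | algebraMap r => rw [AlgHom.commutes]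
  | ι w => rw [mirror_ι, body_ι, body_ι]
  | mul a b ha hb => rw [map_mul, body_mul, ha, hb, body_mul]
  | add a b ha hb => rw [map_add, body_add, ha, hb, body_add]

theorem leftDeriv_mirror (δ : Module.Dual (Smooth U) (Fin d ⊕ₗ Fin d → Smooth U))
    (x : SuperFun U d) :
    leftDeriv δ (mirror U d x) = mirror U d (leftDeriv (δ ∘ₗ swapVec U d) x) := by
  induction x using ExteriorAlgebra.induction with
  | algebraMap r => rw [AlgHom.commutes, leftDeriv_algebraMap, leftDeriv_algebraMap, map_zero]
  | ι w => rw [mirror_ι, leftDeriv_ι, leftDeriv_ι, AlgHom.commutes, LinearMap.comp_apply]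
  | mul a b ha hb =>
    rw [map_mul, leftDeriv_mul, ha, hb, leftDeriv_mul, map_add, map_mul, map_mul, parity_mirror]
  | add a b ha hb => rw [map_add, map_add, ha, hb, map_add, map_add]

theorem leftDeriv_leftDeriv_comm (δ δ' : Module.Dual (Smooth U) (Fin d ⊕ₗ Fin d → Smooth U))
    (x : SuperFun U d) : leftDeriv δ (leftDeriv δ' x) = -leftDeriv δ' (leftDeriv δ x) :=
  CliffordAlgebra.contractLeft_comm _ _ _

theorem body_dThetaBarRight_dTheta {y : SuperFun U d} (hy : parity U d y = y) (α β : Fin d) :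
    body (dThetaBarRight β (dTheta α y)) = body (leftDeriv (LinearMap.proj (toLex (Sum.inr β)))
      (leftDeriv (LinearMap.proj (toLex (Sum.inl α))) y)) := by
  have h := leftDeriv_parity (LinearMap.proj (toLex (Sum.inl α))) y
  rw [hy, eq_neg_iff_add_eq_zero, add_comm, ← eq_neg_iff_add_eq_zero] at h
  rw [dThetaBarRight_eq, dTheta_eq, h, map_neg, neg_neg]

theorem body_dThetaBarRight_dTheta_mirror {y : SuperFun U d} (hy : parity U d y = y)
    (α β : Fin d) : body (dThetaBarRight β (dTheta α (mirror U d y))) =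
      -body (dThetaBarRight α (dTheta β y)) := by
  rw [body_dThetaBarRight_dTheta (by rw [parity_mirror, hy]), body_dThetaBarRight_dTheta hy,
    leftDeriv_mirror, leftDeriv_mirror, body_mirror, leftDeriv_leftDeriv_comm, body_neg]
  rfl

variable {Y : LaurentSeries (SuperFun U d)}

/-- The matrix of second derivatives of the mirrored Y_{-1} is minus the transpose of the original
one, because left derivatives anticommute. -/
theorem IsNondegeneratePotential.mirror (hY : IsNondegeneratePotential Y) :
    IsNondegeneratePotential (laurentMap (mirror U d).toRingHom Y) where
  coeff_eq_zero n hn := by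
    rw [coeff_laurentMap, hY.coeff_eq_zero n hn, map_zero]
  even n := by
    rw [coeff_laurentMap]
    exact (parity_mirror _).trans (congrArg (SuperStar.mirror U d) (hY.even n))
  nilpotent := hY.nilpotent.map _
  nondegenerate x := by
    set M := Matrix.of fun α β : Fin d =>
      body (dThetaBarRight β (dTheta α (Y.coeff (-1)))) x
    have h : (Matrix.of fun α β : Fin d => body (dThetaBarRight β (dTheta α
        ((laurentMap (SuperStar.mirror U d).toRingHom Y).coeff (-1)))) x) = -M.transpose := by
      ext α β
      have h1 := congrArg (Smooth.eval x) (body_dThetaBarRight_dTheta_mirror (hY.even (-1)) α β)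
      rw [map_neg] at h1
      exact h1
    rw [h, Matrix.det_neg, Matrix.det_transpose]
    exact mul_ne_zero (pow_ne_zero _ (neg_ne_zero.2 one_ne_zero)) (hY.nondegenerate x)

variable {C : ℕ → Smooth U →ₗ[ℂ] Smooth U →ₗ[ℂ] Smooth U}

theorem compMat_mirror {u : LaurentSeries (SuperFun U d)} (hu : IsEven u) (I J : Finset (Fin d)) :
    compMat (laurentMap (mirror U d).toRingHom u) I J = (-1 : ℤ) ^ I.card • compMat u J I := by
  ext n
  rw [HahnSeries.coeff_smul]
  exact coeffIJ_mirror_of_even (hu n) I J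

theorem zsmul_starMul (c : ℤ) (f g : LaurentSeries (Smooth U)) :
    starMul C (c • f) g = starMul C f (c • g) :=
  (map_zsmul (AddMonoidHom.mk' (fun f => starMul C f g) fun _ _ => add_starMul _ _ _) c f).trans
    (map_zsmul (AddMonoidHom.mk' (starMul C f) (starMul_add f)) c g).symm

/-- The matrix of components of the exponential of a nondegenerate potential has a right
inverse. -/
theorem IsNondegeneratePotential.exists_matStar_eq_one' (hY : IsNondegeneratePotential Y)
    (hC : IsNaturalStar fun r => (C r).flip) :
    ∃ F, matStar C (compMat (IsNilpotent.exp Y)) F = 1 := by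
  -- Up to row signs the mirrored function has the transposed component matrix. Transposition
  -- together with the opposite product turns a left inverse into a right one, and the signs move
  -- into it.
  obtain ⟨F, hF⟩ := hY.mirror.exists_matStar_eq_one hC
  rw [← hY.nilpotent.map_exp (laurentMap (SuperStar.mirror U d).toRingHom)] at hF
  refine ⟨Matrix.of fun I K => (-1 : ℤ) ^ I.card • F K I, ?_⟩
  ext1 J K
  have h := congrFun (congrFun hF K) J
  rw [matStar_apply] at h
  simp only [starMul_flip, compMat_mirror (isEven_exp hY.even hY.nilpotent), zsmul_starMul] at h
  exact h.trans (congrFun (congrFun Matrix.transpose_one J) K)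

/-- The matrix of components of the exponential of a nondegenerate potential is invertible. -/
theorem IsNondegeneratePotential.exists_inverse (hY : IsNondegeneratePotential Y)
    (hC : IsNaturalStar C) (hC' : IsNaturalStar fun r => (C r).flip) :
    ∃ v, matStar C (compMat (IsNilpotent.exp Y)) v = 1 ∧
      matStar C v (compMat (IsNilpotent.exp Y)) = 1 := by
  obtain ⟨v, hv⟩ := hY.exists_matStar_eq_one' hC'
  obtain ⟨w, hw⟩ := hY.exists_matStar_eq_one hC
  refine ⟨v, hv, ?_⟩
  have h := hC.matStar_assoc w (compMat (IsNilpotent.exp Y)) v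
  rw [hw, hv, hC.one_matStar, hC.matStar_one] at h
  rwa [h]

end Mirror

/-! ### The product associated with a star product and a potential -/

section Product

variable {m d : ℕ} {U : TopologicalSpace.Opens (Fin m → ℂ)} {S : StarProductSV U}
  {u : LaurentSeries (SuperFun U d)}

theorem IsNondegeneratePotential.isAdmissible {Y : LaurentSeries (SuperFun U d)}
    (hY : IsNondegeneratePotential Y) : IsAdmissible S (IsNilpotent.exp Y) :=
  ⟨isEven_exp hY.even hY.nilpotent, (bodyHom_eq_comp _).symm.trans (bodyHom_exp hY.nilpotent),
    hY.exists_inverse (.of_starProductSV S) (.of_starProductSV_flip S)⟩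

theorem compMat_mul_ofMatrix (hu : IsUnit u) (F : CompMatrix U d) :
    compMat (u * ofMatrix S u F) = matStar S.C F (compMat u) := by
  rw [ofMatrix, Ring.mul_inverse_cancel_left _ _ hu]
  exact compMat_ofComp _

theorem ofMatrix_eq_iff (hu : IsUnit u) (F : CompMatrix U d) (f : LaurentSeries (SuperFun U d)) :
    ofMatrix S u F = f ↔ matStar S.C F (compMat u) = compMat (u * f) := by
  rw [← compMat_mul_ofMatrix hu, compMat_injective.eq_iff, hu.mul_right_inj]

theorem IsAdmissible.bijective_ofMatrix (h : IsAdmissible S u) (hu : IsUnit u) :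
    Function.Bijective (ofMatrix S u) := by
  obtain ⟨-, -, v, huv, hvu⟩ := h
  have hC := IsNaturalStar.of_starProductSV S
  refine ⟨fun F G hFG => ?_, fun f => ⟨matStar S.C (compMat (u * f)) v, ?_⟩⟩
  · have h1 := (compMat_mul_ofMatrix hu F).symm.trans
      ((congrArg (fun x => compMat (u * x)) hFG).trans (compMat_mul_ofMatrix hu G))
    have h2 := congrArg (fun X => matStar S.C X v) h1
    simp only [hC.matStar_assoc] at h2
    rw [show matStar S.C (compMat u) v = 1 from huv, hC.matStar_one, hC.matStar_one] at h2
    exact h2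
  · rw [ofMatrix_eq_iff hu, hC.matStar_assoc, show matStar S.C v (compMat u) = 1 from hvu,
      hC.matStar_one]

/-- The identity matrix corresponds to the function 1, which is therefore a right unit; this
recovers f from L_f. -/
theorem IsAdmissible.leftMul_one (h : IsAdmissible S u) (hu : IsUnit u)
    (f : LaurentSeries (SuperFun U d)) : leftMul S u f 1 = f := by
  have hC := IsNaturalStar.of_starProductSV S
  have hb := h.bijective_ofMatrix hu
  have h1 : ofMatrix S u (1 : CompMatrix U d) = 1 := by
    rw [ofMatrix_eq_iff hu, hC.one_matStar, mul_one]
  have h2 : Function.invFun (ofMatrix S u) 1 = (1 : CompMatrix U d) := by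
    conv_lhs => rw [← h1]
    exact Function.leftInverse_invFun hb.1 1
  rw [leftMul, h2, matMul_eq_matStar, hC.matStar_one]
  exact Function.invFun_eq (hb.2 f)

/-- The matrix F corresponds to the function N 1, and both operators multiply the component matrix
of u g by F from the left. -/
theorem IsAdmissible.leftMul_eq_act (h : IsAdmissible S u) (hu : IsUnit u) {F : CompMatrix U d}
    {N : LaurentSeries (Module.End ℂ (SuperFun U d))} (hN : IsRep S.C u F N)
    (g : LaurentSeries (SuperFun U d)) : leftMul S u (act N 1) g = act N g := by
  have hC := IsNaturalStar.of_starProductSV S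
  have hb := h.bijective_ofMatrix hu
  have h1 : ofMatrix S u F = act N 1 := by
    rw [ofMatrix_eq_iff hu, hN.comp_eq, mul_one]
  have h2 : Function.invFun (ofMatrix S u) (act N 1) = F := by
    rw [← h1]
    exact Function.leftInverse_invFun hb.1 F
  rw [leftMul, h2, matMul_eq_matStar, ofMatrix_eq_iff hu, hC.matStar_assoc, hN.comp_eq,
    ← compMat_mul_ofMatrix hu, Function.invFun_eq (hb.2 g)]

theorem IsNaturalOp.isNatural_act {N : LaurentSeries (Module.End ℂ (SuperFun U d))}
    (hN : IsNaturalOp (parity U d) N) : IsNatural (parity U d) (act N) := by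
  refine ⟨fun k => N.coeff k, fun k => diffOpOrderLE_iff_lt.2 (hN k), fun g n => ?_⟩
  obtain ⟨b, hb⟩ := exists_coeff_eq_zero_of_lt g
  rw [coeff_act (fun _ => hN.coeff_eq_zero) hb,
    finsum_eq_sum_of_support_subset (s := (Finset.Icc 0 (n - b)).image Int.toNat)]
  · refine Finset.sum_bij' (fun k _ => k.toNat) (fun k _ => (k : ℤ)) ?_ ?_ ?_ ?_ ?_ <;>
      intro k hk <;> simp only [Finset.mem_image, Finset.mem_Icc] at hk ⊢
    · exact ⟨k, hk, rfl⟩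
    · obtain ⟨j, hj, rfl⟩ := hk
      omega
    · omega
    · omega
    · rw [Int.toNat_of_nonneg hk.1]
  · intro k hk
    simp only [Finset.coe_image, Finset.coe_Icc, Set.mem_image, Set.mem_Icc]
    refine ⟨k, ⟨by positivity, ?_⟩, Int.toNat_natCast k⟩
    by_contra hlt
    exact hk (by dsimp only; rw [hb _ (by omega), map_zero])

/-- Applied to L_f with L_f 1 = f, this gives the necessity of the condition on f. -/
theorem IsNatural.coeff_one_eq_zero
    {T : LaurentSeries (SuperFun U d) → LaurentSeries (SuperFun U d)}
    (h : IsNatural (parity U d) T) {n : ℤ} (hn : n < 0) : (T 1).coeff n = 0 := by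
  obtain ⟨D, -, hD⟩ := h
  rw [hD]
  refine finsum_eq_zero_of_forall_eq_zero fun k => ?_
  rw [coeff_one_of_neg (by omega), map_zero]

end Product

end
end SuperStar

open SuperStar
theorem propositionP {m d : ℕ} (U : TopologicalSpace.Opens (Fin m → ℂ))
    (S : StarProductSV U) (Y : LaurentSeries (SuperFun U d))
    (hY : IsNondegeneratePotential Y) :
    IsAdmissible S (IsNilpotent.exp Y) ∧
      ∀ f : LaurentSeries (SuperFun U d),
        IsNatural (parity U d) (leftMul S (IsNilpotent.exp Y) f) ↔
          ∀ n < (0 : ℤ), f.coeff n = 0 := by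
  have hu : IsUnit (IsNilpotent.exp Y) := IsNilpotent.isUnit_exp hY.nilpotent
  have ha : IsAdmissible S (IsNilpotent.exp Y) := hY.isAdmissible
  refine ⟨ha, fun f => ⟨fun h n hn => ?_, fun hf => ?_⟩⟩
  · rw [← ha.leftMul_one hu f]
    exact h.coeff_one_eq_zero hn
  · obtain ⟨F, N, h, rfl⟩ := hY.exists_isRep (.of_starProductSV S) hf
    rw [show leftMul S (IsNilpotent.exp Y) (act N 1) = act N from funext (ha.leftMul_eq_act hu h)]
    exact h.natural.isNatural_act
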